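/- **Setting.** Fix $t>0$, $M>1$, $a_0>0$ with $a_0M<\pi/6$, and a smooth $\chi:\mathbb R\to\mathbb R$ with $\chi(s)=1$ for $s\le a_0$ and $\chi(s)=0$ for $s\ge a_0M$. Let $\vec\delta_1=(1,0)$, $\vec\delta_{2,3}=\frac12(-1,\pm\sqrt3)$, $\vec b_{1,2}=\frac{2\pi}{3}(1,\pm\sqrt3)$, $\Lambda^*=\mathbb Z\vec b_1+\mathbb Z\vec b_2$, $\vec p_F^{\,\pm}=(\frac{2\pi}3,\pm\frac{2\pi}{3\sqrt3})$, $\Omega(\vec k)=\sum_{j=1}^3e^{i\vec k\cdot(\vec\delta_j-\vec\delta_1)}$. For $\beta>0$, an integer $L\ge1$, an integer $h^*<0$ and $K\in\mathbb N$ put $|\Lambda|=L^2$, $\mathcal A_\Lambda=\frac{3\sqrt3}2L^2$, $\chi_K(s)=\chi(M^{-K}|s|)$, $\chi_{[h^*,0]}(s)=\chi(s)-\chi(M^{-h^*}s)$. Fermionic momenta are $\mathbf k=(k_0,\vec k)$ with $k_0\in\frac{2\pi}\beta(\mathbb Z+\frac12)$ and $\vec k=\frac{n_1}L\vec b_1+\frac{n_2}L\vec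 b_2$, $0\le n_i<L$; photon momenta are $\mathbf p=(p_0,\vec p)$ with $p_0\in\frac{2\pi}\beta\mathbb Z$, $\vec p=\frac{n_1}L\vec b_1+\frac{n_2}L\vec b_2$, $n_i\in\mathbb Z$. Write $\int\frac{d\mathbf k}D=(\beta|\Lambda|)^{-1}\sum_{\mathbf k}$, $\int\frac{d\mathbf p}{(2\pi)^3}=(\beta\mathcal A_\Lambda)^{-1}\sum_{\mathbf p}$, and let $\delta(\mathbf q)$ be $\beta|\Lambda|$ if $q_0=0$, $\vec q\in\Lambda^*$, and $0$ otherwise. Only momenta with $|k_0|,|p_0|<a_0M^{K+1}$, $|\vec p|<a_0M$ are kept; all propagators below vanish outside this range. **Propagators.** Let $$\hat g(\mathbf k)=\chi_K(k_0)\begin{pmatrix}-ik_0&-t\,\overline{\Omega(\vec k)}\\-t\,\Omega(\vec k)&-ik_0\end{pmatrix}^{-1},\qquad \hat g^{(u.v.)}(\mathbf k)=\Big(1-\sum_{\omega=\pm}\chi(|\mathbf k-\mathbf p_F^\omega|)\Big)\hat g(\mathbf k),$$ with $\mathbf p_F^\omega=(0,\vec p_F^{\,\omega})$ and spatial distances taken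 modulo $\Lambda^*$. With $\underline p=(\vec p,p_3)$ let $\hat w^{(u.v.)}=\hat w-\hat w^{(i.r.)}$, where $$\hat w(\mathbf p)=\int_{\mathbb R}\frac{dp_3}{2\pi}\frac{\chi_K(p_0)\chi_{[h^*,0]}(|\underline p|)}{\mathbf p^2+p_3^2},\qquad \hat w^{(i.r.)}(\mathbf p)=\int_{-a_0M}^{a_0M}\frac{dp_3}{2\pi}\frac{\chi(|\mathbf p|)-\chi_K(p_0)\chi(M^{-h^*}|\underline p|)}{\mathbf p^2+p_3^2}.$$ (For $|\mathbf p|\ge a_0M^{h^*+1}$ one has $\hat w^{(i.r.)}(\mathbf p)=\frac{\chi_{[h^*,0]}(|\mathbf p|)}{\pi|\mathbf p|}\arctan\frac{a_0M}{|\mathbf p|}$.) **Interaction.** For Grassmann variables $\hat\Psi^\pm_{\mathbf k,\sigma,\rho}$ ($\sigma=\uparrow,\downarrow$; $\rho=1,2$) and commuting variables $\hat A_{\mu,\mathbf p}$ ($\mu=0,1,2$) let $V(\Psi,A)$ be the formal power series in the charge $e$ $$V=\sum_{N\ge1}e^N\sum_{\sigma,\rho,\rho',\underline\mu}\int\frac{d\mathbf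 k\,d\mathbf k'}{D^2}\frac{d\mathbf p_1\cdots d\mathbf p_N}{(2\pi)^{3N}}\,\hat\Psi^+_{\mathbf k,\sigma,\rho}\hat\Psi^-_{\mathbf k',\sigma,\rho'}\prod_{i=1}^N\hat A_{\mu_i,\mathbf p_i}\;v^{(N)}_{\rho\rho'\underline\mu}\;\delta\Big(\mathbf k-\mathbf k'-\sum_i\mathbf p_i\Big),$$ where, with $\eta_j(\vec p)=\int_0^1e^{-is\vec p\cdot\vec\delta_j}ds$ and $\delta_{j,\mu}$ the components of $(0,\vec\delta_j)$, $$v^{(N)}_{12\underline\mu}=\frac{t\,i^N}{N!}\sum_je^{-i\vec k'\cdot(\vec\delta_j-\vec\delta_1)}\prod_i\eta_j(\vec p_i)\delta_{j,\mu_i},\qquad v^{(N)}_{21\underline\mu}=\frac{t\,(-i)^N}{N!}\sum_je^{i\vec k\cdot(\vec\delta_j-\vec\delta_1)}\prod_i\eta_j(\vec p_i)\delta_{j,\mu_i},$$ $v^{(1)}_{11\mu}=-i\,\delta_{\mu,0}$, $v^{(1)}_{22\mu}=-i\,\delta_{\mu,0}\,e^{-i\vec p_1\cdot\vec\delta_1}$,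 and $v^{(N)}_{11}=v^{(N)}_{22}=0$ for $N\ge2$. This is the momentum-space form of $t\,\Psi^+\Psi^-(e^{\pm ieA}-1)$ on the bonds plus $-ie\,n_{\mathbf x}A_{0,\mathbf x}$ on the sites of the honeycomb lattice. **Ultraviolet integration.** Let $P(d\Psi^{(u.v.)})P(dA^{(u.v.)})$ be the Gaussian integration, given by the Wick rule, with covariances $\langle\hat\Psi^-_{\mathbf k,\sigma,\rho}\hat\Psi^+_{\mathbf k',\sigma',\rho'}\rangle=\beta|\Lambda|\delta_{\mathbf k\mathbf k'}\delta_{\sigma\sigma'}\hat g^{(u.v.)}_{\rho\rho'}(\mathbf k)$ and $\langle\hat A_{\mu,\mathbf p}\hat A_{\nu,-\mathbf p'}\rangle=\beta\mathcal A_\Lambda\delta_{\mathbf p\mathbf p'}\delta_{\mu\nu}\hat w^{(u.v.)}(\mathbf p)$. Define the formal power series $F_{0,K}=\sum_NF^{(N)}_{0,K}e^N$ and $\mathcal V_K(\Psi,A)$, with $\mathcal V_K(0,0)=0$, by $$-\beta|\Lambda|F_{0,K}+\mathcal V_K(\Psi,A)=\log\int P(d\Psi^{(u.v.)})P(dA^{(u.v.)})\,e^{V(\Psi+\Psi^{(u.v.)},A+A^{(u.v.)})}.$$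 **Lemma.** For every $\beta_0>0$ there are constants $C>0$ and $C_{n,m}>0$ ($n,m\ge0$), depending only on $t,a_0,M,\chi,\beta_0$ (and on $n,m$) and not on $\beta,L,K,h^*$, such that for all $\beta\ge\beta_0$, $L\ge1$, $h^*<0$ the following holds. The potential can be written, order by order in $e$, as $$\mathcal V_K=\sum_{\substack{n,m\ge0\\n+m\ge1}}\sum_{\underline\sigma,\underline\rho,\underline\mu}\int\Big[\prod_{j=1}^n\hat\Psi^+_{\mathbf k_{2j-1},\sigma_j,\rho_{2j-1}}\hat\Psi^-_{\mathbf k_{2j},\sigma_j,\rho_{2j}}\Big]\Big[\prod_{i=1}^m\hat A_{\mu_i,\mathbf p_i}\Big]W_{K,2n,m,\underline\rho,\underline\mu}(\{\mathbf k_j\},\{\mathbf p_i\})\,\delta\Big(\sum_{j=1}^n(\mathbf k_{2j-1}-\mathbf k_{2j})-\sum_{i=1}^m\mathbf p_i\Big)$$ with spin-independent kernels $W_{K,2n,m,\underline\rho,\underline\mu}=\sum_{N\ge1}W^{(N)}_{K,2n,m,\underline\rho,\underline\mu}e^N$, where $W^{(N)}_{K,2n,m}=0$ if $n>N$ or $m>N$,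 and, for all $K$ and $N$, $$\big|F^{(N)}_{0,K}\big|\le C^N\Big(\frac N2\Big)!,\qquad\sup_{\{\mathbf k_j\},\{\mathbf p_i\}}\big|W^{(N)}_{K,2n,m,\underline\rho,\underline\mu}(\{\mathbf k_j\},\{\mathbf p_i\})\big|\le C_{n,m}^N\Big(\frac N2\Big)!,$$ where $(N/2)!=\Gamma(N/2+1)$. Moreover, for fixed $\beta,L,h^*$, $N,n,m,\underline\rho,\underline\mu$ and momenta, the limits $\lim_{K\to\infty}F^{(N)}_{0,K}$ and $\lim_{K\to\infty}W^{(N)}_{K,2n,m,\underline\rho,\underline\mu}(\{\mathbf k_j\},\{\mathbf p_i\})$ exist. -/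

import Mathlib

open scoped TensorProduct

noncomputable section

namespace Graphene

/-! ### Geometry of the honeycomb lattice -/

/-- Nearest-neighbour vectors `δ₁, δ₂, δ₃` (indexed by `0, 1, 2`). -/
def nn : Fin 3 → Fin 2 → ℝ :=
  ![![1, 0], ![-1 / 2, √3 / 2], ![-1 / 2, -(√3 / 2)]]

/-- First basis vector of the reciprocal lattice `Λ*`. -/
def b₁ : Fin 2 → ℝ := ![2 * Real.pi / 3, 2 * Real.pi / 3 * √3]

/-- Second basis vector of the reciprocal lattice `Λ*`. -/
def b₂ : Fin 2 → ℝ := ![2 * Real.pi / 3, -(2 * Real.pi / 3 * √3)]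

/-- The two Fermi points (`0` for `ω = +`, `1` for `ω = -`). -/
def fermiPt : Fin 2 → Fin 2 → ℝ :=
  ![![2 * Real.pi / 3, 2 * Real.pi / (3 * √3)], ![2 * Real.pi / 3, -(2 * Real.pi / (3 * √3))]]

/-- Euclidean length in `ℝ²`. -/
def len (v : Fin 2 → ℝ) : ℝ := √(v ⬝ᵥ v)

/-- Distance between two points of the torus `ℝ² / Λ*`. -/
def torusDist (v w : Fin 2 → ℝ) : ℝ :=
  ⨅ z : ℤ × ℤ, len (v - w - (z.1 : ℝ) • b₁ - (z.2 : ℝ) • b₂)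

/-- Integer labels `(n₀, n₁, n₂)` of space-time momenta. -/
abbrev Mom := ℤ × ℤ × ℤ

/-- Spatial momentum `(n₁ / L) b₁ + (n₂ / L) b₂`. -/
def vec (L : ℕ) (n : Mom) : Fin 2 → ℝ :=
  ((n.2.1 : ℝ) / L) • b₁ + ((n.2.2 : ℝ) / L) • b₂

/-- Fermionic Matsubara frequency `(2π / β) (n₀ + 1/2)`. -/
def fFreq (β : ℝ) (n : Mom) : ℝ := 2 * Real.pi / β * ((n.1 : ℝ) + 1 / 2)

/-- Bosonic Matsubara frequency `2π n₀ / β`. -/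
def bFreq (β : ℝ) (n : Mom) : ℝ := 2 * Real.pi / β * (n.1 : ℝ)

/-- The number `|Λ|` of lattice sites of one sublattice. -/
def sites (L : ℕ) : ℝ := (L : ℝ) ^ 2

/-- The area `𝒜_Λ` of the periodic lattice. -/
def area (L : ℕ) : ℝ := 3 * √3 / 2 * (L : ℝ) ^ 2

/-- `Ω(k) = ∑ᵢ exp (i k · (δᵢ - δ₁))`. -/
def Om (k : Fin 2 → ℝ) : ℂ :=
  ∑ j : Fin 3, Complex.exp (Complex.I * ((k ⬝ᵥ (nn j - nn 0) : ℝ) : ℂ))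

/-! ### Cutoffs and propagators -/

/-- `χ` is a smooth cutoff, equal to `1` on `t ≤ a₀` and to `0` on `t ≥ a₀ M`. -/
structure IsCutoff (a₀ M : ℝ) (χ : ℝ → ℝ) : Prop where
  smooth : ContDiff ℝ ((⊤ : ℕ∞) : WithTop ℕ∞) χ
  eq_one : ∀ s, s ≤ a₀ → χ s = 1
  eq_zero : ∀ s, a₀ * M ≤ s → χ s = 0

/-- The parameters of the model: hopping `t`, cutoff constants `a₀, M`, cutoff function `χ`,
inverse temperature `β`, side `L`, infrared cutoff `h*`. -/
structure Params where
  t : ℝ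
  a₀ : ℝ
  M : ℝ
  χ : ℝ → ℝ
  β : ℝ
  L : ℕ
  hstar : ℤ

variable (P : Params) (K : ℕ)

/-- `χ_K(k₀) = χ(M^{-K} |k₀|)`. -/
def chiUV (k₀ : ℝ) : ℝ := P.χ (|k₀| / P.M ^ K)

/-- `χ_{[h*,0]}(s) = χ(s) - χ(M^{-h*} s)`. -/
def chiIR (s : ℝ) : ℝ := P.χ s - P.χ (P.M ^ (-P.hstar) * s)

/-- `|𝐩|` for a space-time vector `𝐩 = (p₀, p⃗)`. -/
def stLen (p₀ : ℝ) (v : Fin 2 → ℝ) : ℝ := √(p₀ ^ 2 + v ⬝ᵥ v)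

/-- `|p̲|` for `p̲ = (p⃗, p₃)`. -/
def len3 (v : Fin 2 → ℝ) (p₃ : ℝ) : ℝ := √(v ⬝ᵥ v + p₃ ^ 2)

/-- The matrix `B(𝐤)`. -/
def kinetic (k₀ : ℝ) (k : Fin 2 → ℝ) : Matrix (Fin 2) (Fin 2) ℂ :=
  !![-Complex.I * k₀, -P.t * star (Om k); -P.t * Om k, -Complex.I * k₀]

/-- The free fermionic propagator `ĝ(𝐤) = χ_K(k₀) B(𝐤)⁻¹`. -/
def fermionProp (n : Mom) : Matrix (Fin 2) (Fin 2) ℂ :=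
  (chiUV P K (fFreq P.β n) : ℂ) • (kinetic P (fFreq P.β n) (vec P.L n))⁻¹

/-- The infrared fermionic propagator `∑_ω χ(|𝐤 - 𝐩_F^ω|) ĝ(𝐤)`. -/
def fermionPropIR (n : Mom) : Matrix (Fin 2) (Fin 2) ℂ :=
  ((∑ ω : Fin 2,
    P.χ (√(fFreq P.β n ^ 2 + torusDist (vec P.L n) (fermiPt ω) ^ 2)) : ℝ) : ℂ) •
      fermionProp P K n

/-- The ultraviolet fermionic propagator. -/
def fermionPropUV (n : Mom) : Matrix (Fin 2) (Fin 2) ℂ :=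
  fermionProp P K n - fermionPropIR P K n

/-- The photon propagator in the Feynman gauge (the scalar multiplying the identity matrix):
`∫ dp₃/(2π) χ_K(p₀) χ_{[h*,0]}(|p̲|) / (𝐩² + p₃²)`. -/
def photonProp (n : Mom) : ℝ :=
  ∫ p₃ : ℝ, (2 * Real.pi)⁻¹ *
    (chiUV P K (bFreq P.β n) * chiIR P (len3 (vec P.L n) p₃) /
      (stLen (bFreq P.β n) (vec P.L n) ^ 2 + p₃ ^ 2))

/-- The infrared photon propagator
`∫_{-a₀M}^{a₀M} dp₃/(2π) (χ(|𝐩|) - χ_K(p₀) χ(M^{-h*}|p̲|)) / (𝐩² + p₃²)`.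
For `|𝐩| ≥ a₀ M^{h*+1}` it equals `χ_{[h*,0]}(|𝐩|) arctan(a₀ M / |𝐩|) / (π |𝐩|)`. -/
def photonPropIR (n : Mom) : ℝ :=
  ∫ p₃ in (-(P.a₀ * P.M))..(P.a₀ * P.M), (2 * Real.pi)⁻¹ *
    ((P.χ (stLen (bFreq P.β n) (vec P.L n)) -
        chiUV P K (bFreq P.β n) * P.χ (P.M ^ (-P.hstar) * len3 (vec P.L n) p₃)) /
      (stLen (bFreq P.β n) (vec P.L n) ^ 2 + p₃ ^ 2))

/-- The ultraviolet photon propagator. -/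
def photonPropUV (n : Mom) : ℝ := photonProp P K n - photonPropIR P K n

/-! ### Field modes. All propagators vanish outside these finite sets. -/

/-- A box of frequency labels containing all frequencies smaller than `a₀ M^{K+1}`. -/
def freqBox : Finset ℤ :=
  Finset.Icc (-(⌈P.β * (P.a₀ * P.M ^ (K + 1))⌉)) ⌈P.β * (P.a₀ * P.M ^ (K + 1))⌉

open Classical in
/-- Fermionic momenta: `k⃗` in the Brillouin zone, `|k₀| < a₀ M^{K+1}`. -/
def fModes : Finset Mom :=
  (freqBox P K ×ˢ (Finset.Ico (0 : ℤ) P.L ×ˢ Finset.Ico (0 : ℤ) P.L)).filter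
    fun n => |fFreq P.β n| < P.a₀ * P.M ^ (K + 1)

open Classical in
/-- Bosonic momenta: `|p⃗| < a₀ M` (so that `|n₁|, |n₂| ≤ L`, as `a₀ M < π/6`) and
`|p₀| < a₀ M^{K+1}`. -/
def bModes : Finset Mom :=
  (freqBox P K ×ˢ (Finset.Icc (-(P.L : ℤ)) P.L ×ˢ Finset.Icc (-(P.L : ℤ)) P.L)).filter
    fun n => |bFreq P.β n| < P.a₀ * P.M ^ (K + 1) ∧ len (vec P.L n) < P.a₀ * P.M

/-! ### The algebra of fields -/

/-- Labels of Grassmann generators: momentum, spin, sublattice `ρ`, and charge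
(`true` for `Ψ̂⁺`, `false` for `Ψ̂⁻`). -/
abbrev FLabel := Mom × Fin 2 × Fin 2 × Bool

/-- Labels of photon variables `Â_{μ,𝐩}`. -/
abbrev BLabel := Fin 3 × Mom

/-- Grassmann algebra generated by the `Ψ̂^±_{𝐤,σ,ρ}`. -/
abbrev Grass := ExteriorAlgebra ℂ (FLabel →₀ ℂ)

/-- Polynomials in the `Â_{μ,𝐩}`. -/
abbrev Bose := MvPolynomial BLabel ℂ

/-- Polynomials in the commuting photon variables with coefficients in the Grassmann algebra. -/
abbrev Fields := Bose ⊗[ℂ] Grass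

/-- The Grassmann generator with label `i`. -/
def psi (i : FLabel) : Grass := ExteriorAlgebra.ι ℂ (Finsupp.single i 1)

/-- Left derivative with respect to the Grassmann generator with label `i`. -/
def gderiv (i : FLabel) : Grass →ₗ[ℂ] Grass :=
  CliffordAlgebra.contractLeft (Finsupp.lapply i : (FLabel →₀ ℂ) →ₗ[ℂ] ℂ)

/-- Derivative with respect to the photon variable with label `i`. -/
def bderiv (i : BLabel) : Bose →ₗ[ℂ] Bose :=
  (MvPolynomial.pderiv i : Derivation ℂ Bose Bose).toLinearMap

/-- The momentum constraint imposed by `δ(∑ⱼ (𝐤_{2j-1} - 𝐤_{2j}) - ∑ᵢ 𝐩ᵢ)`: exact in the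
frequency, modulo `Λ*` in the spatial momentum. The entry `k j` is `(𝐤_{2j-1}, 𝐤_{2j})`. -/
def Conserved {n m : ℕ} (L : ℕ) (k : Fin n → Mom × Mom) (p : Fin m → Mom) : Prop :=
  ∑ j, ((k j).1.1 - (k j).2.1) - ∑ i, (p i).1 = 0 ∧
  (L : ℤ) ∣ ∑ j, ((k j).1.2.1 - (k j).2.2.1) - ∑ i, (p i).2.1 ∧
  (L : ℤ) ∣ ∑ j, ((k j).1.2.2 - (k j).2.2.2) - ∑ i, (p i).2.2

/-- Kernels with `2n` fermionic and `m` photonic legs; the entries of the first argument are the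
pairs `(ρ_{2j-1}, ρ_{2j})`. They do not depend on the spins. -/
abbrev Kernel (n m : ℕ) :=
  (Fin n → Fin 2 × Fin 2) → (Fin m → Fin 3) → (Fin n → Mom × Mom) → (Fin m → Mom) → ℂ

open Classical in
/-- The field polynomial with kernel `W`:
`∑_{σ,ρ,μ} ∫ [∏ⱼ Ψ̂⁺_{𝐤_{2j-1},σⱼ,ρ_{2j-1}} Ψ̂⁻_{𝐤_{2j},σⱼ,ρ_{2j}}] [∏ᵢ Â_{μᵢ,𝐩ᵢ}] W δ(…)`,
where `∫ d𝐤/D = (β|Λ|)⁻¹ ∑`, `∫ d𝐩/(2π)³ = (β𝒜_Λ)⁻¹ ∑`, and `δ` is `β|Λ|` times the Kronecker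
symbol of `Conserved`. -/
def fieldPoly {n m : ℕ} (W : Kernel n m) : Fields :=
  ∑ σ : Fin n → Fin 2, ∑ ρ : Fin n → Fin 2 × Fin 2, ∑ μ : Fin m → Fin 3,
  ∑ k ∈ Fintype.piFinset (fun _ : Fin n => fModes P K ×ˢ fModes P K),
  ∑ p ∈ Fintype.piFinset (fun _ : Fin m => bModes P K),
    ((((P.β * sites P.L)⁻¹ ^ (2 * n) * (P.β * area P.L)⁻¹ ^ m *
        (if Conserved P.L k p then P.β * sites P.L else 0) : ℝ) : ℂ) * W ρ μ k p) •
      ((∏ i, (MvPolynomial.X (μ i, p i) : Bose)) ⊗ₜ[ℂ]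
        (List.ofFn fun j =>
          psi ((k j).1, σ j, (ρ j).1, true) * psi ((k j).2, σ j, (ρ j).2, false)).prod)

/-! ### The interaction -/

/-- `η_j(p⃗) = ∫₀¹ exp(-i s p⃗·δ_j) ds`, that is `(1 - exp(-i p⃗·δ_j)) / (i p⃗·δ_j)`. -/
def eta (j : Fin 3) (v : Fin 2 → ℝ) : ℂ :=
  ∫ s in (0 : ℝ)..1, Complex.exp (-Complex.I * ((s * (v ⬝ᵥ nn j) : ℝ) : ℂ))

/-- The component `μ` of `δ_j`, with time component `0`. -/
def nnComp (j : Fin 3) : Fin 3 → ℝ := ![0, nn j 0, nn j 1]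

/-- The kernel of the part of `V(Ψ,A)` with `m ≥ 1` photon legs, with the factor `e^m` removed. The
off-diagonal part comes from `t Ψ⁺Ψ⁻ (exp(± i e A_{(𝐱,j)}) - 1)`, the diagonal one from
`-i e n_𝐱 A_{0,𝐱}`. -/
def bareKernel (m : ℕ) : Kernel 1 m := fun ρ μ k p =>
  if (ρ 0).1 = 0 ∧ (ρ 0).2 = 1 then
    (P.t : ℂ) * (Complex.I ^ m / (m.factorial : ℂ)) *
      ∑ j : Fin 3, Complex.exp (-Complex.I * ((vec P.L (k 0).2 ⬝ᵥ (nn j - nn 0) : ℝ) : ℂ)) *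
        ∏ i, (eta j (vec P.L (p i)) * (nnComp j (μ i) : ℂ))
  else if (ρ 0).1 = 1 ∧ (ρ 0).2 = 0 then
    (P.t : ℂ) * ((-Complex.I) ^ m / (m.factorial : ℂ)) *
      ∑ j : Fin 3, Complex.exp (Complex.I * ((vec P.L (k 0).1 ⬝ᵥ (nn j - nn 0) : ℝ) : ℂ)) *
        ∏ i, (eta j (vec P.L (p i)) * (nnComp j (μ i) : ℂ))
  else if m = 1 then
    -Complex.I * ∏ i, (if μ i = 0 then
      (if (ρ 0).1 = 0 then 1 else
        Complex.exp (-Complex.I * ((vec P.L (p i) ⬝ᵥ nn 0 : ℝ) : ℂ))) else 0)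
  else 0

/-- The interaction `V(Ψ,A)` as a formal power series in the charge `e`. -/
def interaction : PowerSeries Fields :=
  PowerSeries.mk fun N => if N = 0 then 0 else fieldPoly P K (bareKernel P N)

/-! ### Ultraviolet integration -/

/-- The second-order operator associated with the covariances
`⟨Ψ̂⁻_{𝐤,σ,ρ} Ψ̂⁺_{𝐤,σ,ρ'}⟩ = β|Λ| ĝ^{(u.v.)}_{ρρ'}(𝐤)` and
`⟨Â_{μ,𝐩} Â_{μ,-𝐩}⟩ = β𝒜_Λ ŵ^{(u.v.)}(𝐩)`. -/
def laplacianUV : Fields →ₗ[ℂ] Fields :=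
  (∑ p ∈ bModes P K, ∑ μ : Fin 3,
    ((1 / 2 * (P.β * area P.L) * photonPropUV P K p : ℝ) : ℂ) •
      TensorProduct.map (bderiv (μ, p) ∘ₗ bderiv (μ, -p)) (LinearMap.id : Grass →ₗ[ℂ] Grass)) +
  ∑ k ∈ fModes P K, ∑ σ : Fin 2, ∑ ρ : Fin 2, ∑ ρ' : Fin 2,
    (((P.β * sites P.L : ℝ) : ℂ) * fermionPropUV P K k ρ ρ') •
      TensorProduct.map (LinearMap.id : Bose →ₗ[ℂ] Bose)
        (gderiv (k, σ, ρ', true) ∘ₗ gderiv (k, σ, ρ, false))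

/-- Gaussian integration of the ultraviolet fields,
`X ↦ ∫ P(dΨ^{(u.v.)}) P(dA^{(u.v.)}) X(Ψ + Ψ^{(u.v.)}, A + A^{(u.v.)})`, given by the Wick rule,
that is by the exponential of `laplacianUV` (on each `X` the sum is finite, since `laplacianUV`
lowers the degree in the fields). -/
def expectUV (X : Fields) : Fields :=
  ∑ᶠ s : ℕ, ((s.factorial : ℂ)⁻¹) • ((laplacianUV P K) ^ s) X

/-- `∫ P(dΨ^{(u.v.)}) P(dA^{(u.v.)}) e^{V(Ψ + Ψ^{(u.v.)}, A + A^{(u.v.)})}` as a formal power series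
in `e` (only the powers `V^s` with `s ≤ N` contribute to the order `N`, since `V = O(e)`). -/
def partitionUV : PowerSeries Fields :=
  PowerSeries.mk fun N => expectUV P K
    (∑ s ∈ Finset.range (N + 1),
      ((s.factorial : ℂ)⁻¹) • PowerSeries.coeff N (interaction P K ^ s))

/-- `-β|Λ| F_{0,K} + 𝒱_K(Ψ,A)`: the logarithm of `partitionUV`, whose term of order `e⁰` is `1`. -/
def effectiveAction : PowerSeries Fields :=
  PowerSeries.mk fun N => ∑ s ∈ Finset.Icc 1 N,
    ((-1 : ℂ) ^ (s + 1) / (s : ℂ)) • PowerSeries.coeff N ((partitionUV P K - 1) ^ s)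

/-- Evaluation at vanishing fields `(Ψ, A) = (0, 0)`. -/
def atZero : Fields →ₐ[ℂ] ℂ :=
  Algebra.TensorProduct.lift (MvPolynomial.aeval fun _ : BLabel => (0 : ℂ))
    (ExteriorAlgebra.algebraMapInv : Grass →ₐ[ℂ] ℂ) fun _ _ => Commute.all _ _

/-- The coefficient `F^{(N)}_{0,K}` of `e^N` in the free energy `F_{0,K}`. -/
def freeEnergy (N : ℕ) : ℂ :=
  -atZero (PowerSeries.coeff N (effectiveAction P K)) / ((P.β * sites P.L : ℝ) : ℂ)

/-- The coefficient of `e^N` in the effective potential `𝒱_K`, normalized by `𝒱_K(0,0) = 0`. -/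
def effectivePotential (N : ℕ) : Fields :=
  PowerSeries.coeff N (effectiveAction P K) -
    algebraMap ℂ Fields (atZero (PowerSeries.coeff N (effectiveAction P K)))

end Graphene

end

open scoped TensorProduct
open Finset.HasAntidiagonal (antidiagonal)

noncomputable section

namespace Graphene

/-! ### Second-order operators on commutative algebras -/

section SecondOrder

variable {A : Type*} [CommRing A] [Algebra ℂ A]

/-! By the Wick rule the ultraviolet integration is a heat operator exp(Δ_A + Δ_F), where Δ_A and
Δ_F are second-order operators in the photon and Grassmann derivatives. On the even part of the
field algebra, which is commutative, such an operator obeys the chain rule Δf(u) = f'(u) Δu + f''(u)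
Γ(u,u)/2, with Γ its Leibniz defect `carre`. Hence a solution of ∂_s u = Δu + Γ(u,u)/2 satisfies
exp(u(s)) = exp(sΔ) exp(u(0)) (`expSum_pexp`): the logarithm is obtained directly from a flow
equation, without a graph expansion. The two Laplacians commute, so the fermions are integrated
first and the photons afterwards (`coeff_effectiveAction`).

The interaction is quadratic in Ψ, so the fermionic flow has an explicit solution (`chainFlow_rec`):
Ψ⁺MΨ⁻ turns into the chains M(GM)^j and the loops -2 tr (GM)^(j+1)/(j+1). No factorial appears. In a
chain the internal momenta are fixed by conservation, and a propagator costs only its supremum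
(`MRep.chain`). A loop has one free momentum, and the bound on ĝ decays only like 1/|k₀|, which is
not summable. With at least two propagators the square-summability of this bound suffices
(`MRep.loop`). With one propagator, the diagonal part is odd in k₀ and meets a vertex that does not
depend on the momentum, while the off-diagonal part decays like 1/k₀² (`Rep.tadpole`).

A term of order N with j photon contractions has N - 2j photon legs. The photon propagator decays
like 1/p₀². Tying two legs of one polynomial costs its normalized sum (`Rep.lapA`). Joining two
polynomials fixes the momentum modulo Λ* and costs its supremum (`Rep.contract`). The flow equation
is then a recursion in j, dominated by the majorant `maj`: up to exponentials, N!/((N-2j)! j!)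
counts the choices of j pairs among N legs, and the weight 1/N² makes the quadratic term close
(`sum_majLeg_le`, `photonFlow_rep`). As 2j ≤ N, the majorant is at most C^N (N/2)! (`maj_le`).

The analytic input is the list `UVBounds`, proved uniformly in β, L, h* and K in `exists_uvBounds`.
Subtracting the infrared part cancels every h*-dependent term of the photon propagator and leaves an
integrand that vanishes near the origin; the fermion propagator has its Fermi points cut out. At
fixed momentum each propagator is eventually constant in K, and all momentum sums have dominating
functions independent of K. The limits therefore follow by dominated convergence, which `Rep`
carries along with the bounds. -/

/-- The defect of the Leibniz rule of `Δ`. -/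
def carre (Δ : A →ₗ[ℂ] A) (x y : A) : A := Δ (x * y) - x * Δ y - y * Δ x

/-- `Δ` is a differential operator of order at most two that kills constants. -/
def IsSecondOrder (Δ : A →ₗ[ℂ] A) : Prop :=
  ∀ x y z, carre Δ (x * y) z = x * carre Δ y z + y * carre Δ x z

theorem carre_comm (Δ : A →ₗ[ℂ] A) (x y : A) : carre Δ x y = carre Δ y x := by
  simp only [carre, mul_comm x y]; ring

theorem carre_add_left (Δ : A →ₗ[ℂ] A) (x x' y : A) :
    carre Δ (x + x') y = carre Δ x y + carre Δ x' y := by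
  simp only [carre, add_mul, map_add, mul_add]; ring

theorem carre_add_right (Δ : A →ₗ[ℂ] A) (x y y' : A) :
    carre Δ x (y + y') = carre Δ x y + carre Δ x y' := by
  simp only [carre, add_mul, map_add, mul_add]; ring

theorem carre_smul_left (Δ : A →ₗ[ℂ] A) (c : ℂ) (x y : A) :
    carre Δ (c • x) y = c • carre Δ x y := by
  simp only [carre, smul_mul_assoc, map_smul, mul_smul_comm, smul_sub]

theorem carre_zero_left (Δ : A →ₗ[ℂ] A) (y : A) : carre Δ 0 y = 0 := by simp [carre]

theorem carre_zero_right (Δ : A →ₗ[ℂ] A) (y : A) : carre Δ y 0 = 0 := by simp [carre]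

theorem carre_sum_left {ι : Type*} (s : Finset ι) (Δ : A →ₗ[ℂ] A) (f : ι → A) (y : A) :
    carre Δ (∑ i ∈ s, f i) y = ∑ i ∈ s, carre Δ (f i) y := by
  classical
  induction s using Finset.induction_on with
  | empty => simp [carre_zero_left]
  | insert i s hi ih => rw [Finset.sum_insert hi, Finset.sum_insert hi, carre_add_left, ih]

theorem carre_add_op (Δ Δ' : A →ₗ[ℂ] A) (x y : A) :
    carre (Δ + Δ') x y = carre Δ x y + carre Δ' x y := by
  simp only [carre, LinearMap.add_apply]; ring

theorem carre_smul_op (c : ℂ) (Δ : A →ₗ[ℂ] A) (x y : A) :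
    carre (c • Δ) x y = c • carre Δ x y := by
  simp only [carre, LinearMap.smul_apply, mul_smul_comm, smul_sub]

theorem IsSecondOrder.zero : IsSecondOrder (0 : A →ₗ[ℂ] A) := by
  intro x y z; simp [carre]

theorem IsSecondOrder.add {Δ Δ' : A →ₗ[ℂ] A} (h : IsSecondOrder Δ) (h' : IsSecondOrder Δ') :
    IsSecondOrder (Δ + Δ') := by
  intro x y z
  simp only [carre_add_op, h x y z, h' x y z]; ring

theorem IsSecondOrder.smul {Δ : A →ₗ[ℂ] A} (h : IsSecondOrder Δ) (c : ℂ) :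
    IsSecondOrder (c • Δ) := by
  intro x y z
  simp only [carre_smul_op, h x y z, smul_add, mul_smul_comm]

theorem IsSecondOrder.sum {ι : Type*} (s : Finset ι) {Δ : ι → A →ₗ[ℂ] A}
    (h : ∀ i ∈ s, IsSecondOrder (Δ i)) : IsSecondOrder (∑ i ∈ s, Δ i) := by
  classical
  induction s using Finset.induction_on with
  | empty => simpa using IsSecondOrder.zero
  | insert i s hi ih =>
    rw [Finset.sum_insert hi]
    exact (h i (Finset.mem_insert_self i s)).add
      (ih fun j hj => h j (Finset.mem_insert_of_mem hj))

/-- Γ(·, y) is a derivation, so it kills `1`; evaluated at y = 1 this forces Δ1 = 0. -/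
theorem IsSecondOrder.carre_one_left {Δ : A →ₗ[ℂ] A} (h : IsSecondOrder Δ) (y : A) :
    carre Δ 1 y = 0 := by
  have := h 1 1 y
  simpa using this

theorem IsSecondOrder.map_one {Δ : A →ₗ[ℂ] A} (h : IsSecondOrder Δ) : Δ 1 = 0 := by
  have := h.carre_one_left 1
  simpa [carre] using this

/-! ### Coefficientwise extension -/

theorem sum_antidiagonal_assoc {B : Type*} [AddCommMonoid B] (n : ℕ) (f : ℕ → ℕ → ℕ → B) :
    ∑ p ∈ antidiagonal n, ∑ q ∈ antidiagonal p.1, f q.1 q.2 p.2 =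
      ∑ p ∈ antidiagonal n, ∑ q ∈ antidiagonal p.2, f p.1 q.1 q.2 := by
  rw [Finset.sum_sigma', Finset.sum_sigma']
  refine Finset.sum_nbij' (fun x => ⟨(x.2.1, x.2.2 + x.1.2), (x.2.2, x.1.2)⟩)
    (fun x => ⟨(x.1.1 + x.2.1, x.2.2), (x.1.1, x.2.1)⟩) ?_ ?_ ?_ ?_ ?_ <;>
  · rintro ⟨⟨a, b⟩, ⟨c, d⟩⟩ h
    simp only [Finset.mem_sigma, Finset.HasAntidiagonal.mem_antidiagonal] at h
    obtain ⟨h1, h2⟩ := h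
    first
      | (subst h2; rfl)
      | (simp only [Finset.mem_sigma, Finset.HasAntidiagonal.mem_antidiagonal, and_true]; omega)

/-- The derivation property of Γ summed over Cauchy products. It is stated for sequences so as to
serve both power series in e and polynomials in the flow parameter. -/
theorem sum_carre_mul {Δ : A →ₗ[ℂ] A} (h : IsSecondOrder Δ) (x y z : ℕ → A) (n : ℕ) :
    ∑ p ∈ antidiagonal n, carre Δ (∑ q ∈ antidiagonal p.1, x q.1 * y q.2) (z p.2) =
      ∑ p ∈ antidiagonal n, x p.1 * ∑ q ∈ antidiagonal p.2, carre Δ (y q.1) (z q.2) +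
      ∑ p ∈ antidiagonal n, y p.1 * ∑ q ∈ antidiagonal p.2, carre Δ (x q.1) (z q.2) := by
  simp only [carre_sum_left, h _ _ _, Finset.sum_add_distrib, Finset.mul_sum]
  congr 1
  · exact sum_antidiagonal_assoc n fun a b c => x a * carre Δ (y b) (z c)
  · rw [← sum_antidiagonal_assoc n fun a b c => y a * carre Δ (x b) (z c)]
    refine Finset.sum_congr rfl fun p _ => ?_
    exact (Finset.Nat.sum_antidiagonal_swap
      (f := fun q : ℕ × ℕ => y q.1 * carre Δ (x q.2) (z p.2)))

end SecondOrder

section Extension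

variable {A : Type*} [CommRing A] [Algebra ℂ A]

/-- Coefficientwise action of a linear map on power series. -/
def serExt (f : A →ₗ[ℂ] A) : PowerSeries A →ₗ[ℂ] PowerSeries A where
  toFun x := PowerSeries.mk fun n => f (PowerSeries.coeff n x)
  map_add' x y := by ext n; simp
  map_smul' c x := by
    ext n
    simp only [PowerSeries.coeff_mk, RingHom.id_apply]
    have h : ∀ y : PowerSeries A, PowerSeries.coeff n (c • y) = c • PowerSeries.coeff n y :=
      fun y => rfl
    rw [h, h, map_smul, PowerSeries.coeff_mk]

theorem coeff_csmul {B : Type*} [Ring B] [Algebra ℂ B] (c : ℂ) (y : PowerSeries B) (n : ℕ) :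
    PowerSeries.coeff n (c • y) = c • PowerSeries.coeff n y := rfl

@[simp] theorem coeff_serExt (f : A →ₗ[ℂ] A) (x : PowerSeries A) (n : ℕ) :
    PowerSeries.coeff n (serExt f x) = f (PowerSeries.coeff n x) := by
  simp [serExt]

theorem coeff_carre_serExt (Δ : A →ₗ[ℂ] A) (x y : PowerSeries A) (n : ℕ) :
    PowerSeries.coeff n (carre (serExt Δ) x y) =
      ∑ p ∈ antidiagonal n, carre Δ (PowerSeries.coeff p.1 x) (PowerSeries.coeff p.2 y) := by
  rw [carre, mul_comm y]
  simp only [map_sub, coeff_serExt, PowerSeries.coeff_mul, map_sum, carre,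
    Finset.sum_sub_distrib]
  congr 1
  exact Finset.sum_congr rfl fun p _ => mul_comm _ _

theorem IsSecondOrder.serExt {Δ : A →ₗ[ℂ] A} (h : IsSecondOrder Δ) :
    IsSecondOrder (serExt Δ) := by
  intro x y z
  ext n
  rw [map_add, PowerSeries.coeff_mul, PowerSeries.coeff_mul]
  simp only [coeff_carre_serExt, PowerSeries.coeff_mul]
  exact sum_carre_mul h (fun i => PowerSeries.coeff i x) (fun i => PowerSeries.coeff i y)
    (fun i => PowerSeries.coeff i z) n

/-- Coefficientwise action of a linear map on polynomials. -/
def polyExt (f : A →ₗ[ℂ] A) : Polynomial A →ₗ[ℂ] Polynomial A :=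
  Polynomial.lsum fun n => ((Polynomial.monomial n).restrictScalars ℂ).comp f

@[simp] theorem coeff_polyExt (f : A →ₗ[ℂ] A) (x : Polynomial A) (n : ℕ) :
    (polyExt f x).coeff n = f (x.coeff n) := by
  simp only [polyExt, Polynomial.lsum_apply, Polynomial.sum_def, Polynomial.finsetSum_coeff,
    LinearMap.comp_apply, LinearMap.restrictScalars_apply, Polynomial.coeff_monomial]
  rw [Finset.sum_ite_eq' x.support n fun i => f (x.coeff i)]
  split_ifs with h
  · rfl
  · rw [Polynomial.notMem_support_iff.mp h, map_zero]

theorem coeff_carre_polyExt (Δ : A →ₗ[ℂ] A) (x y : Polynomial A) (n : ℕ) :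
    (carre (polyExt Δ) x y).coeff n =
      ∑ p ∈ antidiagonal n, carre Δ (x.coeff p.1) (y.coeff p.2) := by
  rw [carre, mul_comm y]
  simp only [Polynomial.coeff_sub, coeff_polyExt, Polynomial.coeff_mul, map_sum, carre,
    Finset.sum_sub_distrib]
  congr 1
  exact Finset.sum_congr rfl fun p _ => mul_comm _ _

theorem IsSecondOrder.polyExt {Δ : A →ₗ[ℂ] A} (h : IsSecondOrder Δ) :
    IsSecondOrder (polyExt Δ) := by
  intro x y z
  ext n
  simp only [Polynomial.coeff_add, Polynomial.coeff_mul, coeff_carre_polyExt]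
  exact sum_carre_mul h _ _ _ n

/-- The Leibniz rule. -/
def IsLeibniz (d : A →ₗ[ℂ] A) : Prop := ∀ x y, d (x * y) = x * d y + d x * y

theorem IsLeibniz.serExt {d : A →ₗ[ℂ] A} (h : IsLeibniz d) : IsLeibniz (serExt d) := by
  intro x y
  ext n
  simp only [map_add, PowerSeries.coeff_mul, coeff_serExt, map_sum, h _ _, Finset.sum_add_distrib]

end Extension

/-! ### Formal exponential and logarithm -/

section Exponential

variable {A : Type*} [Ring A] [Algebra ℂ A]

/-- The exponential of a power series without constant term. -/
def pexp (x : PowerSeries A) : PowerSeries A :=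
  PowerSeries.mk fun N => ∑ s ∈ Finset.range (N + 1),
    ((s.factorial : ℂ)⁻¹) • PowerSeries.coeff N (x ^ s)

/-- Without constant term, `x ^ s` starts at order s. The factor `y` makes room for the remainder in
`log_pexp`. -/
theorem coeff_pow_mul_eq_zero {A : Type*} [Ring A] {x : PowerSeries A} (hx : PowerSeries.coeff 0 x = 0)
    (y : PowerSeries A) {N s : ℕ} (h : N < s) : PowerSeries.coeff N (x ^ s * y) = 0 := by
  induction s generalizing N y with
  | zero => omega
  | succ s ih =>
    rw [pow_succ', mul_assoc, PowerSeries.coeff_mul]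
    refine Finset.sum_eq_zero fun p hp => ?_
    rw [Finset.HasAntidiagonal.mem_antidiagonal] at hp
    rcases Nat.eq_zero_or_pos p.1 with h0 | h0
    · rw [h0, hx, zero_mul]
    · rw [ih y (by omega), mul_zero]

theorem coeff_pow_eq_zero {A : Type*} [Ring A] {x : PowerSeries A} (hx : PowerSeries.coeff 0 x = 0)
    {N s : ℕ} (h : N < s) : PowerSeries.coeff N (x ^ s) = 0 := by
  simpa using coeff_pow_mul_eq_zero hx 1 h

/-- The truncated exponential. -/
def expTrunc (x : PowerSeries A) (n : ℕ) : PowerSeries A :=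
  ∑ s ∈ Finset.range n, ((s.factorial : ℂ)⁻¹) • x ^ s

theorem coeff_pexp {x : PowerSeries A} (hx : PowerSeries.coeff 0 x = 0) {N n : ℕ} (h : N < n) :
    PowerSeries.coeff N (pexp x) = PowerSeries.coeff N (expTrunc x n) := by
  rw [pexp, PowerSeries.coeff_mk, expTrunc, map_sum]
  refine Finset.sum_subset (Finset.range_subset_range.mpr (by omega)) fun s _ hs => ?_
  rw [Finset.mem_range, not_lt] at hs
  rw [coeff_pow_eq_zero hx (by omega), smul_zero]

theorem coeff_pow_congr {A : Type*} [Ring A] {x y : PowerSeries A} {N : ℕ}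
    (h : ∀ n ≤ N, PowerSeries.coeff n x = PowerSeries.coeff n y) (s : ℕ) :
    ∀ n ≤ N, PowerSeries.coeff n (x ^ s) = PowerSeries.coeff n (y ^ s) := by
  induction s with
  | zero => simp
  | succ s ih =>
    intro n hn
    rw [pow_succ, pow_succ, PowerSeries.coeff_mul, PowerSeries.coeff_mul]
    refine Finset.sum_congr rfl fun p hp => ?_
    rw [Finset.HasAntidiagonal.mem_antidiagonal] at hp
    rw [ih p.1 (by omega), h p.2 (by omega)]

theorem map_pexp {B : Type*} [Ring B] [Algebra ℂ B] (f : A →ₐ[ℂ] B) (x : PowerSeries A) :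
    PowerSeries.map (f : A →+* B) (pexp x) = pexp (PowerSeries.map (f : A →+* B) x) := by
  ext N
  simp only [pexp, PowerSeries.coeff_map, PowerSeries.coeff_mk, ← map_pow]
  simp

open Polynomial in
/-- `log (1 + (exp X - 1)) = X` for truncated series. -/
theorem X_pow_dvd_log_exp (N : ℕ) :
    (X : ℂ[X]) ^ (N + 1) ∣
      (∑ s ∈ Finset.Icc 1 N, C ((-1 : ℂ) ^ (s + 1) / (s : ℂ)) *
        (∑ r ∈ Finset.Icc 1 N, C ((r.factorial : ℂ)⁻¹) * X ^ r) ^ s) - X := by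
  set y : ℂ[X] := ∑ r ∈ Finset.Icc 1 N, C ((r.factorial : ℂ)⁻¹) * X ^ r with hy
  rcases Nat.eq_zero_or_pos N with rfl | hN
  · simp
  have hXy : X ∣ y := Finset.dvd_sum fun r hr =>
    Dvd.dvd.mul_left (dvd_pow_self X (by have := (Finset.mem_Icc.mp hr).1; omega)) _
  have hIcc : ∀ f : ℕ → ℂ[X], ∑ r ∈ Finset.Icc 1 N, f r = ∑ r ∈ Finset.range N, f (r + 1) := by
    intro f
    rw [Finset.range_eq_Ico, Finset.sum_Ico_add' f 0 N 1]
    rfl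
  -- The truncated exponential misses its own derivative only by the top monomial.
  have hy' : derivative y = 1 + y - C ((N.factorial : ℂ)⁻¹) * X ^ N := by
    have h1 : derivative y = ∑ r ∈ Finset.range N, C ((r.factorial : ℂ)⁻¹) * X ^ r := by
      rw [hy, derivative_sum, hIcc]
      refine Finset.sum_congr rfl fun r _ => ?_
      rw [derivative_C_mul_X_pow, Nat.add_sub_cancel]
      congr 2
      rw [Nat.factorial_succ]
      push_cast
      have : (r : ℂ) + 1 ≠ 0 := by exact_mod_cast Nat.succ_ne_zero r
      have h2 : (r.factorial : ℂ) ≠ 0 := by exact_mod_cast r.factorial_ne_zero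
      field_simp
    have h2 : (1 : ℂ[X]) + y = ∑ r ∈ Finset.range (N + 1), C ((r.factorial : ℂ)⁻¹) * X ^ r := by
      rw [Finset.sum_range_succ', ← hIcc (fun r => C ((r.factorial : ℂ)⁻¹) * X ^ r), ← hy]
      simp [add_comm]
    rw [h1, h2, Finset.sum_range_succ]
    ring
  set l : ℂ[X] := ∑ i ∈ Finset.range N, (-y) ^ i with hl
  have hl' : l * (1 + y) = 1 - (-y) ^ N := by
    have := geom_sum_mul (-y) N
    rw [hl]; linear_combination -this
  set p : ℂ[X] := (∑ s ∈ Finset.Icc 1 N, C ((-1 : ℂ) ^ (s + 1) / (s : ℂ)) * y ^ s) - X with hp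
  have hp' : derivative p = l * derivative y - 1 := by
    rw [hp, derivative_sub, derivative_X, derivative_sum, hIcc, hl, Finset.sum_mul]
    congr 1
    refine Finset.sum_congr rfl fun s _ => ?_
    rw [derivative_C_mul, derivative_pow_succ]
    have : ((s : ℂ) + 1) ≠ 0 := by exact_mod_cast Nat.succ_ne_zero s
    have h3 : C ((-1 : ℂ) ^ (s + 1 + 1) / ((s + 1 : ℕ) : ℂ)) * C ((s : ℂ) + 1) =
        (-1 : ℂ[X]) ^ s := by
      rw [← C_mul]
      push_cast
      rw [div_mul_cancel₀ _ this, pow_add, pow_add]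
      simp
    rw [neg_pow y s, ← h3]
    ring
  -- Both truncation errors in p' are divisible by X^N. Since p(0) = 0 and the characteristic is
  -- zero, X^(N+1) divides p.
  have hdvd : X ^ N ∣ derivative p := by
    have h1 : derivative p = -((-y) ^ N) - X ^ N * (l * C ((N.factorial : ℂ)⁻¹)) := by
      rw [hp', hy']
      linear_combination hl'
    rw [h1]
    exact dvd_sub (dvd_neg.mpr (pow_dvd_pow_of_dvd (dvd_neg.mpr hXy) N)) (dvd_mul_right _ _)
  rw [X_pow_dvd_iff] at hdvd ⊢
  intro d hd
  rcases d with _ | d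
  · have h2 : X ∣ p := by
      rw [hp]
      refine dvd_sub (Finset.dvd_sum fun s hs => Dvd.dvd.mul_left ?_ _) dvd_rfl
      exact dvd_pow hXy (by have := (Finset.mem_Icc.mp hs).1; omega)
    exact X_dvd_iff.mp h2
  · have := hdvd d (by omega)
    rw [coeff_derivative] at this
    refine (mul_eq_zero.mp this).resolve_right ?_
    exact_mod_cast Nat.succ_ne_zero d

-- Substituting `x` in the congruence `X_pow_dvd_log_exp` leaves an error divisible by `x ^ (N +
-- 1)`, invisible at order N. Only powers of one element occur, so `A` need not be commutative;
-- `Fields` is not.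
open Polynomial in
theorem log_pexp {x : PowerSeries A} (hx : PowerSeries.coeff 0 x = 0) (N : ℕ) :
    ∑ s ∈ Finset.Icc 1 N, ((-1 : ℂ) ^ (s + 1) / (s : ℂ)) •
      PowerSeries.coeff N ((pexp x - 1) ^ s) = PowerSeries.coeff N x := by
  obtain ⟨z, hz⟩ := X_pow_dvd_log_exp N
  have h1 := congrArg (fun q => PowerSeries.coeff N (aeval x q)) hz
  simp only [map_mul, map_sub, map_pow, aeval_X, map_sum, aeval_C] at h1
  rw [coeff_pow_mul_eq_zero hx _ (Nat.lt_succ_self N), sub_eq_zero] at h1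
  rw [← h1]
  refine Finset.sum_congr rfl fun s _ => ?_
  rw [← Algebra.smul_def, coeff_csmul]
  congr 1
  refine coeff_pow_congr (fun n hn => ?_) s N le_rfl
  have h2 : ∑ r ∈ Finset.Icc 1 N, algebraMap ℂ (PowerSeries A) ((r.factorial : ℂ)⁻¹) * x ^ r =
      expTrunc x (N + 1) - 1 := by
    rw [expTrunc, Finset.sum_range_succ', Finset.range_eq_Ico,
      Finset.sum_Ico_add' (fun r => ((r.factorial : ℂ)⁻¹) • x ^ r) 0 N 1]
    simp only [← Algebra.smul_def, pow_zero, Nat.factorial_zero, Nat.cast_one, inv_one, one_smul,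
      add_sub_cancel_right]
    rfl
  rw [map_sub, coeff_pexp hx (Nat.lt_succ_of_le hn), h2, map_sub]

end Exponential

/-! ### Heat flow of an exponential -/

section Heat

variable {V : Type*} [AddCommGroup V] [Module ℂ V]

/-- The exponential of a locally nilpotent linear map. -/
def expSum (f : V →ₗ[ℂ] V) (x : V) : V := ∑ᶠ s : ℕ, ((s.factorial : ℂ)⁻¹) • (f ^ s) x

theorem expSum_eq_sum (f : V →ₗ[ℂ] V) (x : V) (I : ℕ) (h : ∀ i, I ≤ i → (f ^ i) x = 0) :
    expSum f x = ∑ s ∈ Finset.range I, ((s.factorial : ℂ)⁻¹) • (f ^ s) x := by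
  refine finsum_eq_sum_of_support_subset _ fun i hi => ?_
  rw [Finset.coe_range, Set.mem_Iio]
  by_contra hc
  exact hi (by simp [h i (not_lt.mp hc)])

/-- The binomial theorem for commuting operators. `expSum` is a `finsum`, meaningful only when
finitely many terms survive, hence the nilpotence assumptions. -/
theorem expSum_add (f g : V →ₗ[ℂ] V) (hfg : Commute f g) (x : V) (I : ℕ)
    (hg : ∀ i, I ≤ i → (g ^ i) x = 0) (hf : ∀ y, ∃ J, ∀ j, J ≤ j → (f ^ j) y = 0) :
    expSum (f + g) x = expSum f (expSum g x) := by
  choose J hJ using fun i => hf ((g ^ i) x)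
  -- One exponent beyond which `f` kills every `(g ^ i) x` with i < I.
  set J' := (Finset.range I).sup J with hJ'
  have hz : ∀ i j, I ≤ i ∨ J' ≤ j → (f ^ j) ((g ^ i) x) = 0 := by
    intro i j h
    by_cases hi : I ≤ i
    · rw [hg i hi, map_zero]
    · refine hJ i j ((Finset.le_sup (f := J) (Finset.mem_range.mpr (not_le.mp hi))).trans ?_)
      exact h.resolve_left hi
  have hadd : ∀ s : ℕ, ((s.factorial : ℂ)⁻¹) • ((f + g) ^ s) x =
      ∑ p ∈ antidiagonal s,
        ((p.1.factorial : ℂ)⁻¹ * (p.2.factorial : ℂ)⁻¹) • (f ^ p.1) ((g ^ p.2) x) := by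
    intro s
    rw [hfg.add_pow', LinearMap.sum_apply, Finset.smul_sum]
    refine Finset.sum_congr rfl fun p hp => ?_
    rw [Finset.HasAntidiagonal.mem_antidiagonal] at hp
    subst hp
    rw [LinearMap.smul_apply, Module.End.mul_apply, ← Nat.cast_smul_eq_nsmul ℂ, smul_smul]
    congr 1
    have h1 := Nat.add_choose_mul_factorial_mul_factorial p.1 p.2
    rw [← Nat.choose_symm_add] at h1
    have h2 : ((p.1 + p.2).factorial : ℂ) ≠ 0 := by exact_mod_cast Nat.factorial_ne_zero _
    have h3 : (p.1.factorial : ℂ) ≠ 0 := by exact_mod_cast Nat.factorial_ne_zero _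
    have h4 : (p.2.factorial : ℂ) ≠ 0 := by exact_mod_cast Nat.factorial_ne_zero _
    have h5 : ((p.1 + p.2).choose p.1 : ℂ) * p.1.factorial * p.2.factorial =
      ((p.1 + p.2).factorial : ℂ) := by exact_mod_cast h1
    field_simp
    linear_combination h5
  rw [expSum_eq_sum g x I hg, expSum_eq_sum f _ J' (fun j hj => by
      rw [map_sum]; exact Finset.sum_eq_zero fun i _ => by rw [map_smul, hz i j (Or.inr hj),
        smul_zero]),
    expSum_eq_sum (f + g) x (I + J')]
  · simp only [hadd, map_sum, map_smul, Finset.smul_sum, smul_smul]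
    rw [Finset.sum_sigma', ← Finset.sum_product']
    refine Finset.sum_of_injOn (fun y => ⟨y.1 + y.2, y⟩) ?_ ?_ ?_ ?_ |>.symm
    · rintro ⟨a, b⟩ _ ⟨c, d⟩ _ h
      exact (Sigma.mk.inj_iff.mp h).2.eq
    · rintro ⟨a, b⟩ h
      simp only [Finset.coe_product, Finset.coe_range, Set.mem_prod, Set.mem_Iio] at h
      simp only [Finset.coe_sigma, Set.mem_sigma_iff, Finset.coe_range, Set.mem_Iio,
        Finset.mem_coe, Finset.HasAntidiagonal.mem_antidiagonal, and_true]
      omega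
    · rintro ⟨s, a, b⟩ h h'
      simp only [Finset.mem_sigma, Finset.mem_range, Finset.HasAntidiagonal.mem_antidiagonal] at h
      rw [hz b a, smul_zero]
      by_contra hc
      rw [not_or, not_le, not_le] at hc
      refine h' ⟨(a, b), ?_, ?_⟩
      · simpa using ⟨hc.2, hc.1⟩
      · obtain ⟨h1, rfl⟩ := h; rfl
    · rintro ⟨a, b⟩ _; rfl
  -- If s ≥ I + J', each splitting of s has at least I factors `g` or at least J' factors `f`.
  · intro s hs
    have h1 := hadd s
    rw [Finset.sum_eq_zero] at h1
    · refine (smul_eq_zero.mp h1).resolve_left ?_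
      exact inv_ne_zero (by exact_mod_cast s.factorial_ne_zero)
    · rintro ⟨a, b⟩ hp
      rw [Finset.HasAntidiagonal.mem_antidiagonal] at hp
      rw [hz b a (by simp only at hp; omega), smul_zero]

end Heat

section Flow

variable {A : Type*} [CommRing A] [Algebra ℂ A]

/-- Divided powers. -/
def divPow (u : A) (r : ℕ) : A := ((r.factorial : ℂ)⁻¹) • u ^ r

theorem divPow_zero (u : A) : divPow u 0 = 1 := by simp [divPow]

theorem divPow_mul_self (u : A) (r : ℕ) :
    divPow u r * u = ((r : ℂ) + 1) • divPow u (r + 1) := by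
  rw [divPow, divPow, smul_mul_assoc, ← pow_succ, smul_smul, Nat.factorial_succ]
  congr 1
  push_cast
  have : (r : ℂ) + 1 ≠ 0 := by exact_mod_cast Nat.succ_ne_zero r
  have h2 : (r.factorial : ℂ) ≠ 0 := by exact_mod_cast r.factorial_ne_zero
  field_simp

theorem divPow_succ (u : A) (r : ℕ) :
    divPow u (r + 1) = ((r : ℂ) + 1)⁻¹ • (divPow u r * u) := by
  have : (r : ℂ) + 1 ≠ 0 := by exact_mod_cast Nat.succ_ne_zero r
  rw [divPow_mul_self, smul_smul, inv_mul_cancel₀ this, one_smul]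

theorem IsLeibniz.divPow_succ {d : A →ₗ[ℂ] A} (h : IsLeibniz d) (u : A) (r : ℕ) :
    d (divPow u (r + 1)) = divPow u r * d u := by
  induction r with
  | zero => simp [divPow]
  | succ r ih =>
    have hr : (((r + 1 : ℕ) : ℂ) + 1) ≠ 0 := by exact_mod_cast Nat.succ_ne_zero (r + 1)
    rw [Graphene.divPow_succ u (r + 1), map_smul, h, ih, inv_smul_eq_iff₀ hr]
    have := divPow_mul_self u r
    rw [mul_right_comm, this, smul_mul_assoc]
    push_cast
    module

theorem IsSecondOrder.carre_divPow_succ {Δ : A →ₗ[ℂ] A} (h : IsSecondOrder Δ) (u : A) (r : ℕ) :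
    carre Δ (divPow u (r + 1)) u = divPow u r * carre Δ u u := by
  induction r with
  | zero => simp [divPow]
  | succ r ih =>
    have hr : (((r + 1 : ℕ) : ℂ) + 1) ≠ 0 := by exact_mod_cast Nat.succ_ne_zero (r + 1)
    rw [Graphene.divPow_succ u (r + 1), carre_smul_left, h, ih, inv_smul_eq_iff₀ hr,
      ← mul_assoc, mul_comm u, divPow_mul_self, smul_mul_assoc]
    push_cast
    module

/-- The second-order chain rule for the function u^(r+2)/(r+2)!, whose first two derivatives are
again divided powers. -/
theorem IsSecondOrder.divPow_add_two {Δ : A →ₗ[ℂ] A} (h : IsSecondOrder Δ) (u : A) (r : ℕ) :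
    Δ (divPow u (r + 2)) =
      divPow u (r + 1) * Δ u + (1 / 2 : ℂ) • (divPow u r * carre Δ u u) := by
  have key : ∀ x : A, Δ (x * u) = carre Δ x u + x * Δ u + u * Δ x := by
    intro x; rw [carre]; ring
  induction r with
  | zero =>
    rw [divPow_succ u 1, map_smul, key, h.carre_divPow_succ]
    simp only [divPow, zero_add, pow_one, Nat.factorial_one, Nat.cast_one, inv_one, one_smul,
      pow_zero, Nat.factorial_zero]
    module
  | succ r ih =>
    have hr : (((r + 2 : ℕ) : ℂ) + 1) ≠ 0 := by exact_mod_cast Nat.succ_ne_zero (r + 2)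
    rw [show r + 1 + 2 = (r + 2) + 1 from rfl, divPow_succ u (r + 2), map_smul, key,
      h.carre_divPow_succ, ih, inv_smul_eq_iff₀ hr, mul_add, ← mul_assoc, mul_comm u,
      divPow_mul_self, mul_smul_comm, ← mul_assoc, mul_comm u, divPow_mul_self]
    push_cast
    simp only [smul_mul_assoc]
    module

theorem coeff_serExt_pexp {f : A →ₗ[ℂ] A} {u : PowerSeries A} (hu : PowerSeries.coeff 0 u = 0)
    {N n : ℕ} (h : N < n) :
    PowerSeries.coeff N (serExt f (pexp u)) = PowerSeries.coeff N (serExt f (expTrunc u n)) := by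
  rw [coeff_serExt, coeff_serExt, coeff_pexp hu h]

/-- If `∂u = Δu + Γ(u,u)/2` then `∂ exp u = Δ exp u`. -/
theorem serExt_pexp_eq {d Δ : A →ₗ[ℂ] A} (hd : IsLeibniz d) (hΔ : IsSecondOrder Δ)
    {u : PowerSeries A} (hu : PowerSeries.coeff 0 u = 0)
    (hflow : serExt d u = serExt Δ u + (1 / 2 : ℂ) • carre (serExt Δ) u u) :
    serExt d (pexp u) = serExt Δ (pexp u) := by
  have hd1 : serExt d 1 = 0 := by
    have := hd.serExt 1 1
    simpa using this
  have e1 : ∀ n, serExt d (expTrunc u (n + 1)) = expTrunc u n * serExt d u := by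
    intro n
    have : ∀ m, expTrunc u m = ∑ r ∈ Finset.range m, divPow u r := fun m => rfl
    rw [this, this, Finset.sum_range_succ', map_add, divPow_zero, hd1, add_zero, map_sum,
      Finset.sum_mul]
    exact Finset.sum_congr rfl fun r _ => hd.serExt.divPow_succ u r
  -- Each derivative shortens the truncated exponential by one term, hence the lengths n + 2, n + 1,
  -- n.
  have e2 : ∀ n, serExt Δ (expTrunc u (n + 2)) = expTrunc u (n + 1) * serExt Δ u +
      (1 / 2 : ℂ) • (expTrunc u n * carre (serExt Δ) u u) := by
    intro n
    have : ∀ m, expTrunc u m = ∑ r ∈ Finset.range m, divPow u r := fun m => rfl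
    rw [this (n + 2), this n, this (n + 1), Finset.sum_range_succ', Finset.sum_range_succ',
      map_add, map_add, divPow_zero, hΔ.serExt.map_one, add_zero, map_sum,
      Finset.sum_range_succ' _ n, add_mul, Finset.sum_mul, Finset.sum_mul, Finset.smul_sum]
    have h1 : divPow u (0 + 1) = u := by simp [divPow]
    rw [h1, divPow_zero, one_mul, add_right_comm, ← Finset.sum_add_distrib]
    congr 1
    exact Finset.sum_congr rfl fun r _ => hΔ.serExt.divPow_add_two u r
  ext N
  rw [coeff_serExt_pexp hu (show N < N + 2 by omega), coeff_serExt_pexp hu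
    (show N < N + 2 by omega), e1, e2, hflow, mul_add, map_add, map_add]
  congr 1
  rw [mul_smul_comm, coeff_csmul, coeff_csmul]
  congr 1
  -- The two truncations differ by u^N Γ(u,u)/N!. It has order greater than N, because Γ(u,u) has no
  -- constant term.
  rw [expTrunc, Finset.sum_range_succ, add_mul, map_add, smul_mul_assoc, coeff_csmul]
  have hΓ : PowerSeries.coeff 0 (carre (serExt Δ) u u) = 0 := by
    rw [coeff_carre_serExt]
    simp [hu, carre_zero_left]
  have : PowerSeries.coeff N (u ^ N * carre (serExt Δ) u u) = 0 := by
    rw [PowerSeries.coeff_mul]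
    refine Finset.sum_eq_zero fun p hp => ?_
    rw [Finset.HasAntidiagonal.mem_antidiagonal] at hp
    rcases Nat.eq_zero_or_pos p.2 with h0 | h0
    · rw [h0, hΓ, mul_zero]
    · rw [coeff_pow_eq_zero hu (by omega), zero_mul]
  rw [this, smul_zero, add_zero, expTrunc]

/-- A polynomial solution of q' = Δq in the flow parameter is its own Taylor series: its coefficient
of order i is Δ^i q(0)/i!. -/
theorem coeff_of_derivative_eq {Δ : A →ₗ[ℂ] A} {q : Polynomial A}
    (h : Polynomial.derivative q = polyExt Δ q) (i : ℕ) :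
    (Δ ^ i) (q.coeff 0) = (i.factorial : ℂ) • q.coeff i := by
  induction i with
  | zero => simp
  | succ i ih =>
    rw [pow_succ', Module.End.mul_apply, ih, map_smul, ← coeff_polyExt, ← h,
      Polynomial.coeff_derivative, Nat.factorial_succ, mul_comm (i + 1), Nat.cast_mul, mul_smul]
    congr 1
    have : q.coeff (i + 1) * ((i : A) + 1) = ((i + 1 : ℕ) : A) * q.coeff (i + 1) := by
      push_cast; ring
    rw [this, ← nsmul_eq_mul, Nat.cast_smul_eq_nsmul]

/-- Since q is a polynomial, Δ is nilpotent on q(0), and the exponential series is a finite sum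
equal to q(1). -/
theorem expSum_of_derivative_eq {Δ : A →ₗ[ℂ] A} {q : Polynomial A}
    (h : Polynomial.derivative q = polyExt Δ q) :
    (∀ i, q.natDegree + 1 ≤ i → (Δ ^ i) (q.coeff 0) = 0) ∧
      expSum Δ (q.coeff 0) = q.eval 1 := by
  have hz : ∀ i, q.natDegree + 1 ≤ i → (Δ ^ i) (q.coeff 0) = 0 := fun i hi => by
    rw [coeff_of_derivative_eq h, Polynomial.coeff_eq_zero_of_natDegree_lt (by omega), smul_zero]
  refine ⟨hz, ?_⟩
  rw [expSum_eq_sum Δ _ _ hz, Polynomial.eval_eq_sum_range]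
  refine Finset.sum_congr rfl fun i _ => ?_
  rw [coeff_of_derivative_eq h, smul_smul,
    inv_mul_cancel₀ (by exact_mod_cast i.factorial_ne_zero), one_smul]
  simp

theorem derivative_isLeibniz :
    IsLeibniz ((Polynomial.derivative : Polynomial A →ₗ[A] Polynomial A).restrictScalars ℂ) := by
  intro x y
  simp only [LinearMap.restrictScalars_apply, Polynomial.derivative_mul]
  ring

/-- The flow equation integrates the heat equation for exponentials. -/
theorem expSum_pexp {Δ : A →ₗ[ℂ] A} (hΔ : IsSecondOrder Δ) (u : ℕ → ℕ → A)
    (h0 : ∀ j, u 0 j = 0) (hfin : ∀ N j, N < j → u N j = 0)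
    (hrec : ∀ N j : ℕ, ((j : ℂ) + 1) • u N (j + 1) = Δ (u N j) + (1 / 2 : ℂ) •
      ∑ p ∈ antidiagonal N, ∑ q ∈ antidiagonal j, carre Δ (u p.1 q.1) (u p.2 q.2)) (N : ℕ) :
    (∃ I, ∀ i, I ≤ i →
      (Δ ^ i) (PowerSeries.coeff N (pexp (PowerSeries.mk fun n => u n 0))) = 0) ∧
    expSum Δ (PowerSeries.coeff N (pexp (PowerSeries.mk fun n => u n 0))) =
      PowerSeries.coeff N
        (pexp (PowerSeries.mk fun n => ∑ j ∈ Finset.range (n + 1), u n j)) := by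
  -- The unknown as a polynomial in the flow parameter at each order of e; `hrec` is the flow
  -- equation read coefficient by coefficient.
  set v : PowerSeries (Polynomial A) := PowerSeries.mk fun n =>
    ∑ j ∈ Finset.range (n + 1), Polynomial.monomial j (u n j) with hv
  have hvc : ∀ n j, (PowerSeries.coeff n v).coeff j = u n j := by
    intro n j
    rw [hv, PowerSeries.coeff_mk, Polynomial.finsetSum_coeff]
    simp only [Polynomial.coeff_monomial]
    rw [Finset.sum_ite_eq' (Finset.range (n + 1)) j fun j => u n j]
    split_ifs with h
    · rfl
    · rw [hfin n j (by simpa using h)]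
  have hv0 : PowerSeries.coeff 0 v = 0 := by
    ext j; rw [hvc, h0, Polynomial.coeff_zero]
  have hflow : serExt ((Polynomial.derivative :
      Polynomial A →ₗ[A] Polynomial A).restrictScalars ℂ) v =
      serExt (polyExt Δ) v + (1 / 2 : ℂ) • carre (serExt (polyExt Δ)) v v := by
    ext n j
    rw [map_add, coeff_csmul, Polynomial.coeff_add, Polynomial.coeff_smul, coeff_serExt,
      coeff_serExt, coeff_carre_serExt, Polynomial.finsetSum_coeff, coeff_polyExt, hvc,
      LinearMap.restrictScalars_apply, Polynomial.coeff_derivative, hvc]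
    simp only [coeff_carre_polyExt, hvc]
    rw [← hrec n j]
    rw [Algebra.smul_def, mul_comm]
    simp
  have key := serExt_pexp_eq derivative_isLeibniz hΔ.polyExt hv0 hflow
  have hq : Polynomial.derivative (PowerSeries.coeff N (pexp v)) =
      polyExt Δ (PowerSeries.coeff N (pexp v)) := by
    have := congrArg (PowerSeries.coeff N) key
    rwa [coeff_serExt, coeff_serExt] at this
  obtain ⟨h1, h2⟩ := expSum_of_derivative_eq hq
  -- Specialization of the flow parameter: a = 0 gives the initial datum, a = 1 the integrated one.
  have heval : ∀ a : A, (PowerSeries.coeff N (pexp v)).eval a =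
      PowerSeries.coeff N (pexp (PowerSeries.mk fun n =>
        ∑ j ∈ Finset.range (n + 1), u n j * a ^ j)) := by
    intro a
    have h3 := map_pexp ((Polynomial.aeval a : Polynomial A →ₐ[A] A).restrictScalars ℂ) v
    have h4 := congrArg (PowerSeries.coeff N) h3
    rw [PowerSeries.coeff_map] at h4
    have h5 : PowerSeries.map ((Polynomial.aeval a : Polynomial A →ₐ[A] A).restrictScalars ℂ :
        Polynomial A →+* A) v = PowerSeries.mk fun n =>
        ∑ j ∈ Finset.range (n + 1), u n j * a ^ j := by
      ext n
      rw [PowerSeries.coeff_map, hv, PowerSeries.coeff_mk, PowerSeries.coeff_mk, map_sum]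
      refine Finset.sum_congr rfl fun j _ => ?_
      simp
    rw [h5] at h4
    rw [← h4]
    exact (Polynomial.coe_aeval_eq_eval a ▸ rfl)
  have hc0 : (PowerSeries.coeff N (pexp v)).coeff 0 =
      PowerSeries.coeff N (pexp (PowerSeries.mk fun n => u n 0)) := by
    rw [Polynomial.coeff_zero_eq_eval_zero, heval]
    congr 3
    ext n
    rw [Finset.sum_range_succ']
    simp
  rw [hc0, heval] at h2
  rw [hc0] at h1
  refine ⟨⟨_, h1⟩, ?_⟩
  simpa using h2

end Flow

/-! ### The Grassmann algebra: parity and left derivatives -/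

/-- The parity automorphism of the Grassmann algebra. -/
def gpar : Grass →ₐ[ℂ] Grass := CliffordAlgebra.involute

theorem gpar_psi (i : FLabel) : gpar (psi i) = -psi i := CliffordAlgebra.involute_ι _

theorem gpar_gpar (a : Grass) : gpar (gpar a) = a := CliffordAlgebra.involute_involute a

theorem gderiv_mul (i : FLabel) (a b : Grass) :
    gderiv i (a * b) = gderiv i a * b + gpar a * gderiv i b := by
  unfold gderiv gpar
  induction a using CliffordAlgebra.left_induction with
  | algebraMap r =>
    rw [CliffordAlgebra.contractLeft_algebraMap_mul, CliffordAlgebra.contractLeft_algebraMap,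
      zero_mul, zero_add, AlgHom.commutes]
  | add x y hx hy => rw [add_mul, map_add, hx, hy, map_add, map_add]; noncomm_ring
  | ι_mul x m hx =>
    rw [mul_assoc, CliffordAlgebra.contractLeft_ι_mul, hx, CliffordAlgebra.contractLeft_ι_mul,
      map_mul, CliffordAlgebra.involute_ι, sub_mul, smul_mul_assoc]
    noncomm_ring

theorem gpar_gderiv (i : FLabel) (a : Grass) : gpar (gderiv i a) = -gderiv i (gpar a) := by
  unfold gderiv gpar
  induction a using CliffordAlgebra.left_induction with
  | algebraMap r => simp [CliffordAlgebra.contractLeft_algebraMap]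
  | add x y hx hy => rw [map_add, map_add, hx, hy, map_add, map_add, neg_add]
  | ι_mul x m hx =>
    rw [CliffordAlgebra.contractLeft_ι_mul, map_sub, map_smul, map_mul, hx, map_mul,
      CliffordAlgebra.involute_ι, neg_mul, neg_mul, LinearMap.map_neg,
      CliffordAlgebra.contractLeft_ι_mul, mul_neg, neg_neg, neg_neg]

theorem gderiv_psi (i j : FLabel) : gderiv i (psi j) = if j = i then 1 else 0 := by
  rw [gderiv, psi, ExteriorAlgebra.ι, CliffordAlgebra.contractLeft_ι, Finsupp.lapply_apply,
    Finsupp.single_apply]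
  split_ifs <;> simp

theorem ι_mul_eq_gpar_mul_ι (v : FLabel →₀ ℂ) (a : Grass) :
    ExteriorAlgebra.ι ℂ v * a = gpar a * ExteriorAlgebra.ι ℂ v := by
  unfold gpar
  induction a using CliffordAlgebra.left_induction with
  | algebraMap r => rw [AlgHom.commutes, Algebra.commutes]
  | add x y hx hy => rw [mul_add, hx, hy, map_add, add_mul]
  | ι_mul x m hx =>
    have h := ExteriorAlgebra.ι_add_mul_swap (R := ℂ) v m
    have h2 : ExteriorAlgebra.ι ℂ v * CliffordAlgebra.ι 0 m =
        -(CliffordAlgebra.ι 0 m * ExteriorAlgebra.ι ℂ v) := eq_neg_of_add_eq_zero_left h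
    rw [← mul_assoc, h2, map_mul, CliffordAlgebra.involute_ι, neg_mul, neg_mul, neg_mul,
      mul_assoc, mul_assoc, hx]

/-- Moving a generator across `a` costs the parity automorphism, which is trivial on even elements;
generators span the algebra multiplicatively. -/
theorem commute_of_gpar_eq {a : Grass} (ha : gpar a = a) (b : Grass) : Commute a b := by
  induction b using CliffordAlgebra.left_induction with
  | algebraMap r => exact Algebra.commutes' r a |>.symm
  | add x y hx hy => exact hx.add_right hy
  | ι_mul x m hx =>
    refine Commute.mul_right ?_ hx
    have := ι_mul_eq_gpar_mul_ι m a
    rw [ha] at this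
    exact this.symm

theorem psi_mul_psi (i j : FLabel) : psi i * psi j = -(psi j * psi i) := by
  have := ι_mul_eq_gpar_mul_ι (Finsupp.single i 1) (psi j)
  rw [gpar_psi, neg_mul] at this
  exact this

/-! ### The algebra of fields: parity and derivatives -/

/-- The parity automorphism of the algebra of fields. -/
def par : Fields →ₐ[ℂ] Fields := Algebra.TensorProduct.map (AlgHom.id ℂ Bose) gpar

@[simp] theorem par_tmul (b : Bose) (g : Grass) : par (b ⊗ₜ g) = b ⊗ₜ gpar g := by
  simp [par]

/-- Derivative with respect to a photon variable. -/
def bosD (i : BLabel) : Fields →ₗ[ℂ] Fields := TensorProduct.map (bderiv i) LinearMap.id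

/-- Left derivative with respect to a Grassmann variable. -/
def ferD (i : FLabel) : Fields →ₗ[ℂ] Fields := TensorProduct.map LinearMap.id (gderiv i)

@[simp] theorem bosD_tmul (i : BLabel) (b : Bose) (g : Grass) :
    bosD i (b ⊗ₜ g) = bderiv i b ⊗ₜ g := rfl

@[simp] theorem ferD_tmul (i : FLabel) (b : Bose) (g : Grass) :
    ferD i (b ⊗ₜ g) = b ⊗ₜ gderiv i g := rfl

theorem bderiv_mul (i : BLabel) (a b : Bose) : bderiv i (a * b) = bderiv i a * b + a * bderiv i b := by
  simp only [bderiv, Derivation.coeFn_coe, Derivation.leibniz, smul_eq_mul]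
  ring

theorem bosD_mul (i : BLabel) (x y : Fields) : bosD i (x * y) = bosD i x * y + x * bosD i y := by
  induction x using TensorProduct.induction_on with
  | zero => simp
  | add x x' hx hx' => rw [add_mul, map_add, hx, hx', map_add]; noncomm_ring
  | tmul b g =>
    induction y using TensorProduct.induction_on with
    | zero => simp
    | add y y' hy hy' => rw [mul_add, map_add, hy, hy', map_add]; noncomm_ring
    | tmul b' g' =>
      simp only [Algebra.TensorProduct.tmul_mul_tmul, bosD_tmul, bderiv_mul,
        TensorProduct.add_tmul]

theorem ferD_mul (i : FLabel) (x y : Fields) : ferD i (x * y) = ferD i x * y + par x * ferD i y := by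
  induction x using TensorProduct.induction_on with
  | zero => simp
  | add x x' hx hx' => rw [add_mul, map_add, hx, hx', map_add, map_add]; noncomm_ring
  | tmul b g =>
    induction y using TensorProduct.induction_on with
    | zero => simp
    | add y y' hy hy' => rw [mul_add, map_add, hy, hy', map_add]; noncomm_ring
    | tmul b' g' =>
      simp only [Algebra.TensorProduct.tmul_mul_tmul, ferD_tmul, gderiv_mul, par_tmul,
        TensorProduct.tmul_add]

theorem par_bosD (i : BLabel) (x : Fields) : par (bosD i x) = bosD i (par x) := by
  induction x using TensorProduct.induction_on with
  | zero => simp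
  | add x x' hx hx' => simp only [map_add, hx, hx']
  | tmul b g => simp

theorem par_ferD (i : FLabel) (x : Fields) : par (ferD i x) = (-1 : ℂ) • ferD i (par x) := by
  induction x using TensorProduct.induction_on with
  | zero => simp
  | add x x' hx hx' => simp only [map_add, hx, hx', smul_add]
  | tmul b g =>
    rw [ferD_tmul, par_tmul, par_tmul, ferD_tmul, gpar_gderiv, ← TensorProduct.tmul_smul,
      neg_one_smul]

/-- A fixed point of `par` need not be presented by tensors with even factors. Averaging cures this:
2x = x + par x is a sum of terms b ⊗ (g + gpar g), whose Grassmann factors are central. -/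
theorem commute_of_par_eq {x : Fields} (hx : par x = x) (y : Fields) : Commute x y := by
  have key : ∀ z y : Fields, Commute (z + par z) y := by
    intro z y
    induction z using TensorProduct.induction_on with
    | zero => simp
    | add z z' h h' =>
      rw [map_add, add_add_add_comm]
      exact h.add_left h'
    | tmul b g =>
      rw [par_tmul, ← TensorProduct.tmul_add]
      induction y using TensorProduct.induction_on with
      | zero => simp
      | add y y' h h' => exact h.add_right h'
      | tmul b' g' =>
        have hg : gpar (g + gpar g) = g + gpar g := by rw [map_add, gpar_gpar, add_comm]
        have h1 := commute_of_gpar_eq hg g'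
        unfold Commute SemiconjBy
        rw [Algebra.TensorProduct.tmul_mul_tmul, Algebra.TensorProduct.tmul_mul_tmul, h1.eq,
          mul_comm]
  have h := key x y
  rw [hx, ← two_smul ℂ x] at h
  have h2 := h.smul_left (2⁻¹ : ℂ)
  rwa [smul_smul, inv_mul_cancel₀ two_ne_zero, one_smul] at h2

/-- The even part of the algebra of fields. -/
def evenPart : Subalgebra ℂ Fields := AlgHom.equalizer par (AlgHom.id ℂ Fields)

theorem mem_evenPart {x : Fields} : x ∈ evenPart ↔ par x = x := Iff.rfl

/-- Commutativity is what lets the second-order calculus apply to fermions: the interaction is even,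
and both Laplacians preserve parity. -/
instance : CommRing evenPart :=
  { (inferInstance : Ring evenPart) with
    mul_comm := fun x y => Subtype.ext (commute_of_par_eq x.2 y.1).eq }

theorem even_comm {x : Fields} (hx : x ∈ evenPart) (y : Fields) : x * y = y * x :=
  (commute_of_par_eq hx y).eq

theorem bosD_mem_evenPart (i : BLabel) {x : Fields} (hx : x ∈ evenPart) :
    bosD i x ∈ evenPart := by
  rw [mem_evenPart] at hx ⊢
  rw [par_bosD, hx]

theorem ferD_ferD_mem_evenPart (i j : FLabel) {x : Fields} (hx : x ∈ evenPart) :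
    ferD i (ferD j x) ∈ evenPart := by
  rw [mem_evenPart] at hx ⊢
  rw [par_ferD, par_ferD, hx, map_smul, smul_smul, neg_one_mul, neg_neg, one_smul]

/-- The restriction to the even part of a linear map that preserves it. -/
def evenRestrict (f : Fields →ₗ[ℂ] Fields) (hf : ∀ x ∈ evenPart, f x ∈ evenPart) :
    evenPart →ₗ[ℂ] evenPart where
  toFun x := ⟨f x.1, hf x.1 x.2⟩
  map_add' x y := Subtype.ext (map_add f x.1 y.1)
  map_smul' c x := Subtype.ext (map_smul f c x.1)

theorem carre_bosD (i j : BLabel) (x y : Fields) (hy : y ∈ evenPart) :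
    bosD i (bosD j (x * y)) - x * bosD i (bosD j y) - y * bosD i (bosD j x) =
      bosD i x * bosD j y + bosD j x * bosD i y := by
  simp only [bosD_mul, map_add]
  rw [even_comm hy]
  noncomm_ring

/-- The minus sign appears because the outer antiderivation passes an odd element, the inner
derivative of an even one. -/
theorem carre_ferD (i j : FLabel) (x y : Fields) (hx : x ∈ evenPart) (hy : y ∈ evenPart) :
    ferD i (ferD j (x * y)) - x * ferD i (ferD j y) - y * ferD i (ferD j x) =
      ferD i x * ferD j y - ferD j x * ferD i y := by
  have hx' := mem_evenPart.mp hx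
  simp only [ferD_mul, map_add, par_ferD, hx']
  rw [even_comm hy, smul_mul_assoc]
  module

/-- The operator `∂ᵢ∂ⱼ` in the photon variables, on the even part. -/
def bosE (i j : BLabel) : evenPart →ₗ[ℂ] evenPart :=
  evenRestrict (bosD i ∘ₗ bosD j) fun _ hx => bosD_mem_evenPart i (bosD_mem_evenPart j hx)

/-- The operator `∂ᵢ∂ⱼ` in the Grassmann variables, on the even part. -/
def ferE (i j : FLabel) : evenPart →ₗ[ℂ] evenPart :=
  evenRestrict (ferD i ∘ₗ ferD j) fun _ hx => ferD_ferD_mem_evenPart i j hx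

theorem coe_carre_bosE (i j : BLabel) (x y : evenPart) :
    ((carre (bosE i j) x y : evenPart) : Fields) =
      bosD i x * bosD j y + bosD j x * bosD i y :=
  carre_bosD i j x y y.2

theorem coe_carre_ferE (i j : FLabel) (x y : evenPart) :
    ((carre (ferE i j) x y : evenPart) : Fields) =
      ferD i x * ferD j y - ferD j x * ferD i y :=
  carre_ferD i j x y x.2 y.2

theorem bosE_isSecondOrder (i j : BLabel) : IsSecondOrder (bosE i j) := by
  intro x y z
  apply Subtype.ext
  rw [Subalgebra.coe_add, Subalgebra.coe_mul, Subalgebra.coe_mul, coe_carre_bosE, coe_carre_bosE,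
    coe_carre_bosE, Subalgebra.coe_mul, bosD_mul, bosD_mul]
  rw [even_comm y.2 (bosD i x * _ + _), ← even_comm y.2 (bosD i x), ← even_comm y.2 (bosD j x),
    ← even_comm y.2 (bosD i x * _ + _)]
  noncomm_ring

/-- On even factors the antiderivation `ferD` obeys the ordinary Leibniz rule, and even factors move
freely past the odd derivatives. -/
theorem ferE_isSecondOrder (i j : FLabel) : IsSecondOrder (ferE i j) := by
  intro x y z
  apply Subtype.ext
  rw [Subalgebra.coe_add, Subalgebra.coe_mul, Subalgebra.coe_mul, coe_carre_ferE, coe_carre_ferE,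
    coe_carre_ferE, Subalgebra.coe_mul, ferD_mul, ferD_mul, mem_evenPart.mp x.2]
  rw [← even_comm y.2 (ferD i x), ← even_comm y.2 (ferD j x)]
  simp only [add_mul, mul_sub, mul_assoc]
  abel

/-! ### The ultraviolet Laplacian -/

variable (P : Params) (K : ℕ)

/-- The photon part of the Laplacian. -/
def lapA : Fields →ₗ[ℂ] Fields :=
  ∑ p ∈ bModes P K, ∑ μ : Fin 3,
    ((1 / 2 * (P.β * area P.L) * photonPropUV P K p : ℝ) : ℂ) • (bosD (μ, p) ∘ₗ bosD (μ, -p))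

/-- The entries of the ultraviolet fermionic propagator. -/
def gUV (k : Mom) (ρ ρ' : Fin 2) : ℂ := fermionPropUV P K k ρ ρ'

/-- The fermion part of the Laplacian. -/
def lapF : Fields →ₗ[ℂ] Fields :=
  ∑ k ∈ fModes P K, ∑ σ : Fin 2, ∑ ρ : Fin 2, ∑ ρ' : Fin 2,
    (((P.β * sites P.L : ℝ) : ℂ) * gUV P K k ρ ρ') •
      (ferD (k, σ, ρ', true) ∘ₗ ferD (k, σ, ρ, false))

theorem laplacianUV_eq : laplacianUV P K = lapA P K + lapF P K := by
  unfold laplacianUV lapA lapF bosD ferD gUV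
  simp only [← TensorProduct.map_comp, LinearMap.id_comp]

theorem expectUV_eq (x : Fields) : expectUV P K x = expSum (lapA P K + lapF P K) x := by
  rw [← laplacianUV_eq]; rfl

/-- The photon part of the Laplacian on the even part. -/
def lapAE : evenPart →ₗ[ℂ] evenPart :=
  ∑ p ∈ bModes P K, ∑ μ : Fin 3,
    ((1 / 2 * (P.β * area P.L) * photonPropUV P K p : ℝ) : ℂ) • bosE (μ, p) (μ, -p)

/-- The fermion part of the Laplacian on the even part. -/
def lapFE : evenPart →ₗ[ℂ] evenPart :=
  ∑ k ∈ fModes P K, ∑ σ : Fin 2, ∑ ρ : Fin 2, ∑ ρ' : Fin 2,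
    (((P.β * sites P.L : ℝ) : ℂ) * gUV P K k ρ ρ') •
      ferE (k, σ, ρ', true) (k, σ, ρ, false)

theorem lapAE_isSecondOrder : IsSecondOrder (lapAE P K) :=
  IsSecondOrder.sum _ fun _ _ => IsSecondOrder.sum _ fun _ _ => (bosE_isSecondOrder _ _).smul _

theorem lapFE_isSecondOrder : IsSecondOrder (lapFE P K) :=
  IsSecondOrder.sum _ fun _ _ => IsSecondOrder.sum _ fun _ _ => IsSecondOrder.sum _ fun _ _ =>
    IsSecondOrder.sum _ fun _ _ => (ferE_isSecondOrder _ _).smul _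

theorem coe_lapAE (x : evenPart) : (lapAE P K x : Fields) = lapA P K x := by
  simp only [lapAE, lapA, LinearMap.sum_apply, LinearMap.smul_apply, AddSubmonoidClass.coe_finsetSum]
  rfl

theorem coe_lapFE (x : evenPart) : (lapFE P K x : Fields) = lapF P K x := by
  simp only [lapFE, lapF, LinearMap.sum_apply, LinearMap.smul_apply, AddSubmonoidClass.coe_finsetSum]
  rfl

theorem coe_lapAE_pow (s : ℕ) (x : evenPart) :
    (((lapAE P K) ^ s) x : Fields) = ((lapA P K) ^ s) x := by
  induction s with
  | zero => simp
  | succ s ih =>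
    rw [pow_succ', pow_succ', Module.End.mul_apply, Module.End.mul_apply, ← ih, coe_lapAE]

theorem coe_lapFE_pow (s : ℕ) (x : evenPart) :
    (((lapFE P K) ^ s) x : Fields) = ((lapF P K) ^ s) x := by
  induction s with
  | zero => simp
  | succ s ih =>
    rw [pow_succ', pow_succ', Module.End.mul_apply, Module.End.mul_apply, ← ih, coe_lapFE]

theorem carre_sum_op {A ι : Type*} [CommRing A] [Algebra ℂ A] (s : Finset ι)
    (Δ : ι → A →ₗ[ℂ] A) (x y : A) :
    carre (∑ i ∈ s, Δ i) x y = ∑ i ∈ s, carre (Δ i) x y := by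
  simp only [carre, LinearMap.sum_apply, Finset.mul_sum, Finset.sum_sub_distrib]

theorem coe_carre_lapAE (x y : evenPart) : ((carre (lapAE P K) x y : evenPart) : Fields) =
    ∑ p ∈ bModes P K, ∑ μ : Fin 3,
      ((1 / 2 * (P.β * area P.L) * photonPropUV P K p : ℝ) : ℂ) •
        (bosD (μ, p) x * bosD (μ, -p) y + bosD (μ, -p) x * bosD (μ, p) y) := by
  simp only [lapAE, carre_sum_op, carre_smul_op, AddSubmonoidClass.coe_finsetSum,
    ← coe_carre_bosE]
  rfl

theorem coe_carre_lapFE (x y : evenPart) : ((carre (lapFE P K) x y : evenPart) : Fields) =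
    ∑ k ∈ fModes P K, ∑ σ : Fin 2, ∑ ρ : Fin 2, ∑ ρ' : Fin 2,
    (((P.β * sites P.L : ℝ) : ℂ) * gUV P K k ρ ρ') •
      (ferD (k, σ, ρ', true) x * ferD (k, σ, ρ, false) y -
        ferD (k, σ, ρ, false) x * ferD (k, σ, ρ', true) y) := by
  simp only [lapFE, carre_sum_op, carre_smul_op, AddSubmonoidClass.coe_finsetSum,
    ← coe_carre_ferE]
  rfl

/-- The two derivatives act on different tensor factors. -/
theorem commute_bosD_ferD (i : BLabel) (j : FLabel) : Commute (bosD i) (ferD j) := by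
  unfold Commute SemiconjBy bosD ferD
  rw [Module.End.mul_eq_comp, Module.End.mul_eq_comp, ← TensorProduct.map_comp,
    ← TensorProduct.map_comp]
  rfl

theorem commute_lapA_lapF : Commute (lapA P K) (lapF P K) := by
  refine Commute.sum_left _ _ _ fun p _ => Commute.sum_left _ _ _ fun μ _ =>
    Commute.smul_left ?_ _
  refine Commute.sum_right _ _ _ fun k _ => Commute.sum_right _ _ _ fun σ _ =>
    Commute.sum_right _ _ _ fun ρ _ => Commute.sum_right _ _ _ fun ρ' _ =>
    Commute.smul_right ?_ _
  have h := fun i j => commute_bosD_ferD i j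
  exact Commute.mul_left ((h _ _).mul_right (h _ _)) ((h _ _).mul_right (h _ _))

/-- Fields of degree at most `d` in the photon variables. -/
def bdegLE (d : ℕ) : Submodule ℂ Fields :=
  Submodule.span ℂ {x | ∃ (s : BLabel →₀ ℕ) (a : ℂ) (g : Grass), s.degree ≤ d ∧
    x = MvPolynomial.monomial s a ⊗ₜ g}

theorem bdegLE_mono {d d' : ℕ} (h : d ≤ d') : bdegLE d ≤ bdegLE d' :=
  Submodule.span_mono fun _ ⟨s, a, g, hs, hx⟩ => ⟨s, a, g, hs.trans h, hx⟩

theorem exists_mem_bdegLE (x : Fields) : ∃ d, x ∈ bdegLE d := by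
  induction x using TensorProduct.induction_on with
  | zero => exact ⟨0, Submodule.zero_mem _⟩
  | add x y hx hy =>
    obtain ⟨d, hd⟩ := hx
    obtain ⟨d', hd'⟩ := hy
    exact ⟨max d d', Submodule.add_mem _ (bdegLE_mono (le_max_left _ _) hd)
      (bdegLE_mono (le_max_right _ _) hd')⟩
  | tmul b g =>
    induction b using MvPolynomial.induction_on' with
    | monomial s a => exact ⟨s.degree, Submodule.subset_span ⟨s, a, g, le_rfl, rfl⟩⟩
    | add p q hp hq =>
      obtain ⟨d, hd⟩ := hp
      obtain ⟨d', hd'⟩ := hq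
      rw [TensorProduct.add_tmul]
      exact ⟨max d d', Submodule.add_mem _ (bdegLE_mono (le_max_left _ _) hd)
        (bdegLE_mono (le_max_right _ _) hd')⟩

theorem bosD_mem_bdegLE (i : BLabel) {d : ℕ} {x : Fields} (hx : x ∈ bdegLE (d + 1)) :
    bosD i x ∈ bdegLE d := by
  induction hx using Submodule.span_induction with
  | zero => rw [map_zero]; exact Submodule.zero_mem _
  | add x y _ _ hx hy => rw [map_add]; exact Submodule.add_mem _ hx hy
  | smul c x _ hx => rw [map_smul]; exact Submodule.smul_mem _ _ hx
  | mem x hx =>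
    obtain ⟨s, a, g, hs, rfl⟩ := hx
    rw [bosD_tmul, bderiv, Derivation.coeFn_coe, MvPolynomial.pderiv_monomial]
    by_cases h0 : s i = 0
    · simp [h0]
    · refine Submodule.subset_span ⟨_, _, g, ?_, rfl⟩
      have h1 : s - Finsupp.single i 1 + Finsupp.single i 1 = s :=
        tsub_add_cancel_of_le (by
          rw [Finsupp.single_le_iff]; omega)
      have h2 := congrArg Finsupp.degree h1
      rw [map_add, Finsupp.degree_single] at h2
      omega

theorem bosD_eq_zero (i : BLabel) {x : Fields} (hx : x ∈ bdegLE 0) : bosD i x = 0 := by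
  induction hx using Submodule.span_induction with
  | zero => rw [map_zero]
  | add x y _ _ hx hy => rw [map_add, hx, hy, add_zero]
  | smul c x _ hx => rw [map_smul, hx, smul_zero]
  | mem x hx =>
    obtain ⟨s, a, g, hs, rfl⟩ := hx
    have : s = 0 := by simpa [Finsupp.degree_eq_zero_iff] using hs
    subst this
    rw [bosD_tmul, bderiv, Derivation.coeFn_coe, MvPolynomial.pderiv_monomial]
    simp

theorem lapA_mem_bdegLE {d : ℕ} {x : Fields} (hx : x ∈ bdegLE (d + 1)) :
    lapA P K x ∈ bdegLE d := by
  simp only [lapA, LinearMap.sum_apply, LinearMap.smul_apply, LinearMap.comp_apply]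
  exact Submodule.sum_mem _ fun p _ => Submodule.sum_mem _ fun μ _ => Submodule.smul_mem _ _
    (bosD_mem_bdegLE _ (bdegLE_mono (Nat.le_succ d) (bosD_mem_bdegLE _ hx)))

theorem lapA_eq_zero {x : Fields} (hx : x ∈ bdegLE 0) : lapA P K x = 0 := by
  simp only [lapA, LinearMap.sum_apply, LinearMap.smul_apply, LinearMap.comp_apply,
    bosD_eq_zero _ hx, map_zero, smul_zero, Finset.sum_const_zero]

/-- Each application lowers the photon degree, which is finite for any element of `Fields`. -/
theorem lapA_locally_nilpotent (x : Fields) : ∃ J, ∀ j, J ≤ j → ((lapA P K) ^ j) x = 0 := by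
  obtain ⟨d, hd⟩ := exists_mem_bdegLE x
  refine ⟨d + 1, fun j hj => ?_⟩
  induction d generalizing x j with
  | zero =>
    obtain ⟨j, rfl⟩ := Nat.exists_eq_add_of_le hj
    rw [add_comm, pow_add, Module.End.mul_apply, zero_add, pow_one, lapA_eq_zero P K hd, map_zero]
  | succ d ih =>
    obtain ⟨j, rfl⟩ := Nat.exists_eq_succ_of_ne_zero (show j ≠ 0 by omega)
    rw [pow_succ, Module.End.mul_apply]
    exact ih _ (lapA_mem_bdegLE P K hd) j (by omega)

/-! ### Sums over tuples -/

section Tuples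

variable {α β M : Type*} [AddCommMonoid M]

theorem sum_piFinset_insertNth {m : ℕ} (S : Finset α) (i : Fin (m + 1))
    (F : (Fin (m + 1) → α) → M) :
    ∑ b ∈ Fintype.piFinset (fun _ : Fin (m + 1) => S), F b =
      ∑ y ∈ S, ∑ b ∈ Fintype.piFinset (fun _ : Fin m => S), F (i.insertNth y b) := by
  rw [← Finset.sum_product']
  symm
  refine Finset.sum_equiv (Fin.insertNthEquiv (fun _ => α) i) (fun x => ?_) fun x _ => rfl
  simp only [Finset.mem_product, Fintype.mem_piFinset, Fin.insertNthEquiv_apply]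
  rw [Fin.forall_iff_succAbove i]
  simp

theorem sum_piFinset_append {m n : ℕ} (S : Finset α) (F : (Fin (m + n) → α) → M) :
    ∑ b ∈ Fintype.piFinset (fun _ : Fin (m + n) => S), F b =
      ∑ b ∈ Fintype.piFinset (fun _ : Fin m => S),
        ∑ b' ∈ Fintype.piFinset (fun _ : Fin n => S), F (Fin.append b b') := by
  rw [← Finset.sum_product']
  symm
  refine Finset.sum_nbij' (fun x => Fin.append x.1 x.2)
    (fun b => (fun i => b (Fin.castAdd n i), fun i => b (Fin.natAdd m i))) ?_ ?_ ?_ ?_ ?_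
  · rintro ⟨a, b⟩ h
    simp only [Finset.mem_product, Fintype.mem_piFinset] at h
    rw [Fintype.mem_piFinset, Fin.forall_fin_add]
    simpa using h
  · intro b h
    simp only [Finset.mem_product, Fintype.mem_piFinset] at h ⊢
    exact ⟨fun i => h _, fun i => h _⟩
  · rintro ⟨a, b⟩ _; simp
  · intro b _; exact Fin.append_castAdd_natAdd
  · rintro ⟨a, b⟩ _; rfl

theorem sum_univ_append [Fintype α] {m n : ℕ} (F : (Fin (m + n) → α) → M) :
    ∑ b, F b = ∑ b : Fin m → α, ∑ b' : Fin n → α, F (Fin.append b b') := by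
  have := sum_piFinset_append (m := m) (n := n) Finset.univ F
  simpa only [Fintype.piFinset_univ] using this

theorem sum_piFinset_prod {n : ℕ} (S : Finset α) (T : Finset β)
    (F : (Fin n → α) → (Fin n → β) → M) :
    ∑ q ∈ Fintype.piFinset (fun _ : Fin n => S ×ˢ T), F (fun j => (q j).1) (fun j => (q j).2) =
      ∑ a ∈ Fintype.piFinset (fun _ : Fin n => S),
        ∑ b ∈ Fintype.piFinset (fun _ : Fin n => T), F a b := by
  rw [← Finset.sum_product' (f := F)]
  refine Finset.sum_equiv (Equiv.arrowProdEquivProdArrow (Fin n) (fun _ => α) (fun _ => β))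
    (fun x => ?_) fun x _ => rfl
  simp [Fintype.mem_piFinset, Equiv.arrowProdEquivProdArrow, forall_and]

end Tuples

/-! ### Monomials and polynomials in the fields -/

/-- Labels of a pair `Ψ̂⁺Ψ̂⁻` without spin. -/
abbrev QLabel := (Fin 2 × Fin 2) × (Mom × Mom)

/-- Spin-independent coefficients of field monomials with `n` pairs and `m` photons. -/
abbrev Kern (n m : ℕ) := (Fin n → QLabel) → (Fin m → BLabel) → ℂ

/-- The pair `Ψ̂⁺Ψ̂⁻`. -/
def gpair (σ : Fin 2) (q : QLabel) : Grass :=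
  psi (q.2.1, σ, q.1.1, true) * psi (q.2.2, σ, q.1.2, false)

/-- An ordered product of pairs. -/
def gmon {n : ℕ} (σ : Fin n → Fin 2) (q : Fin n → QLabel) : Grass :=
  (List.ofFn fun j => gpair (σ j) (q j)).prod

/-- A product of photon variables. -/
def bmon {m : ℕ} (b : Fin m → BLabel) : Bose := ∏ i, MvPolynomial.X (b i)

theorem gmon_append {n n' : ℕ} (σ : Fin n → Fin 2) (σ' : Fin n' → Fin 2) (q : Fin n → QLabel)
    (q' : Fin n' → QLabel) :
    gmon (Fin.append σ σ') (Fin.append q q') = gmon σ q * gmon σ' q' := by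
  rw [gmon, gmon, gmon, ← List.prod_append, ← List.ofFn_fin_append]
  congr 2
  funext j
  refine Fin.addCases (fun i => ?_) (fun i => ?_) j <;> simp

theorem bmon_append {m m' : ℕ} (b : Fin m → BLabel) (b' : Fin m' → BLabel) :
    bmon (Fin.append b b') = bmon b * bmon b' := by
  rw [bmon, Fin.prod_univ_add]
  simp [bmon]

theorem bderiv_prod {ι : Type*} [DecidableEq ι] (x : BLabel) (s : Finset ι) (f : ι → Bose) :
    bderiv x (∏ i ∈ s, f i) = ∑ i ∈ s, bderiv x (f i) * ∏ j ∈ s.erase i, f j := by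
  induction s using Finset.induction_on with
  | empty =>
    rw [Finset.prod_empty, Finset.sum_empty, bderiv, Derivation.coeFn_coe,
      Derivation.map_one_eq_zero]
  | insert a s ha ih =>
    rw [Finset.prod_insert ha, bderiv_mul, ih, Finset.sum_insert ha, Finset.erase_insert ha,
      Finset.mul_sum]
    congr 1
    refine Finset.sum_congr rfl fun i hi => ?_
    have hia : i ≠ a := fun h => ha (h ▸ hi)
    rw [Finset.erase_insert_of_ne hia.symm, Finset.prod_insert (by simp [ha])]
    ring

theorem bderiv_bmon {m : ℕ} (x : BLabel) (b : Fin (m + 1) → BLabel) :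
    bderiv x (bmon b) = ∑ i, if b i = x then bmon (fun j => b (i.succAbove j)) else 0 := by
  rw [bmon, bderiv_prod]
  refine Finset.sum_congr rfl fun i _ => ?_
  have h1 : ∏ j ∈ Finset.univ.erase i, (MvPolynomial.X (b j) : Bose) =
      bmon (fun j => b (i.succAbove j)) := by
    rw [← Finset.compl_singleton, ← Fin.image_succAbove_univ,
      Finset.prod_image (fun _ _ _ _ h => Fin.succAbove_right_injective h)]
    rfl
  rw [h1, bderiv, Derivation.coeFn_coe, MvPolynomial.pderiv_X, Pi.single_apply]
  split_ifs <;> simp_all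

theorem bderiv_bmon_zero (x : BLabel) (b : Fin 0 → BLabel) : bderiv x (bmon b) = 0 := by
  rw [bmon, bderiv_prod]
  simp

variable (P : Params) (K : ℕ)

/-- The pair labels with momenta among the modes. -/
def qLabels : Finset QLabel := Finset.univ ×ˢ (fModes P K ×ˢ fModes P K)

/-- The photon labels with momentum among the modes. -/
def bLabels : Finset BLabel := Finset.univ ×ˢ bModes P K

/-- The photon polynomial with coefficients `c`. -/
def bpoly {m : ℕ} (c : (Fin m → BLabel) → ℂ) : Bose :=
  ∑ b ∈ Fintype.piFinset fun _ : Fin m => bLabels P K, c b • bmon b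

/-- The field polynomial with coefficients `c`. -/
def fpoly {n m : ℕ} (c : Kern n m) : Fields :=
  ∑ σ : Fin n → Fin 2, ∑ q ∈ Fintype.piFinset fun _ : Fin n => qLabels P K,
    bpoly P K (c q) ⊗ₜ[ℂ] gmon σ q

variable {P K}

theorem bpoly_add {m : ℕ} (c c' : (Fin m → BLabel) → ℂ) :
    bpoly P K (c + c') = bpoly P K c + bpoly P K c' := by
  simp only [bpoly, Pi.add_apply, add_smul, Finset.sum_add_distrib]

theorem bpoly_smul {m : ℕ} (a : ℂ) (c : (Fin m → BLabel) → ℂ) :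
    bpoly P K (a • c) = a • bpoly P K c := by
  simp only [bpoly, Pi.smul_apply, smul_eq_mul, mul_smul, Finset.smul_sum]

theorem bpoly_zero {m : ℕ} : bpoly P K (0 : (Fin m → BLabel) → ℂ) = 0 := by
  simp [bpoly]

theorem bpoly_sum {m : ℕ} {ι : Type*} (s : Finset ι) (c : ι → (Fin m → BLabel) → ℂ) :
    bpoly P K (∑ i ∈ s, c i) = ∑ i ∈ s, bpoly P K (c i) := by
  classical
  induction s using Finset.induction_on with
  | empty => simp [bpoly_zero]
  | insert a s ha ih => rw [Finset.sum_insert ha, Finset.sum_insert ha, bpoly_add, ih]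

theorem bpoly_mul {m m' : ℕ} (c : (Fin m → BLabel) → ℂ) (c' : (Fin m' → BLabel) → ℂ) :
    bpoly P K c * bpoly P K c' = bpoly P K fun b : Fin (m + m') → BLabel =>
      c (fun i => b (Fin.castAdd m' i)) * c' (fun i => b (Fin.natAdd m i)) := by
  simp only [bpoly]
  rw [sum_piFinset_append, Finset.sum_mul]
  refine Finset.sum_congr rfl fun b _ => ?_
  rw [Finset.mul_sum]
  refine Finset.sum_congr rfl fun b' _ => ?_
  simp only [Fin.append_left, Fin.append_right, bmon_append]
  rw [smul_mul_smul_comm]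

/-- Kernels are not symmetrized, so the derivative sums over the slot that receives `x`. Without
`hx` the right side could be nonzero while the left side vanishes. -/
theorem bderiv_bpoly {m : ℕ} (c : (Fin (m + 1) → BLabel) → ℂ) {x : BLabel}
    (hx : x ∈ bLabels P K) :
    bderiv x (bpoly P K c) = bpoly P K fun b : Fin m → BLabel => ∑ i : Fin (m + 1), c (i.insertNth x b) := by
  simp only [bpoly, map_sum, map_smul, bderiv_bmon, Finset.smul_sum, Finset.sum_smul]
  rw [Finset.sum_comm, Finset.sum_comm (s := Fintype.piFinset fun _ : Fin m => bLabels P K)]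
  refine Finset.sum_congr rfl fun i _ => ?_
  rw [sum_piFinset_insertNth _ i]
  simp only [Fin.insertNth_apply_same, Fin.insertNth_apply_succAbove, smul_ite, smul_zero]
  rw [Finset.sum_eq_single_of_mem x hx]
  · simp
  · intro y _ hy
    simp [hy]

theorem bderiv_bpoly_zero (c : (Fin 0 → BLabel) → ℂ) (x : BLabel) :
    bderiv x (bpoly P K c) = 0 := by
  simp only [bpoly, map_sum, map_smul, bderiv_bmon_zero, smul_zero, Finset.sum_const_zero]

theorem fpoly_add {n m : ℕ} (c c' : Kern n m) :
    fpoly P K (c + c') = fpoly P K c + fpoly P K c' := by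
  simp only [fpoly, Pi.add_apply, bpoly_add, TensorProduct.add_tmul, Finset.sum_add_distrib]

theorem fpoly_smul {n m : ℕ} (a : ℂ) (c : Kern n m) :
    fpoly P K (a • c) = a • fpoly P K c := by
  simp only [fpoly, Pi.smul_apply, bpoly_smul, ← TensorProduct.smul_tmul', Finset.smul_sum]

theorem fpoly_zero {n m : ℕ} : fpoly P K (0 : Kern n m) = 0 := by
  simp [fpoly, bpoly_zero]

theorem fpoly_sum {n m : ℕ} {ι : Type*} (s : Finset ι) (c : ι → Kern n m) :
    fpoly P K (∑ i ∈ s, c i) = ∑ i ∈ s, fpoly P K (c i) := by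
  classical
  induction s using Finset.induction_on with
  | empty => simp [fpoly_zero]
  | insert a s ha ih => rw [Finset.sum_insert ha, Finset.sum_insert ha, fpoly_add, ih]

/-- Because the coefficients are neither symmetrized nor antisymmetrized, a product of polynomials
concatenates the labels and multiplies the coefficients, without signs or combinatorial factors. -/
theorem fpoly_mul {n n' m m' : ℕ} (c : Kern n m) (c' : Kern n' m') :
    fpoly P K c * fpoly P K c' = fpoly P K fun (q : Fin (n + n') → QLabel)
        (b : Fin (m + m') → BLabel) =>
      c (fun j => q (Fin.castAdd n' j)) (fun i => b (Fin.castAdd m' i)) *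
        c' (fun j => q (Fin.natAdd n j)) (fun i => b (Fin.natAdd m i)) := by
  simp only [fpoly]
  rw [sum_univ_append, Finset.sum_mul]
  refine Finset.sum_congr rfl fun σ _ => ?_
  rw [Finset.mul_sum]
  refine Finset.sum_congr rfl fun σ' _ => ?_
  rw [sum_piFinset_append, Finset.sum_mul]
  refine Finset.sum_congr rfl fun q _ => ?_
  rw [Finset.mul_sum]
  refine Finset.sum_congr rfl fun q' _ => ?_
  rw [Algebra.TensorProduct.tmul_mul_tmul, gmon_append, bpoly_mul]
  simp only [Fin.append_left, Fin.append_right]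

theorem bosD_fpoly {n m : ℕ} (c : Kern n (m + 1)) {x : BLabel} (hx : x ∈ bLabels P K) :
    bosD x (fpoly P K c) = fpoly P K fun q (b : Fin m → BLabel) =>
      ∑ i : Fin (m + 1), c q (i.insertNth x b) := by
  simp only [fpoly, map_sum, bosD_tmul, bderiv_bpoly _ hx]

theorem bosD_fpoly_zero {n : ℕ} (c : Kern n 0) (x : BLabel) : bosD x (fpoly P K c) = 0 := by
  simp only [fpoly, map_sum, bosD_tmul, bderiv_bpoly_zero, TensorProduct.zero_tmul,
    Finset.sum_const_zero]

/-! ### Momentum conservation -/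

/-- Space-time momenta modulo `Λ*`. -/
abbrev MomGrp (L : ℕ) := ℤ × ZMod L × ZMod L

/-- Reduction of momentum labels modulo `Λ*`. -/
def momHom (L : ℕ) : Mom →+ MomGrp L where
  toFun n := (n.1, (n.2.1 : ZMod L), (n.2.2 : ZMod L))
  map_zero' := by simp
  map_add' x y := by simp

/-- The total momentum `∑ⱼ (𝐤_{2j-1} - 𝐤_{2j}) - ∑ᵢ 𝐩ᵢ`. -/
def totMom (L : ℕ) {n m : ℕ} (q : Fin n → QLabel) (b : Fin m → BLabel) : MomGrp L :=
  ∑ j, (momHom L (q j).2.1 - momHom L (q j).2.2) - ∑ i, momHom L (b i).2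

/-- Turns the divisibility conditions into the vanishing of a group-valued sum, which is additive
under insertion and concatenation of legs. -/
theorem conserved_iff (L : ℕ) {n m : ℕ} (q : Fin n → QLabel) (b : Fin m → BLabel) :
    Conserved L (fun j => (q j).2) (fun i => (b i).2) ↔ totMom L q b = 0 := by
  have h : totMom L q b = momHom L (∑ j, ((q j).2.1 - (q j).2.2) - ∑ i, (b i).2) := by
    rw [totMom, map_sub, map_sum, map_sum]
    simp only [map_sub]
  rw [h, Conserved, momHom]
  simp only [AddMonoidHom.coe_mk, ZeroHom.coe_mk, Prod.mk_eq_zero,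
    ZMod.intCast_zmod_eq_zero_iff_dvd, Prod.fst_sub, Prod.snd_sub, Prod.fst_sum, Prod.snd_sum]

theorem totMom_insertNth (L : ℕ) {n m : ℕ} (q : Fin n → QLabel) (b : Fin m → BLabel)
    (i : Fin (m + 1)) (x : BLabel) :
    totMom L q (i.insertNth x b : Fin (m + 1) → BLabel) = totMom L q b - momHom L x.2 := by
  rw [totMom, totMom, Fin.sum_univ_succAbove _ i]
  simp only [Fin.insertNth_apply_same, Fin.insertNth_apply_succAbove]
  abel

theorem totMom_split (L : ℕ) {n n' m m' : ℕ} (q : Fin (n + n') → QLabel)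
    (b : Fin (m + m') → BLabel) :
    totMom L q b =
      totMom L (fun j => q (Fin.castAdd n' j)) (fun i => b (Fin.castAdd m' i)) +
        totMom L (fun j => q (Fin.natAdd n j)) (fun i => b (Fin.natAdd m i)) := by
  simp only [totMom, Fin.sum_univ_add]
  abel

/-! ### Field polynomials with normalized, momentum-conserving kernels. -/

variable (P) in
/-- The factor `β|Λ|`. -/
def vol : ℝ := P.β * sites P.L

variable (P) in
/-- The factor `β𝒜_Λ`. -/
def avol : ℝ := P.β * area P.L

variable (P) in
/-- The normalization and momentum conservation factor of field polynomials. -/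
def pref {n m : ℕ} (q : Fin n → QLabel) (b : Fin m → BLabel) : ℂ :=
  (((vol P)⁻¹ ^ (2 * n) * (avol P)⁻¹ ^ m * (if totMom P.L q b = 0 then vol P else 0) : ℝ) : ℂ)

variable (P K) in
/-- The field polynomial with kernel `w`. -/
def gpoly {n m : ℕ} (w : Kern n m) : Fields := fpoly P K fun q b => pref P q b * w q b

/-- Separation of the components of the labels. -/
def Kern.toKernel {n m : ℕ} (w : Kern n m) : Kernel n m := fun ρ μ k p =>
  w (fun j => (ρ j, k j)) (fun i => (μ i, p i))

theorem fieldPoly_toKernel {n m : ℕ} (w : Kern n m) :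
    fieldPoly P K w.toKernel = gpoly P K w := by
  unfold fieldPoly gpoly fpoly
  refine Finset.sum_congr rfl fun σ _ => ?_
  have h1 : ∀ q : Fin n → QLabel, (bpoly P K fun b : Fin m → BLabel => pref P q b * w q b) =
      ∑ μ : Fin m → Fin 3, ∑ p ∈ Fintype.piFinset fun _ : Fin m => bModes P K,
        (pref P q (fun i => (μ i, p i)) * w q (fun i => (μ i, p i))) •
          bmon (fun i => (μ i, p i)) := by
    intro q
    rw [bpoly, bLabels, ← Fintype.piFinset_univ, ← sum_piFinset_prod]
  rw [qLabels]
  rw [sum_piFinset_prod Finset.univ (fModes P K ×ˢ fModes P K) fun ρ k =>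
    bpoly P K (fun b : Fin m → BLabel => pref P (fun j => (ρ j, k j)) b *
      w (fun j => (ρ j, k j)) b) ⊗ₜ[ℂ] gmon σ (fun j => (ρ j, k j)), Fintype.piFinset_univ]
  refine Finset.sum_congr rfl fun ρ _ => ?_
  rw [Finset.sum_comm]
  refine Finset.sum_congr rfl fun k _ => ?_
  rw [h1, TensorProduct.sum_tmul]
  refine Finset.sum_congr rfl fun μ _ => ?_
  rw [TensorProduct.sum_tmul]
  refine Finset.sum_congr rfl fun p _ => ?_
  rw [← TensorProduct.smul_tmul']
  have h2 := conserved_iff P.L (fun j => (ρ j, k j)) (fun i => (μ i, p i))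
  simp only at h2
  congr 1
  simp only [h2]
  rfl

/-! ### Convergent sequences and dominated sums -/

/-- The sequence `f` has a limit. -/
def Conv (f : ℕ → ℂ) : Prop := ∃ l, Filter.Tendsto f Filter.atTop (nhds l)

theorem Conv.const (a : ℂ) : Conv fun _ => a := ⟨a, tendsto_const_nhds⟩

theorem Conv.add {f g : ℕ → ℂ} (hf : Conv f) (hg : Conv g) : Conv fun K => f K + g K := by
  obtain ⟨a, ha⟩ := hf
  obtain ⟨b, hb⟩ := hg
  exact ⟨a + b, ha.add hb⟩

theorem Conv.mul {f g : ℕ → ℂ} (hf : Conv f) (hg : Conv g) : Conv fun K => f K * g K := by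
  obtain ⟨a, ha⟩ := hf
  obtain ⟨b, hb⟩ := hg
  exact ⟨a * b, ha.mul hb⟩

theorem Conv.sum {ι : Type*} (s : Finset ι) {f : ι → ℕ → ℂ} (hf : ∀ i ∈ s, Conv (f i)) :
    Conv fun K => ∑ i ∈ s, f i K := by
  classical
  induction s using Finset.induction_on with
  | empty => simpa using Conv.const 0
  | insert a s ha ih =>
    simp only [Finset.sum_insert ha]
    exact (hf a (Finset.mem_insert_self a s)).add
      (ih fun i hi => hf i (Finset.mem_insert_of_mem hi))

/-- The range of summation changes with the cutoff; extending the summands by zero puts all sums on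
one index set, where dominated convergence applies. -/
theorem conv_sum_of_dominated {ι : Type*} [DecidableEq ι] {S : ℕ → Finset ι} {f : ℕ → ι → ℂ} {g : ι → ℝ}
    (hg : Summable g) (hg0 : ∀ i, 0 ≤ g i) (hb : ∀ K, ∀ i ∈ S K, ‖f K i‖ ≤ g i)
    (hl : ∀ i, Conv fun K => if i ∈ S K then f K i else 0) :
    Conv fun K => ∑ i ∈ S K, f K i := by
  choose l hl using hl
  refine ⟨∑' i, l i, ?_⟩
  have h := tendsto_tsum_of_dominated_convergence hg hl (Filter.Eventually.of_forall fun K i => by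
    split_ifs with h
    · exact hb K i h
    · simpa using hg0 i)
  refine h.congr fun K => ?_
  rw [tsum_eq_sum (s := S K) fun i hi => by simp [hi]]
  exact Finset.sum_congr rfl fun i hi => by simp [hi]

theorem norm_sum_le_of_dominated {ι : Type*} {S : Finset ι} {f : ι → ℂ} {g : ι → ℝ}
    (hg : Summable g) (hg0 : ∀ i, 0 ≤ g i) (hb : ∀ i ∈ S, ‖f i‖ ≤ g i) :
    ‖∑ i ∈ S, f i‖ ≤ ∑' i, g i :=
  (norm_sum_le_of_le S hb).trans (hg.sum_le_tsum S fun i _ => hg0 i)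

/-! ### Bounds on the propagators -/

/-- Bounds on the ultraviolet propagators, uniform in the ultraviolet cutoff. -/
structure UVBounds (P : Params) (c : ℝ) : Prop where
  beta_pos : 0 < P.β
  one_le_L : 1 ≤ P.L
  one_le : 1 ≤ c
  neg_mem : ∀ K, ∀ p ∈ bModes P K, -p ∈ bModes P K
  photon_le : ∀ K, ∀ p ∈ bModes P K, |photonPropUV P K p| ≤ c
  photon_sum : ∃ g : Mom → ℝ, (∀ p, 0 ≤ g p) ∧ Summable g ∧ ∑' p, g p ≤ c * avol P ∧
    ∀ K, ∀ p ∈ bModes P K, |photonPropUV P K p| ≤ g p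
  photon_lim : ∀ p, Conv fun K => if p ∈ bModes P K then (photonPropUV P K p : ℂ) else 0
  fermion_sum : ∃ G : Mom → ℝ, (∀ k, 0 ≤ G k) ∧ (∀ k, G k ≤ c) ∧ (Summable fun k => G k ^ 2) ∧
    ∑' k, G k ^ 2 ≤ c * vol P ∧
    (∀ K, ∀ k ∈ fModes P K, ∀ ρ ρ', ‖gUV P K k ρ ρ'‖ ≤ G k) ∧
    (∀ K, ∀ k ∈ fModes P K, ∀ ρ ρ', ρ ≠ ρ' → ‖gUV P K k ρ ρ'‖ ≤ c * G k ^ 2)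
  fermion_lim : ∀ k ρ ρ', Conv fun K => if k ∈ fModes P K then gUV P K k ρ ρ' else 0
  tadpole : ∀ K ρ, ∑ k ∈ fModes P K, gUV P K k ρ ρ = 0

section UV

variable {P : Params} {c : ℝ}

theorem UVBounds.vol_pos (hU : UVBounds P c) : 0 < vol P := by
  have := hU.beta_pos
  have h : (0 : ℝ) < P.L := by exact_mod_cast hU.one_le_L
  unfold vol sites
  positivity

theorem UVBounds.avol_pos (hU : UVBounds P c) : 0 < avol P := by
  have := hU.beta_pos
  have h : (0 : ℝ) < P.L := by exact_mod_cast hU.one_le_L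
  unfold avol area
  positivity

theorem UVBounds.vol_le_avol (hU : UVBounds P c) : vol P ≤ avol P := by
  have h3 : (1 : ℝ) ≤ √3 := Real.one_le_sqrt.mpr (by norm_num)
  have h : avol P = 3 * √3 / 2 * vol P := by unfold avol vol area sites; ring
  rw [h]
  nlinarith [hU.vol_pos]

theorem UVBounds.pos (hU : UVBounds P c) : 0 < c := lt_of_lt_of_le one_pos hU.one_le

end UV

/-! ### Sequences of field polynomials with bounded convergent kernels -/

/-- For every cutoff `K` the field `X K` is a polynomial with `n` fermion pairs and `m` photons,
with kernels bounded by `B` and convergent as `K → ∞`. -/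
def Rep (P : Params) (n m : ℕ) (B : ℝ) (X : ℕ → Fields) : Prop :=
  ∃ w : ℕ → Kern n m, (∀ K, X K = gpoly P K (w K)) ∧ (∀ K q b, ‖w K q b‖ ≤ B) ∧
    ∀ q b, Conv fun K => w K q b

section Rep

variable {P : Params} {n m : ℕ} {B B' : ℝ} {X Y : ℕ → Fields}

theorem gpoly_add {K : ℕ} (w w' : Kern n m) :
    gpoly P K (w + w') = gpoly P K w + gpoly P K w' := by
  rw [gpoly, gpoly, gpoly, ← fpoly_add]
  congr 1
  funext q b
  simp only [Pi.add_apply]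
  ring

theorem gpoly_smul {K : ℕ} (a : ℂ) (w : Kern n m) :
    gpoly P K (a • w) = a • gpoly P K w := by
  rw [gpoly, gpoly, ← fpoly_smul]
  congr 1
  funext q b
  simp only [Pi.smul_apply, smul_eq_mul]
  ring

theorem gpoly_zero {K : ℕ} : gpoly P K (0 : Kern n m) = 0 := by
  have := gpoly_smul (P := P) (K := K) 0 (0 : Kern n m)
  simpa using this

theorem Rep.nonneg (h : Rep P n m B X) : 0 ≤ B := by
  obtain ⟨w, -, hb, -⟩ := h
  exact (norm_nonneg _).trans (hb 0 (fun _ => 0) (fun _ => 0))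

theorem Rep.add (h : Rep P n m B X) (h' : Rep P n m B' Y) :
    Rep P n m (B + B') fun K => X K + Y K := by
  obtain ⟨w, hw, hb, hc⟩ := h
  obtain ⟨w', hw', hb', hc'⟩ := h'
  refine ⟨fun K => w K + w' K, fun K => by simp only [hw, hw', gpoly_add], fun K q b => ?_,
    fun q b => (hc q b).add (hc' q b)⟩
  exact norm_add_le_of_le (hb K q b) (hb' K q b)

theorem Rep.smul (h : Rep P n m B X) (a : ℂ) : Rep P n m (‖a‖ * B) fun K => a • X K := by
  obtain ⟨w, hw, hb, hc⟩ := h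
  refine ⟨fun K => a • w K, fun K => by simp only [hw, gpoly_smul], fun K q b => ?_,
    fun q b => (Conv.const a).mul (hc q b)⟩
  simp only [Pi.smul_apply, smul_eq_mul, norm_mul]
  exact mul_le_mul_of_nonneg_left (hb K q b) (norm_nonneg a)

theorem Rep.mono (h : Rep P n m B X) (hB : B ≤ B') : Rep P n m B' X := by
  obtain ⟨w, hw, hb, hc⟩ := h
  exact ⟨w, hw, fun K q b => (hb K q b).trans hB, hc⟩

theorem Rep.zero (P : Params) (n m : ℕ) : Rep P n m 0 fun _ => 0 :=
  ⟨fun _ => 0, fun K => gpoly_zero.symm, fun _ _ _ => by simp, fun _ _ => Conv.const 0⟩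

theorem Rep.sum {ι : Type*} (s : Finset ι) {B : ι → ℝ} {X : ι → ℕ → Fields}
    (h : ∀ i ∈ s, Rep P n m (B i) (X i)) :
    Rep P n m (∑ i ∈ s, B i) fun K => ∑ i ∈ s, X i K := by
  classical
  induction s using Finset.induction_on with
  | empty => simpa using Rep.zero P n m
  | insert a s ha ih =>
    simp only [Finset.sum_insert ha]
    exact (h a (Finset.mem_insert_self a s)).add
      (ih fun i hi => h i (Finset.mem_insert_of_mem hi))

/-! ### Contraction of photons -/

theorem mem_bLabels {K : ℕ} {x : BLabel} : x ∈ bLabels P K ↔ x.2 ∈ bModes P K := by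
  simp [bLabels]

theorem pref_insertNth (q : Fin n → QLabel) (b : Fin m → BLabel) (i : Fin (m + 1)) (x : BLabel) :
    pref P q (i.insertNth x b : Fin (m + 1) → BLabel) =
      (((vol P)⁻¹ ^ (2 * n) * (avol P)⁻¹ ^ (m + 1) *
        (if totMom P.L q b = momHom P.L x.2 then vol P else 0) : ℝ) : ℂ) := by
  rw [pref, totMom_insertNth]
  simp only [sub_eq_zero]

/-- Opposite momenta do not change the total momentum, so only the two normalizations of the photon
integrals remain. -/
theorem pref_insertNth_insertNth (q : Fin n → QLabel) (b : Fin m → BLabel) (i : Fin (m + 2))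
    (j : Fin (m + 1)) (μ : Fin 3) (p : Mom) :
    pref P q (i.insertNth (μ, -p) (j.insertNth (μ, p) b : Fin (m + 1) → BLabel) :
      Fin (m + 2) → BLabel) = (((avol P)⁻¹ ^ 2 : ℝ) : ℂ) * pref P q b := by
  rw [pref, pref, totMom_insertNth, totMom_insertNth, map_neg, sub_neg_eq_add, sub_add_cancel,
    ← Complex.ofReal_mul]
  congr 1
  ring

/-- The momentum of the closed photon line is free, so the sum of the propagator appears. Its bound
c · `avol P` is compensated by the factor `(avol P)⁻¹` left from one covariance volume and two leg
normalizations. The rest counts components and ordered pairs of slots. -/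
theorem Rep.lapA {c : ℝ} (hU : UVBounds P c) (h : Rep P n (m + 2) B X) :
    Rep P n m (3 / 2 * c * ((m + 1) * (m + 2)) * B) fun K => lapA P K (X K) := by
  have hB := h.nonneg
  obtain ⟨w, hw, hb, hc⟩ := h
  obtain ⟨g, hg0, hg, hgs, hgb⟩ := hU.photon_sum
  have ha := hU.avol_pos
  set T : ℕ → (Fin n → QLabel) → (Fin m → BLabel) → Mom → ℂ := fun K q b p =>
    ∑ μ : Fin 3, ∑ j : Fin (m + 1), ∑ i : Fin (m + 2),
      w K q (i.insertNth (μ, -p) (j.insertNth (μ, p) b : Fin (m + 1) → BLabel)) with hT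
  have hTb : ∀ K q b p, ‖T K q b p‖ ≤ 3 * ((m + 1) * (m + 2)) * B := by
    intro K q b p
    refine (norm_sum_le_of_le _ fun μ _ => norm_sum_le_of_le _ fun j _ =>
      norm_sum_le_of_le _ fun i _ => hb _ _ _).trans ?_
    simp only [Finset.sum_const, Finset.card_univ, Fintype.card_fin, nsmul_eq_mul]
    push_cast
    apply le_of_eq; ring
  have hM : (0 : ℝ) ≤ 3 * ((m + 1) * (m + 2)) * B := by positivity
  refine ⟨fun K q b => ((1 / 2 * (avol P)⁻¹ : ℝ) : ℂ) * ∑ p ∈ bModes P K,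
    (photonPropUV P K p : ℂ) * T K q b p, fun K => ?_, fun K q b => ?_, fun q b => ?_⟩
  · beta_reduce
    rw [hw, gpoly, Graphene.lapA, LinearMap.sum_apply]
    have : ∀ p ∈ bModes P K, (∑ μ : Fin 3,
        ((1 / 2 * (P.β * area P.L) * photonPropUV P K p : ℝ) : ℂ) •
          (bosD (μ, p) ∘ₗ bosD (μ, -p)))
          (fpoly P K fun q b => pref P q b * w K q b) =
        fpoly P K fun q (b : Fin m → BLabel) =>
          pref P q b * (((1 / 2 * (avol P)⁻¹ : ℝ) : ℂ) * ((photonPropUV P K p : ℂ) *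
            T K q b p)) := by
      intro p hp
      rw [LinearMap.sum_apply]
      simp only [LinearMap.smul_apply, LinearMap.comp_apply]
      simp only [bosD_fpoly _ (mem_bLabels.mpr (hU.neg_mem K p hp) : ((_, -p) : BLabel) ∈ _),
        bosD_fpoly _ (mem_bLabels.mpr hp : ((_, p) : BLabel) ∈ _), ← fpoly_smul, ← fpoly_sum]
      congr 1
      funext q b
      simp only [← avol.eq_1 P]
      simp only [Finset.sum_apply, Pi.smul_apply, pref_insertNth_insertNth, smul_eq_mul,
        ← Finset.mul_sum, hT, mul_assoc]
      have ha' : (avol P : ℂ) ≠ 0 := by exact_mod_cast ha.ne'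
      push_cast
      field_simp
    rw [Finset.sum_congr rfl this, ← fpoly_sum, gpoly]
    congr 1
    funext q b
    rw [Finset.sum_apply, Finset.sum_apply]
    simp only [Finset.mul_sum]
  · have h1 : ‖∑ p ∈ bModes P K, (photonPropUV P K p : ℂ) * T K q b p‖ ≤
        ∑' p, g p * (3 * ((m + 1) * (m + 2)) * B) := by
      refine norm_sum_le_of_dominated (hg.mul_right _) (fun p => mul_nonneg (hg0 p) hM)
        fun p hp => ?_
      rw [norm_mul, Complex.norm_real]
      exact mul_le_mul (hgb K p hp) (hTb _ _ _ _) (norm_nonneg _) (hg0 p)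
    rw [tsum_mul_right] at h1
    rw [norm_mul, Complex.norm_real, Real.norm_of_nonneg (by positivity)]
    calc 1 / 2 * (avol P)⁻¹ * ‖∑ p ∈ bModes P K, (photonPropUV P K p : ℂ) * T K q b p‖
        ≤ 1 / 2 * (avol P)⁻¹ * ((c * avol P) * (3 * ((m + 1) * (m + 2)) * B)) := by
          gcongr
          exact h1.trans (mul_le_mul_of_nonneg_right hgs hM)
      _ = _ := by field_simp
  · refine (Conv.const _).mul (conv_sum_of_dominated (g := fun p => g p *
      (3 * ((m + 1) * (m + 2)) * B)) (hg.mul_right _) (fun p => mul_nonneg (hg0 p) hM)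
        (fun K p hp => ?_) fun p => ?_)
    · rw [norm_mul, Complex.norm_real]
      exact mul_le_mul (hgb K p hp) (hTb _ _ _ _) (norm_nonneg _) (hg0 p)
    · have h2 : Conv fun K => T K q b p :=
        Conv.sum _ fun μ _ => Conv.sum _ fun j _ => Conv.sum _ fun i _ => hc _ _
      have h3 := (hU.photon_lim p).mul h2
      simp only [ite_mul, zero_mul] at h3
      exact h3

theorem lapA_gpoly_of_lt_two {K : ℕ} (hm : m < 2)
    (hneg : ∀ p ∈ bModes P K, -p ∈ bModes P K) (w : Kern n m) :
    lapA P K (gpoly P K w) = 0 := by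
  simp only [lapA, LinearMap.sum_apply, LinearMap.smul_apply, LinearMap.comp_apply, gpoly]
  refine Finset.sum_eq_zero fun p hp => Finset.sum_eq_zero fun μ _ => ?_
  have : m = 0 ∨ m = 1 := by omega
  rcases this with rfl | rfl
  · rw [bosD_fpoly_zero, map_zero, smul_zero]
  · rw [bosD_fpoly _ (mem_bLabels.mpr (hneg p hp) : ((μ, -p) : BLabel) ∈ _), bosD_fpoly_zero,
      smul_zero]

/-! ### Joining two polynomials by a photon line. -/

theorem card_Icc_filter_zmod_le {L : ℕ} (hL : 1 ≤ L) (z : ZMod L) :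
    ((Finset.Icc (-(L : ℤ)) L).filter fun x : ℤ => (x : ZMod L) = z).card ≤ 3 := by
  have hL' : (0 : ℤ) < L := by exact_mod_cast hL
  have h : ((Finset.Icc (-(L : ℤ)) L).filter fun x : ℤ => (x : ZMod L) = z).card ≤
      (Finset.Icc (-1 : ℤ) 1).card := by
    refine Finset.card_le_card_of_injOn (fun x => x / L) (fun x hx => ?_) fun x hx y hy hxy => ?_
    · simp only [Finset.coe_filter, Finset.mem_Icc, Set.mem_ofPred_eq] at hx
      simp only [Finset.coe_Icc, Set.mem_Icc]
      constructor
      · rw [Int.le_ediv_iff_mul_le hL']; linarith [hx.1.1]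
      · have : x / (L : ℤ) < 2 := by rw [Int.ediv_lt_iff_lt_mul hL']; linarith [hx.1.2]
        omega
    · simp only [Finset.coe_filter, Finset.mem_Icc, Set.mem_ofPred_eq] at hx hy
      have h1 : (x : ZMod L) = (y : ZMod L) := hx.2.trans hy.2.symm
      rw [ZMod.intCast_eq_intCast_iff] at h1
      have h2 : x % L = y % L := h1
      simp only at hxy
      rw [← Int.mul_ediv_add_emod x L, ← Int.mul_ediv_add_emod y L, hxy, h2]
  simpa using h

/-- Photon momenta are not reduced modulo Λ*. Conservation fixes the frequency, but each spatial
label in [-L, L] has up to three representatives of its class. -/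
theorem card_bModes_filter_le {K : ℕ} (hL : 1 ≤ P.L) (g : MomGrp P.L) :
    ((bModes P K).filter fun p => g = momHom P.L p).card ≤ 9 := by
  have h : ((bModes P K).filter fun p => g = momHom P.L p).card ≤
      (((Finset.Icc (-(P.L : ℤ)) P.L).filter fun x : ℤ => (x : ZMod P.L) = g.2.1) ×ˢ
      ((Finset.Icc (-(P.L : ℤ)) P.L).filter fun x : ℤ => (x : ZMod P.L) = g.2.2)).card := by
    refine Finset.card_le_card_of_injOn (fun p => p.2) (fun p hp => ?_) fun p hp p' hp' hpp => ?_
    · simp only [bModes, Finset.coe_filter, Finset.mem_filter, Finset.mem_product,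
        Set.mem_ofPred_eq] at hp
      simp only [Finset.coe_product, Set.mem_prod, Finset.mem_coe, Finset.mem_filter]
      obtain ⟨⟨⟨-, h1, h2⟩, -⟩, rfl⟩ := hp
      exact ⟨⟨h1, rfl⟩, ⟨h2, rfl⟩⟩
    · simp only [Finset.coe_filter, Set.mem_ofPred_eq] at hp hp'
      have := congrArg Prod.fst (hp.2.symm.trans hp'.2)
      exact Prod.ext this hpp
  refine h.trans ?_
  rw [Finset.card_product]
  exact Nat.mul_le_mul (card_Icc_filter_zmod_le hL _) (card_Icc_filter_zmod_le hL _)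

/-- The product of two delta functions is the delta of total momentum times the constraint that
determines the exchanged momentum modulo Λ*. -/
theorem pref_mul_pref {n' m' : ℕ} (q : Fin (n + n') → QLabel)
    (b : Fin (m + m') → BLabel) (i : Fin (m + 1)) (j : Fin (m' + 1)) (μ : Fin 3) (p : Mom) :
    pref P (fun l => q (Fin.castAdd n' l))
        (i.insertNth (μ, p) (fun l => b (Fin.castAdd m' l)) : Fin (m + 1) → BLabel) *
      pref P (fun l => q (Fin.natAdd n l))
        (j.insertNth (μ, -p) (fun l => b (Fin.natAdd m l)) : Fin (m' + 1) → BLabel) =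
    (((avol P)⁻¹ * (vol P / avol P) : ℝ) : ℂ) * pref P q b *
      (if totMom P.L (fun l => q (Fin.castAdd n' l)) (fun l => b (Fin.castAdd m' l)) =
        momHom P.L p then 1 else 0) := by
  rw [pref_insertNth, pref_insertNth, pref, totMom_split]
  simp only [map_neg]
  set x := totMom P.L (fun l => q (Fin.castAdd n' l)) (fun l => b (Fin.castAdd m' l))
  set y := totMom P.L (fun l => q (Fin.natAdd n l)) (fun l => b (Fin.natAdd m l))
  by_cases h : x = momHom P.L p
  · rw [← h, if_pos rfl, if_pos rfl]
    by_cases h' : y = -x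
    · rw [if_pos h', if_pos (by rw [h']; abel)]
      push_cast
      field_simp
      ring
    · rw [if_neg h', if_neg (fun h2 => h' (eq_neg_of_add_eq_zero_right h2))]
      simp
  · rw [if_neg h, if_neg h]
    simp

/-- The constraint leaves at most nine momenta, so only the supremum of the propagator is paid. The
factor 27/2 is one half times 9 momenta and 3 components. -/
theorem Rep.contract {c : ℝ} (hU : UVBounds P c) {n' m' : ℕ} (h : Rep P n (m + 1) B X)
    (h' : Rep P n' (m' + 1) B' Y) :
    Rep P (n + n') (m + m') (27 / 2 * c * ((m + 1) * (m' + 1)) * (B * B')) fun K =>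
      ∑ p ∈ bModes P K, ∑ μ : Fin 3,
        ((1 / 2 * (P.β * area P.L) * photonPropUV P K p : ℝ) : ℂ) •
          (bosD (μ, p) (X K) * bosD (μ, -p) (Y K)) := by
  have hB := h.nonneg
  have hB' := h'.nonneg
  obtain ⟨w, hw, hb, hc⟩ := h
  obtain ⟨w', hw', hb', hc'⟩ := h'
  obtain ⟨g, hg0, hg, hgs, hgb⟩ := hU.photon_sum
  have ha := hU.avol_pos
  have hv := hU.vol_pos
  have hva := hU.vol_le_avol
  set T : ℕ → (Fin (n + n') → QLabel) → (Fin (m + m') → BLabel) → Mom → ℂ := fun K q b p =>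
    (if totMom P.L (fun l => q (Fin.castAdd n' l)) (fun l => b (Fin.castAdd m' l)) =
        momHom P.L p then 1 else 0) *
    ∑ μ : Fin 3, (∑ i : Fin (m + 1), w K (fun l => q (Fin.castAdd n' l))
        (i.insertNth (μ, p) (fun l => b (Fin.castAdd m' l)))) *
      ∑ j : Fin (m' + 1), w' K (fun l => q (Fin.natAdd n l))
        (j.insertNth (μ, -p) (fun l => b (Fin.natAdd m l))) with hT
  have hM : (0 : ℝ) ≤ 3 * ((m + 1) * (m' + 1)) * (B * B') := by positivity
  have hTb0 : ∀ K q b p, ‖T K q b p‖ ≤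
      (if totMom P.L (fun l => q (Fin.castAdd n' l)) (fun l => b (Fin.castAdd m' l)) =
        momHom P.L p then 1 else 0) * (3 * ((m + 1) * (m' + 1)) * (B * B')) := by
    intro K q b p
    rw [hT, norm_mul]
    gcongr
    · split_ifs <;> simp
    · refine (norm_sum_le_of_le _ fun μ _ => (norm_mul_le _ _).trans
        (mul_le_mul (norm_sum_le_of_le _ fun i _ => hb _ _ _)
          (norm_sum_le_of_le _ fun i _ => hb' _ _ _) (norm_nonneg _) ?_)).trans ?_
      · simp only [Finset.sum_const, Finset.card_univ, Fintype.card_fin, nsmul_eq_mul]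
        positivity
      · simp only [Finset.sum_const, Finset.card_univ, Fintype.card_fin, nsmul_eq_mul]
        push_cast
        apply le_of_eq; ring
  have hTb : ∀ K q b p, ‖T K q b p‖ ≤ 3 * ((m + 1) * (m' + 1)) * (B * B') := by
    intro K q b p
    refine (hTb0 K q b p).trans (mul_le_of_le_one_left hM ?_)
    split_ifs <;> simp
  refine ⟨fun K q b => ((1 / 2 * (vol P / avol P) : ℝ) : ℂ) * ∑ p ∈ bModes P K,
    (photonPropUV P K p : ℂ) * T K q b p, fun K => ?_, fun K q b => ?_, fun q b => ?_⟩
  · have : ∀ p ∈ bModes P K, ∑ μ : Fin 3,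
        ((1 / 2 * (P.β * area P.L) * photonPropUV P K p : ℝ) : ℂ) •
          (bosD (μ, p) (X K) * bosD (μ, -p) (Y K)) =
        fpoly P K fun (q : Fin (n + n') → QLabel) (b : Fin (m + m') → BLabel) =>
          pref P q b * (((1 / 2 * (vol P / avol P) : ℝ) : ℂ) * ((photonPropUV P K p : ℂ) *
            T K q b p)) := by
      intro p hp
      simp only [hw, hw', gpoly, bosD_fpoly _
          (mem_bLabels.mpr (hU.neg_mem K p hp) : ((_, -p) : BLabel) ∈ _),
        bosD_fpoly _ (mem_bLabels.mpr hp : ((_, p) : BLabel) ∈ _), fpoly_mul,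
        ← fpoly_smul, ← fpoly_sum]
      congr 1
      funext q b
      simp only [Finset.sum_apply, Pi.smul_apply, smul_eq_mul, hT, Finset.sum_mul_sum]
      simp only [Finset.mul_sum]
      refine Finset.sum_congr rfl fun μ _ => Finset.sum_congr rfl fun i _ =>
        Finset.sum_congr rfl fun j _ => ?_
      rw [mul_mul_mul_comm, pref_mul_pref, ← avol.eq_1 P]
      have ha' : (avol P : ℂ) ≠ 0 := by exact_mod_cast ha.ne'
      push_cast
      field_simp
    beta_reduce
    rw [Finset.sum_congr rfl this, ← fpoly_sum, gpoly]
    congr 1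
    funext q b
    rw [Finset.sum_apply, Finset.sum_apply]
    simp only [Finset.mul_sum]
  · have h1 : ‖∑ p ∈ bModes P K, (photonPropUV P K p : ℂ) * T K q b p‖ ≤
        9 * (c * (3 * ((m + 1) * (m' + 1)) * (B * B'))) := by
      calc ‖∑ p ∈ bModes P K, (photonPropUV P K p : ℂ) * T K q b p‖
          ≤ ∑ p ∈ bModes P K, (if totMom P.L (fun l => q (Fin.castAdd n' l))
              (fun l => b (Fin.castAdd m' l)) = momHom P.L p then
              (c * (3 * ((m + 1) * (m' + 1)) * (B * B'))) else 0) := by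
            refine norm_sum_le_of_le _ fun p hp => ?_
            rw [norm_mul, Complex.norm_real]
            refine (mul_le_mul (hU.photon_le K p hp) (hTb0 K q b p) (norm_nonneg _)
              hU.pos.le).trans (le_of_eq ?_)
            split_ifs <;> simp
        _ ≤ _ := by
            rw [← Finset.sum_filter, Finset.sum_const, nsmul_eq_mul]
            refine mul_le_mul_of_nonneg_right ?_ (mul_nonneg hU.pos.le hM)
            exact_mod_cast card_bModes_filter_le hU.one_le_L _
    have h2 : vol P / avol P ≤ 1 := by rw [div_le_one ha]; exact hva
    have h3 : 0 ≤ vol P / avol P := by positivity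
    rw [norm_mul, Complex.norm_real, Real.norm_of_nonneg (by positivity)]
    calc 1 / 2 * (vol P / avol P) * ‖∑ p ∈ bModes P K, (photonPropUV P K p : ℂ) * T K q b p‖
        ≤ 1 / 2 * 1 * (9 * (c * (3 * ((m + 1) * (m' + 1)) * (B * B')))) := by
          gcongr
      _ = _ := by ring
  -- The supremum gave the bound; for the limit, the summable bound on the propagator provides the
  -- dominating function.
  · refine (Conv.const _).mul (conv_sum_of_dominated (g := fun p => g p *
      (3 * ((m + 1) * (m' + 1)) * (B * B'))) (hg.mul_right _) (fun p => mul_nonneg (hg0 p) hM)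
        (fun K p hp => ?_) fun p => ?_)
    · rw [norm_mul, Complex.norm_real]
      exact mul_le_mul (hgb K p hp) (hTb _ _ _ _) (norm_nonneg _) (hg0 p)
    · have h2 : Conv fun K => T K q b p :=
        (Conv.const _).mul (Conv.sum _ fun μ _ => (Conv.sum _ fun i _ => hc _ _).mul
          (Conv.sum _ fun j _ => hc' _ _))
      have h3 := (hU.photon_lim p).mul h2
      simp only [ite_mul, zero_mul] at h3
      exact h3

end Rep

/-! ### Quadratic forms in the Grassmann variables -/

/-- Labels of fermionic modes without spin. -/
abbrev FIdx (P : Params) (K : ℕ) := fModes P K × Fin 2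

section Quadratic

variable {P : Params} {K : ℕ}

/-- `Ψ̂⁺` with label `x` and spin `σ`. -/
def plus (σ : Fin 2) (x : FIdx P K) : Grass := psi (x.1, σ, x.2, true)

/-- `Ψ̂⁻` with label `x` and spin `σ`. -/
def minus (σ : Fin 2) (x : FIdx P K) : Grass := psi (x.1, σ, x.2, false)

/-- The derivative with respect to `Ψ̂⁺`. -/
def dplus (σ : Fin 2) (x : FIdx P K) : Fields →ₗ[ℂ] Fields := ferD (x.1, σ, x.2, true)

/-- The derivative with respect to `Ψ̂⁻`. -/
def dminus (σ : Fin 2) (x : FIdx P K) : Fields →ₗ[ℂ] Fields := ferD (x.1, σ, x.2, false)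

/-- The quadratic form `∑_σ Ψ̂⁺ T Ψ̂⁻`. -/
def quad (T : Matrix (FIdx P K) (FIdx P K) Bose) : Fields :=
  ∑ σ : Fin 2, ∑ x, ∑ y, T x y ⊗ₜ[ℂ] (plus σ x * minus σ y)

variable (P K) in
/-- The covariance matrix `β|Λ| ĝ^{(u.v.)}`. -/
def covMat (x y : FIdx P K) : ℂ :=
  if x.1 = y.1 then (vol P : ℂ) * gUV P K x.1 x.2 y.2 else 0

variable (P K) in
/-- The covariance matrix with entries in the photon polynomials. -/
def covB : Matrix (FIdx P K) (FIdx P K) Bose :=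
  Matrix.of fun x y => algebraMap ℂ Bose (covMat P K x y)

theorem sum_covMat {M : Type*} [AddCommGroup M] [Module ℂ M] (F : FIdx P K → FIdx P K → M) :
    ∑ x, ∑ y, covMat P K x y • F x y = ∑ k : fModes P K, ∑ ρ : Fin 2, ∑ ρ' : Fin 2,
      ((vol P : ℂ) * gUV P K k ρ ρ') • F (k, ρ) (k, ρ') := by
  rw [Fintype.sum_prod_type]
  refine Finset.sum_congr rfl fun k _ => Finset.sum_congr rfl fun ρ _ => ?_
  rw [Fintype.sum_prod_type, Finset.sum_eq_single k]
  · simp [covMat]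
  · intro k' _ hk
    simp [covMat, hk.symm]
  · simp

theorem lapF_apply (z : Fields) : lapF P K z =
    ∑ σ : Fin 2, ∑ x, ∑ y, covMat P K x y • dplus σ y (dminus σ x z) := by
  refine Eq.trans ?_ (Finset.sum_congr rfl fun σ _ =>
    (sum_covMat fun x y => dplus σ y (dminus σ x z)).symm)
  simp only [lapF, LinearMap.sum_apply, LinearMap.smul_apply, LinearMap.comp_apply]
  rw [← Finset.sum_coe_sort (fModes P K), Finset.sum_comm]
  rfl

theorem coe_carre_lapFE' (z z' : evenPart) : ((carre (lapFE P K) z z' : evenPart) : Fields) =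
    ∑ σ : Fin 2, ∑ x, ∑ y, covMat P K x y •
      (dplus σ y z * dminus σ x z' - dminus σ x z * dplus σ y z') := by
  refine Eq.trans ?_ (Finset.sum_congr rfl fun σ _ =>
    (sum_covMat fun x y => dplus σ y z.1 * dminus σ x z'.1 - dminus σ x z.1 * dplus σ y z'.1).symm)
  rw [coe_carre_lapFE, ← Finset.sum_coe_sort (fModes P K), Finset.sum_comm]
  rfl

theorem gderiv_plus_mul_minus (i : FLabel) (σ : Fin 2) (x y : FIdx P K) :
    gderiv i (plus σ x * minus σ y) =
      (if ((x.1, σ, x.2, true) : FLabel) = i then minus σ y else 0) -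
        (if ((y.1, σ, y.2, false) : FLabel) = i then plus σ x else 0) := by
  rw [gderiv_mul, plus, minus, gderiv_psi, gderiv_psi, gpar_psi]
  split_ifs <;> simp [sub_eq_add_neg]

theorem flabel_eq_iff {σ σ' : Fin 2} {x y : FIdx P K} {s : Bool} :
    ((x.1, σ, x.2, s) : FLabel) = ((y.1 : Mom), σ', y.2, s) ↔ x = y ∧ σ = σ' := by
  simp only [Prod.ext_iff, Subtype.ext_iff]
  tauto

theorem dplus_quad (T : Matrix (FIdx P K) (FIdx P K) Bose) (σ : Fin 2) (x : FIdx P K) :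
    dplus σ x (quad T) = ∑ y, T x y ⊗ₜ[ℂ] minus σ y := by
  simp only [quad, map_sum, dplus, ferD_tmul, gderiv_plus_mul_minus, flabel_eq_iff]
  rw [Finset.sum_eq_single σ]
  · rw [Finset.sum_eq_single x]
    · simp
    · intro y _ hy
      simp [hy]
    · simp
  · intro σ' _ h
    simp [h]
  · simp

theorem dminus_quad (T : Matrix (FIdx P K) (FIdx P K) Bose) (σ : Fin 2) (y : FIdx P K) :
    dminus σ y (quad T) = (-1 : ℂ) • ∑ x, T x y ⊗ₜ[ℂ] plus σ x := by
  simp only [quad, map_sum, dminus, ferD_tmul, gderiv_plus_mul_minus, flabel_eq_iff]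
  rw [Finset.sum_eq_single σ]
  · rw [Finset.smul_sum]
    refine Finset.sum_congr rfl fun x _ => ?_
    rw [Finset.sum_eq_single y]
    · rw [← TensorProduct.tmul_smul, neg_one_smul]
      simp
    · intro z _ hz
      simp [hz]
    · simp
  · intro σ' _ h
    simp [h]
  · simp

/-- Two spins and the sign from contracting Ψ⁺Ψ⁻ in the order opposite to the covariance give the
factor -2. -/
theorem lapF_quad (T : Matrix (FIdx P K) (FIdx P K) Bose) :
    lapF P K (quad T) = (-2 : ℂ) • ((covB P K * T).trace ⊗ₜ[ℂ] 1) := by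
  have h : ∀ (σ : Fin 2) (x y : FIdx P K), covMat P K x y • dplus σ y (dminus σ x (quad T)) =
      (-1 : ℂ) • ((covB P K x y * T y x) ⊗ₜ[ℂ] (1 : Grass)) := by
    intro σ x y
    rw [dminus_quad, map_smul, map_sum, Finset.sum_eq_single y]
    · rw [dplus, ferD_tmul, plus, gderiv_psi, if_pos rfl, smul_comm, covB, Matrix.of_apply,
        ← Algebra.smul_def, TensorProduct.smul_tmul']
    · intro z _ hz
      rw [dplus, ferD_tmul, plus, gderiv_psi, if_neg, TensorProduct.tmul_zero]
      rw [flabel_eq_iff]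
      tauto
    · simp
  simp only [lapF_apply, h, Finset.sum_const, Finset.card_univ, Fintype.card_fin,
    ← Finset.smul_sum]
  rw [← Nat.cast_smul_eq_nsmul ℂ, smul_smul]
  simp only [Matrix.trace, Matrix.diag_apply, Matrix.mul_apply, TensorProduct.sum_tmul]
  congr 1
  norm_num

theorem quad_mem_evenPart (T : Matrix (FIdx P K) (FIdx P K) Bose) : quad T ∈ evenPart := by
  refine Subalgebra.sum_mem _ fun σ _ => Subalgebra.sum_mem _ fun x _ =>
    Subalgebra.sum_mem _ fun y _ => ?_
  rw [mem_evenPart, par_tmul, map_mul, plus, minus, gpar_psi, gpar_psi, neg_mul_neg]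

theorem quad_add (T T' : Matrix (FIdx P K) (FIdx P K) Bose) :
    quad (T + T') = quad T + quad T' := by
  simp only [quad, Matrix.add_apply, TensorProduct.add_tmul, Finset.sum_add_distrib]

theorem quad_zero : quad (0 : Matrix (FIdx P K) (FIdx P K) Bose) = 0 := by
  simp [quad]

theorem quad_sum {ι : Type*} (s : Finset ι) (T : ι → Matrix (FIdx P K) (FIdx P K) Bose) :
    quad (∑ i ∈ s, T i) = ∑ i ∈ s, quad (T i) := by
  classical
  induction s using Finset.induction_on with
  | empty => simp [quad_zero]
  | insert a s ha ih => rw [Finset.sum_insert ha, Finset.sum_insert ha, quad_add, ih]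

theorem quad_mul_cov_mul (T T' : Matrix (FIdx P K) (FIdx P K) Bose) :
    quad (T * covB P K * T') = ∑ σ : Fin 2, ∑ x, ∑ y, covMat P K x y •
      ((∑ a, T a x ⊗ₜ[ℂ] plus σ a) * ∑ b, T' y b ⊗ₜ[ℂ] minus σ b) := by
  rw [quad]
  refine Finset.sum_congr rfl fun σ _ => ?_
  have h1 : ∀ a b, (T * covB P K * T') a b ⊗ₜ[ℂ] (plus σ a * minus σ b) =
      ∑ x, ∑ y, covMat P K x y • ((T a x ⊗ₜ[ℂ] plus σ a) * (T' y b ⊗ₜ[ℂ] minus σ b)) := by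
    intro a b
    simp only [Matrix.mul_apply, Finset.sum_mul, TensorProduct.sum_tmul]
    rw [Finset.sum_comm]
    refine Finset.sum_congr rfl fun x _ => Finset.sum_congr rfl fun y _ => ?_
    rw [Algebra.TensorProduct.tmul_mul_tmul, TensorProduct.smul_tmul', covB, Matrix.of_apply,
      Algebra.smul_def]
    congr 1
    ring
  simp only [h1, Finset.sum_mul_sum, Finset.smul_sum]
  have h2 : ∀ F : FIdx P K → FIdx P K → FIdx P K → FIdx P K → Fields,
      ∑ a, ∑ b, ∑ x, ∑ y, F a b x y = ∑ x, ∑ y, ∑ a, ∑ b, F a b x y := by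
    intro F
    calc ∑ a, ∑ b, ∑ x, ∑ y, F a b x y = ∑ a, ∑ x, ∑ b, ∑ y, F a b x y :=
          Finset.sum_congr rfl fun a _ => Finset.sum_comm
      _ = ∑ x, ∑ a, ∑ b, ∑ y, F a b x y := Finset.sum_comm
      _ = ∑ x, ∑ a, ∑ y, ∑ b, F a b x y :=
          Finset.sum_congr rfl fun x _ => Finset.sum_congr rfl fun a _ => Finset.sum_comm
      _ = _ := Finset.sum_congr rfl fun x _ => Finset.sum_comm
  exact h2 _

theorem minus_mul_plus (T T' : Matrix (FIdx P K) (FIdx P K) Bose) (σ : Fin 2) (x y : FIdx P K) :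
    (∑ b, T y b ⊗ₜ[ℂ] minus σ b) * (∑ a, T' a x ⊗ₜ[ℂ] plus σ a) =
      (-1 : ℂ) • ((∑ a, T' a x ⊗ₜ[ℂ] plus σ a) * ∑ b, T y b ⊗ₜ[ℂ] minus σ b) := by
  rw [Finset.sum_mul_sum, Finset.sum_mul_sum, Finset.sum_comm, Finset.smul_sum]
  refine Finset.sum_congr rfl fun a _ => ?_
  rw [Finset.smul_sum]
  refine Finset.sum_congr rfl fun b _ => ?_
  rw [Algebra.TensorProduct.tmul_mul_tmul, Algebra.TensorProduct.tmul_mul_tmul,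
    ← TensorProduct.tmul_smul, neg_one_smul, minus, plus, psi_mul_psi, mul_comm]

/-- One contraction between two quadratic forms links them in either order; anticommutation absorbs
the minus sign of the fermionic Γ. -/
theorem coe_carre_quad (T T' : Matrix (FIdx P K) (FIdx P K) Bose) (z z' : evenPart)
    (hz : (z : Fields) = quad T) (hz' : (z' : Fields) = quad T') :
    ((carre (lapFE P K) z z' : evenPart) : Fields) =
      quad (T * covB P K * T') + quad (T' * covB P K * T) := by
  rw [coe_carre_lapFE', hz, hz', quad_mul_cov_mul, quad_mul_cov_mul]
  simp only [← Finset.sum_add_distrib]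
  refine Finset.sum_congr rfl fun σ _ => Finset.sum_congr rfl fun x _ =>
    Finset.sum_congr rfl fun y _ => ?_
  rw [← smul_add, dplus_quad, dplus_quad, dminus_quad, dminus_quad, mul_smul_comm,
    smul_mul_assoc, minus_mul_plus]
  module

theorem ferD_tmul_one (i : FLabel) (b : Bose) : ferD i (b ⊗ₜ 1) = 0 := by
  rw [ferD_tmul, gderiv, CliffordAlgebra.contractLeft_one, TensorProduct.tmul_zero]

theorem lapF_tmul_one (b : Bose) : lapF P K (b ⊗ₜ 1) = 0 := by
  simp only [lapF_apply, dminus, ferD_tmul_one, map_zero, smul_zero, Finset.sum_const_zero]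

theorem carre_tmul_one (z z' : evenPart) (b : Bose) (hz : (z : Fields) = b ⊗ₜ 1) :
    carre (lapFE P K) z z' = 0 := by
  apply Subtype.ext
  rw [coe_carre_lapFE', hz]
  simp only [dminus, dplus, ferD_tmul_one, zero_mul, sub_zero, smul_zero, Finset.sum_const_zero]
  rfl

end Quadratic

/-! ### Resummation of the fermionic contractions -/

section Chains

variable {P : Params} {K : ℕ}

variable (P K) in
/-- The chains `M (G M)^j` of order `N`. -/
def chainMat (M : ℕ → Matrix (FIdx P K) (FIdx P K) Bose) :
    ℕ → ℕ → Matrix (FIdx P K) (FIdx P K) Bose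
  | 0, N => M N
  | j + 1, N => ∑ p ∈ antidiagonal N, M p.1 * covB P K * chainMat M j p.2

/-- Linking chains with a + 1 and b + 1 vertices by one propagator gives the chain with a + b + 2
vertices, regardless of where it is split. -/
theorem chainMat_mul (M : ℕ → Matrix (FIdx P K) (FIdx P K) Bose) (a b N : ℕ) :
    ∑ p ∈ antidiagonal N, chainMat P K M a p.1 * covB P K * chainMat P K M b p.2 =
      chainMat P K M (a + b + 1) N := by
  induction a generalizing N with
  | zero => rw [zero_add]; rfl
  | succ a ih =>
    have e1 : ∀ j n, chainMat P K M (j + 1) n =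
      ∑ p ∈ antidiagonal n, M p.1 * covB P K * chainMat P K M j p.2 := fun _ _ => rfl
    rw [show a + 1 + b + 1 = (a + b + 1) + 1 by ring, e1 (a + b + 1)]
    simp only [e1 a, Finset.sum_mul]
    rw [sum_antidiagonal_assoc N fun x y z =>
      M x * covB P K * chainMat P K M a y * covB P K * chainMat P K M b z]
    refine Finset.sum_congr rfl fun p _ => ?_
    rw [← ih, Finset.mul_sum]
    simp only [Matrix.mul_assoc]

/-- A chain with j propagators has j + 1 vertices, each of order at least one in e. -/
theorem chainMat_eq_zero {M : ℕ → Matrix (FIdx P K) (FIdx P K) Bose} (hM : M 0 = 0) {j N : ℕ}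
    (h : N ≤ j) : chainMat P K M j N = 0 := by
  induction j generalizing N with
  | zero => rw [Nat.le_zero.mp h]; exact hM
  | succ j ih =>
    rw [chainMat]
    refine Finset.sum_eq_zero fun p hp => ?_
    rw [Finset.HasAntidiagonal.mem_antidiagonal] at hp
    rcases Nat.eq_zero_or_pos p.1 with h0 | h0
    · rw [h0, hM, Matrix.zero_mul, Matrix.zero_mul]
    · rw [ih (by omega), Matrix.mul_zero]

/-- The even element `b ⊗ 1`. -/
def bosElem (b : Bose) : evenPart :=
  ⟨b ⊗ₜ 1, by rw [mem_evenPart, par_tmul, map_one]⟩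

/-- The quadratic form as an even element. -/
def quadElem (T : Matrix (FIdx P K) (FIdx P K) Bose) : evenPart := ⟨quad T, quad_mem_evenPart T⟩

variable (P K) in
/-- The terms with `j` fermionic contractions and order `N`. -/
def chainFlow (M : ℕ → Matrix (FIdx P K) (FIdx P K) Bose) (N : ℕ) : ℕ → evenPart
  | 0 => quadElem (M N)
  | j + 1 => quadElem (chainMat P K M (j + 1) N) +
      (-2 / ((j : ℂ) + 1)) • bosElem (covB P K * chainMat P K M j N).trace

theorem chainFlow_eq (M : ℕ → Matrix (FIdx P K) (FIdx P K) Bose) (N j : ℕ) :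
    ∃ b : Bose, chainFlow P K M N j = quadElem (chainMat P K M j N) + bosElem b := by
  cases j with
  | zero => exact ⟨0, by rw [chainFlow, chainMat]; apply Subtype.ext; simp [bosElem]⟩
  | succ j =>
    refine ⟨(-2 / ((j : ℂ) + 1)) • (covB P K * chainMat P K M j N).trace, ?_⟩
    rw [chainFlow]
    congr 1

theorem carre_chainFlow (M : ℕ → Matrix (FIdx P K) (FIdx P K) Bose) (N N' j j' : ℕ) :
    carre (lapFE P K) (chainFlow P K M N j) (chainFlow P K M N' j') =
      quadElem (chainMat P K M j N * covB P K * chainMat P K M j' N') +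
        quadElem (chainMat P K M j' N' * covB P K * chainMat P K M j N) := by
  obtain ⟨b, hb⟩ := chainFlow_eq M N j
  obtain ⟨b', hb'⟩ := chainFlow_eq M N' j'
  rw [hb, hb', carre_add_left, carre_add_right,
    carre_tmul_one (bosElem b) _ b rfl, carre_comm _ _ (bosElem b'),
    carre_tmul_one (bosElem b') _ b' rfl, add_zero, add_zero]
  apply Subtype.ext
  rw [coe_carre_quad _ _ _ _ rfl rfl]
  rfl

theorem quadElem_sum {ι : Type*} (s : Finset ι) (T : ι → Matrix (FIdx P K) (FIdx P K) Bose) :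
    quadElem (∑ i ∈ s, T i) = ∑ i ∈ s, quadElem (T i) := by
  apply Subtype.ext
  rw [AddSubmonoidClass.coe_finsetSum]
  exact quad_sum s T

theorem lapFE_chainFlow (M : ℕ → Matrix (FIdx P K) (FIdx P K) Bose) (N j : ℕ) :
    lapFE P K (chainFlow P K M N j) =
      (-2 : ℂ) • bosElem (covB P K * chainMat P K M j N).trace := by
  obtain ⟨b, hb⟩ := chainFlow_eq M N j
  rw [hb, map_add]
  apply Subtype.ext
  rw [Subalgebra.coe_add, coe_lapFE, coe_lapFE]
  show lapF P K (quad _) + lapF P K (b ⊗ₜ 1) = _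
  rw [lapF_quad, lapF_tmul_one, add_zero]
  rfl

/-- The j + 1 splittings of a chain give the same matrix, and the two linking orders cancel the
factor 1/2. The trace term integrates s^j into s^(j+1)/(j+1), the weight of the loops. -/
theorem chainFlow_rec (M : ℕ → Matrix (FIdx P K) (FIdx P K) Bose) (N j : ℕ) :
    ((j : ℂ) + 1) • chainFlow P K M N (j + 1) = lapFE P K (chainFlow P K M N j) + (1 / 2 : ℂ) •
      ∑ p ∈ antidiagonal N, ∑ q ∈ antidiagonal j,
        carre (lapFE P K) (chainFlow P K M p.1 q.1) (chainFlow P K M p.2 q.2) := by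
  have hj : (j : ℂ) + 1 ≠ 0 := by exact_mod_cast Nat.succ_ne_zero j
  have h1 : ∑ p ∈ antidiagonal N, ∑ q ∈ antidiagonal j,
      quadElem (chainMat P K M q.1 p.1 * covB P K * chainMat P K M q.2 p.2) =
      ((j : ℂ) + 1) • quadElem (chainMat P K M (j + 1) N) := by
    rw [Finset.sum_comm]
    have : ∀ q ∈ antidiagonal j, ∑ p ∈ antidiagonal N,
        quadElem (chainMat P K M q.1 p.1 * covB P K * chainMat P K M q.2 p.2) =
        quadElem (chainMat P K M (j + 1) N) := by
      intro q hq
      rw [Finset.HasAntidiagonal.mem_antidiagonal] at hq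
      rw [← quadElem_sum, chainMat_mul, hq]
    rw [Finset.sum_congr rfl this, Finset.sum_const, Finset.Nat.card_antidiagonal,
      ← Nat.cast_smul_eq_nsmul ℂ]
    push_cast
    rfl
  have h2 : ∑ p ∈ antidiagonal N, ∑ q ∈ antidiagonal j,
      quadElem (chainMat P K M q.2 p.2 * covB P K * chainMat P K M q.1 p.1) =
      ((j : ℂ) + 1) • quadElem (chainMat P K M (j + 1) N) := by
    rw [← h1, ← Finset.Nat.sum_antidiagonal_swap]
    refine Finset.sum_congr rfl fun p _ => ?_
    rw [← Finset.Nat.sum_antidiagonal_swap]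
    rfl
  simp only [carre_chainFlow, Finset.sum_add_distrib, h1, h2, lapFE_chainFlow]
  rw [chainFlow, smul_add, smul_smul, mul_div_cancel₀ _ hj, add_comm]
  congr 1
  module

end Chains

/-! ### Matrices with polynomial entries -/

/-- The label of a single pair. -/
def qlab (x y : Mom × Fin 2) : Fin 1 → QLabel := fun _ => ((x.2, y.2), (x.1, y.1))

/-- The mode label without its membership proof. -/
def FIdx.lab {P : Params} {K : ℕ} (x : FIdx P K) : Mom × Fin 2 := (x.1, x.2)

section MatPoly

variable {P : Params} {K : ℕ}

variable (P K) in
/-- The matrix of photon polynomials with kernel `τ`. -/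
def matPoly {m : ℕ} (τ : Kern 1 m) : Matrix (FIdx P K) (FIdx P K) Bose :=
  Matrix.of fun x y => bpoly P K fun b => pref P (qlab x.lab y.lab) b * τ (qlab x.lab y.lab) b

theorem sum_fIdx {M : Type*} [AddCommMonoid M] (F : Mom × Fin 2 → M) :
    ∑ x : FIdx P K, F x.lab = ∑ x ∈ fModes P K ×ˢ Finset.univ, F x := by
  rw [Finset.sum_product, Fintype.sum_prod_type,
    ← Finset.sum_coe_sort (fModes P K) fun k => ∑ ρ, F (k, ρ)]
  rfl

theorem quad_matPoly {m : ℕ} (τ : Kern 1 m) : quad (matPoly P K τ) = gpoly P K τ := by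
  have h1 : ∀ σ : Fin 1 → Fin 2, ∑ q ∈ Fintype.piFinset fun _ : Fin 1 => qLabels P K,
      (bpoly P K fun b => pref P q b * τ q b) ⊗ₜ[ℂ] gmon σ q =
      ∑ x : FIdx P K, ∑ y : FIdx P K, matPoly P K τ x y ⊗ₜ[ℂ] (plus (σ 0) x * minus (σ 0) y) := by
    intro σ
    have e : ∀ y : QLabel, ∀ b : Fin 0 → QLabel,
        ((0 : Fin 1).insertNth y b : Fin 1 → QLabel) = fun _ => y := by
      intro y b
      funext i
      rw [show i = (0 : Fin 1) from Fin.eq_zero i]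
      exact Fin.insertNth_apply_same (α := fun _ => QLabel) 0 y b
    rw [sum_piFinset_insertNth _ 0]
    simp only [e, Fintype.piFinset_of_isEmpty, Finset.univ_unique, Finset.sum_singleton]
    have h2 : ∀ x : FIdx P K, ∀ y : FIdx P K,
        matPoly P K τ x y ⊗ₜ[ℂ] (plus (σ 0) x * minus (σ 0) y) =
        (fun x y : Mom × Fin 2 => (bpoly P K fun b => pref P (qlab x y) b * τ (qlab x y) b) ⊗ₜ[ℂ]
          gmon σ (qlab x y)) x.lab y.lab := by
      intro x y
      simp only [matPoly, Matrix.of_apply, gmon, List.ofFn_succ, List.ofFn_zero, List.prod_cons,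
        List.prod_nil, mul_one]
      rfl
    have h3 := (Finset.sum_congr rfl fun (x : FIdx P K) _ => (Finset.sum_congr rfl fun y _ =>
      h2 x y).trans (sum_fIdx (P := P) (K := K) fun y =>
        (bpoly P K fun b => pref P (qlab x.lab y) b * τ (qlab x.lab y) b) ⊗ₜ[ℂ]
          gmon σ (qlab x.lab y))).trans (sum_fIdx (P := P) (K := K) fun x =>
            ∑ y ∈ fModes P K ×ˢ Finset.univ,
      (bpoly P K fun b => pref P (qlab x y) b * τ (qlab x y) b) ⊗ₜ[ℂ] gmon σ (qlab x y))
    rw [h3, ← Finset.sum_product']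
    refine Finset.sum_nbij' (fun q => ((q.2.1, q.1.1), (q.2.2, q.1.2)))
      (fun x => ((x.1.2, x.2.2), (x.1.1, x.2.1))) ?_ ?_ ?_ ?_ ?_
    · intro q hq; simpa [qLabels] using hq
    · intro q hq; simpa [qLabels] using hq
    · intro q _; rfl
    · intro q _; rfl
    · intro q _; rfl
  rw [gpoly, fpoly, Finset.sum_congr rfl fun σ _ => h1 σ, quad]
  refine (Fintype.sum_equiv (Equiv.funUnique (Fin 1) (Fin 2)) _ _ fun σ => ?_).symm
  rfl

theorem gpoly_zero_pairs {m : ℕ} (w : Kern 0 m) :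
    gpoly P K w = (bpoly P K fun b => pref P (Fin.elim0 : Fin 0 → QLabel) b * w Fin.elim0 b) ⊗ₜ[ℂ]
      (1 : Grass) := by
  rw [gpoly, fpoly]
  rw [Fintype.sum_eq_single (Fin.elim0 : Fin 0 → Fin 2) fun σ h => absurd (Subsingleton.elim _ _) h,
    Finset.sum_eq_single_of_mem (Fin.elim0 : Fin 0 → QLabel) (Fintype.mem_piFinset.mpr fun i => i.elim0)
      fun q _ h => absurd (Subsingleton.elim _ _) h]
  rw [gmon, List.ofFn_zero, List.prod_nil]

theorem totMom_qlab {L m : ℕ} (x y : Mom × Fin 2) (b : Fin m → BLabel) :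
    totMom L (qlab x y) b = momHom L x.1 - momHom L y.1 - ∑ i, momHom L (b i).2 := by
  simp [totMom, qlab]

theorem sum_covMat' {M : Type*} [AddCommGroup M] [Module ℂ M]
    (F : Mom × Fin 2 → Mom × Fin 2 → M) :
    ∑ x : FIdx P K, ∑ y : FIdx P K, covMat P K x y • F x.lab y.lab =
      ∑ k ∈ fModes P K, ∑ ρ : Fin 2, ∑ ρ' : Fin 2,
        ((vol P : ℂ) * gUV P K k ρ ρ') • F (k, ρ) (k, ρ') := by
  rw [sum_covMat fun x y : FIdx P K => F x.lab y.lab,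
    ← Finset.sum_coe_sort (fModes P K)]
  rfl

/-- The momentum constraint of a chain. -/
def chainInd (L : ℕ) {m m' : ℕ} (k k' : Mom) (b : Fin (m + m') → BLabel) : ℂ :=
  if momHom L k - momHom L k' - ∑ i : Fin m, momHom L (b (Fin.castAdd m' i)).2 = 0 then 1 else 0

/-- The volume in the covariance compensates the normalization of the two contracted fermion legs,
and one delta becomes the constraint on the internal momentum. -/
theorem pref_qlab_mul {m m' : ℕ} (hv : vol P ≠ 0) (x y z z' : Mom × Fin 2) (hz : z.1 = z'.1)
    (b : Fin (m + m') → BLabel) :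
    pref P (qlab x z) (fun i => b (Fin.castAdd m' i)) * (vol P : ℂ) *
      pref P (qlab z' y) (fun i => b (Fin.natAdd m i)) =
    pref P (qlab x y) b * chainInd P.L x.1 z.1 b := by
  rw [pref, pref, pref, totMom_qlab, totMom_qlab, totMom_qlab, chainInd, Fin.sum_univ_add, ← hz]
  set s := ∑ i : Fin m, momHom P.L (b (Fin.castAdd m' i)).2
  set s' := ∑ i : Fin m', momHom P.L (b (Fin.natAdd m i)).2
  by_cases h : momHom P.L x.1 - momHom P.L z.1 - s = 0
  · rw [if_pos h, if_pos h]
    have hv' : (vol P : ℂ) ≠ 0 := by exact_mod_cast hv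
    have h2 : momHom P.L x.1 - momHom P.L y.1 - (s + s') =
        momHom P.L z.1 - momHom P.L y.1 - s' := by
      have h3 : momHom P.L x.1 = momHom P.L z.1 + s := by
        rw [sub_sub, sub_eq_zero] at h; exact h
      rw [h3]; abel
    rw [h2]
    by_cases h' : momHom P.L z.1 - momHom P.L y.1 - s' = 0
    · rw [if_pos h']
      push_cast
      rw [pow_add]
      field_simp
    · rw [if_neg h']; simp
  · rw [if_neg h, if_neg h]; simp

variable (P K) in
/-- The kernel of a chain of two vertices. -/
def chainKern {m m' : ℕ} (τ : Kern 1 m) (τ' : Kern 1 m') : Kern 1 (m + m') := fun q b =>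
  ∑ k ∈ fModes P K, ∑ ρ : Fin 2, ∑ ρ' : Fin 2,
    gUV P K k ρ ρ' * (chainInd P.L (q 0).2.1 k b *
      (τ (qlab ((q 0).2.1, (q 0).1.1) (k, ρ)) (fun i => b (Fin.castAdd m' i)) *
        τ' (qlab (k, ρ') ((q 0).2.2, (q 0).1.2)) (fun i => b (Fin.natAdd m i))))

theorem matPoly_mul {m m' : ℕ} (hv : vol P ≠ 0) (τ : Kern 1 m) (τ' : Kern 1 m') :
    matPoly P K τ * covB P K * matPoly P K τ' = matPoly P K (chainKern P K τ τ') := by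
  ext1 x y
  have h1 : (matPoly P K τ * covB P K * matPoly P K τ') x y =
      ∑ z : FIdx P K, ∑ z' : FIdx P K, covMat P K z z' •
        (matPoly P K τ x z * matPoly P K τ' z' y) := by
    simp only [Matrix.mul_apply, Finset.sum_mul]
    rw [Finset.sum_comm]
    refine Finset.sum_congr rfl fun z _ => Finset.sum_congr rfl fun z' _ => ?_
    rw [covB, Matrix.of_apply, Algebra.smul_def]
    ring
  rw [h1]
  have h2 := sum_covMat' (P := P) (K := K) fun z z' =>
    (bpoly P K fun b => pref P (qlab x.lab z) b * τ (qlab x.lab z) b) *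
    (bpoly P K fun b => pref P (qlab z' y.lab) b * τ' (qlab z' y.lab) b)
  refine h2.trans ?_
  simp only [bpoly_mul, ← bpoly_smul, ← bpoly_sum]
  rw [matPoly, Matrix.of_apply]
  congr 1
  funext b
  simp only [Finset.sum_apply, Pi.smul_apply, smul_eq_mul, chainKern, Finset.mul_sum]
  refine Finset.sum_congr rfl fun k _ => Finset.sum_congr rfl fun ρ _ =>
    Finset.sum_congr rfl fun ρ' _ => ?_
  have h3 := pref_qlab_mul hv x.lab y.lab (k, ρ) (k, ρ') rfl b
  change _ = pref P (qlab x.lab y.lab) b * (gUV P K k ρ ρ' * (chainInd P.L x.lab.1 k b *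
    (τ (qlab x.lab (k, ρ)) (fun i => b (Fin.castAdd m' i)) *
      τ' (qlab (k, ρ') y.lab) (fun i => b (Fin.natAdd m i)))))
  linear_combination (gUV P K k ρ ρ' *
    τ (qlab x.lab (k, ρ)) (fun i => b (Fin.castAdd m' i)) *
    τ' (qlab (k, ρ') y.lab) (fun i => b (Fin.natAdd m i))) * h3

variable (P K) in
/-- The kernel of a closed chain. -/
def loopKern {m : ℕ} (τ : Kern 1 m) : Kern 0 m := fun _ b =>
  ((vol P : ℂ)⁻¹) * ∑ k ∈ fModes P K, ∑ ρ : Fin 2, ∑ ρ' : Fin 2,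
    gUV P K k ρ ρ' * τ (qlab (k, ρ') (k, ρ)) b

theorem loopKern_apply {m : ℕ} (τ : Kern 1 m) (q : Fin 0 → QLabel) (b : Fin m → BLabel) :
    loopKern P K τ q b = ((vol P : ℂ)⁻¹) * ∑ k ∈ fModes P K, ∑ ρ : Fin 2, ∑ ρ' : Fin 2,
      gUV P K k ρ ρ' * τ (qlab (k, ρ') (k, ρ)) b := rfl

/-- The loop momentum drops out of the conservation law and stays free; the remaining normalization
is the factor `(vol P)⁻¹` in `loopKern`. -/
theorem trace_matPoly {m : ℕ} (hv : vol P ≠ 0) (τ : Kern 1 m) :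
    (covB P K * matPoly P K τ).trace ⊗ₜ[ℂ] (1 : Grass) = gpoly P K (loopKern P K τ) := by
  rw [gpoly_zero_pairs]
  congr 1
  have h1 : (covB P K * matPoly P K τ).trace = ∑ z : FIdx P K, ∑ z' : FIdx P K,
      covMat P K z z' • matPoly P K τ z' z := by
    simp only [Matrix.trace, Matrix.diag_apply, Matrix.mul_apply]
    refine Finset.sum_congr rfl fun z _ => Finset.sum_congr rfl fun z' _ => ?_
    rw [covB, Matrix.of_apply, Algebra.smul_def]
  rw [h1]
  have h2 := sum_covMat' (P := P) (K := K) fun z z' =>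
    (bpoly P K fun b => pref P (qlab z' z) b * τ (qlab z' z) b)
  refine h2.trans ?_
  simp only [← bpoly_smul, ← bpoly_sum]
  congr 1
  funext b
  simp only [Finset.sum_apply, Pi.smul_apply, smul_eq_mul, loopKern, Finset.mul_sum]
  refine Finset.sum_congr rfl fun k _ => Finset.sum_congr rfl fun ρ _ =>
    Finset.sum_congr rfl fun ρ' _ => ?_
  have h3 : pref P (qlab (k, ρ') (k, ρ)) b * (vol P : ℂ) =
      pref P (Fin.elim0 : Fin 0 → QLabel) b * ((vol P : ℂ)⁻¹) := by
    rw [pref, pref, totMom_qlab]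
    have : totMom P.L (Fin.elim0 : Fin 0 → QLabel) b = - ∑ i, momHom P.L (b i).2 := by
      simp [totMom]
    rw [this, sub_self, zero_sub]
    have hv' : (vol P : ℂ) ≠ 0 := by exact_mod_cast hv
    push_cast
    field_simp
  linear_combination (gUV P K k ρ ρ' * τ (qlab (k, ρ') (k, ρ)) b) * h3

end MatPoly

/-! ### Bounds for chains and loops -/

/-- Sequences of matrices with bounded convergent kernels. -/
def MRep (P : Params) (m : ℕ) (B : ℝ) (T : (K : ℕ) → Matrix (FIdx P K) (FIdx P K) Bose) : Prop :=
  ∃ τ : ℕ → Kern 1 m, (∀ K, T K = matPoly P K (τ K)) ∧ (∀ K q b, ‖τ K q b‖ ≤ B) ∧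
    ∀ q b, Conv fun K => τ K q b

section MRep

variable {P : Params} {m m' : ℕ} {B B' : ℝ} {T T' : (K : ℕ) → Matrix (FIdx P K) (FIdx P K) Bose}

theorem MRep.nonneg (h : MRep P m B T) : 0 ≤ B := by
  obtain ⟨w, -, hb, -⟩ := h
  exact (norm_nonneg _).trans (hb 0 (fun _ => 0) (fun _ => 0))

theorem matPoly_add {K : ℕ} (τ τ' : Kern 1 m) :
    matPoly P K (τ + τ') = matPoly P K τ + matPoly P K τ' := by
  ext1 x y
  rw [Matrix.add_apply, matPoly, matPoly, matPoly, Matrix.of_apply, Matrix.of_apply,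
    Matrix.of_apply, ← bpoly_add]
  congr 1
  funext b
  simp only [Pi.add_apply]
  ring

theorem matPoly_zero {K : ℕ} : matPoly P K (0 : Kern 1 m) = 0 := by
  have := matPoly_add (P := P) (K := K) (0 : Kern 1 m) 0
  simpa using this

theorem MRep.add (h : MRep P m B T) (h' : MRep P m B' T') :
    MRep P m (B + B') fun K => T K + T' K := by
  obtain ⟨w, hw, hb, hc⟩ := h
  obtain ⟨w', hw', hb', hc'⟩ := h'
  refine ⟨fun K => w K + w' K, fun K => by simp only [hw, hw', matPoly_add], fun K q b => ?_,
    fun q b => (hc q b).add (hc' q b)⟩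
  exact norm_add_le_of_le (hb K q b) (hb' K q b)

theorem MRep.zero (P : Params) (m : ℕ) : MRep P m 0 fun _ => 0 :=
  ⟨fun _ => 0, fun K => matPoly_zero.symm, fun _ _ _ => by simp, fun _ _ => Conv.const 0⟩

theorem MRep.mono (h : MRep P m B T) (hB : B ≤ B') : MRep P m B' T := by
  obtain ⟨w, hw, hb, hc⟩ := h
  exact ⟨w, hw, fun K q b => (hb K q b).trans hB, hc⟩

theorem MRep.sum {ι : Type*} (s : Finset ι) {B : ι → ℝ}
    {T : ι → (K : ℕ) → Matrix (FIdx P K) (FIdx P K) Bose}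
    (h : ∀ i ∈ s, MRep P m (B i) (T i)) :
    MRep P m (∑ i ∈ s, B i) fun K => ∑ i ∈ s, T i K := by
  classical
  induction s using Finset.induction_on with
  | empty => simpa using MRep.zero P m
  | insert a s ha ih =>
    simp only [Finset.sum_insert ha]
    exact (h a (Finset.mem_insert_self a s)).add
      (ih fun i hi => h i (Finset.mem_insert_of_mem hi))

theorem MRep.quad (h : MRep P m B T) : Rep P 1 m B fun K => quad (T K) := by
  obtain ⟨w, hw, hb, hc⟩ := h
  exact ⟨w, fun K => by simp only [hw, quad_matPoly], hb, hc⟩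

/-- Labels with spatial part in the Brillouin zone. -/
def InBZ (L : ℕ) (k : Mom) : Prop := k.2 ∈ Finset.Ico (0 : ℤ) L ×ˢ Finset.Ico (0 : ℤ) L

instance (L : ℕ) (k : Mom) : Decidable (InBZ L k) := by unfold InBZ; infer_instance

theorem inBZ_of_mem {K : ℕ} {k : Mom} (hk : k ∈ fModes P K) : InBZ P.L k := by
  simp only [fModes, Finset.mem_filter, Finset.mem_product] at hk
  simpa [InBZ] using hk.1.2

/-- Fermion momenta live in a fundamental domain, so unlike photon momenta they are determined by
their class. -/
theorem momHom_injOn {L : ℕ} {k k' : Mom} (hk : InBZ L k) (hk' : InBZ L k')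
    (h : momHom L k = momHom L k') : k = k' := by
  simp only [InBZ, Finset.mem_product, Finset.mem_Ico] at hk hk'
  simp only [momHom, AddMonoidHom.coe_mk, ZeroHom.coe_mk, Prod.mk.injEq,
    ZMod.intCast_eq_intCast_iff] at h
  have key : ∀ a b : ℤ, 0 ≤ a → a < L → 0 ≤ b → b < L → a ≡ b [ZMOD L] → a = b := by
    intro a b h1 h2 h3 h4 h5
    have : a % L = b % L := h5
    rwa [Int.emod_eq_of_lt h1 h2, Int.emod_eq_of_lt h3 h4] at this
  exact Prod.ext h.1 (Prod.ext (key _ _ hk.1.1 hk.1.2 hk'.1.1 hk'.1.2 h.2.1)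
    (key _ _ hk.2.1 hk.2.2 hk'.2.1 hk'.2.2 h.2.2))

/-- At most one element satisfies a constraint that determines it. -/
theorem sum_ite_le_of_unique {ι : Type*} (s : Finset ι) (p : ι → Prop) [DecidablePred p] {a : ℝ}
    (ha : 0 ≤ a) (h : ∀ x ∈ s, ∀ y ∈ s, p x → p y → x = y) :
    ∑ x ∈ s, (if p x then a else 0) ≤ a := by
  rw [← Finset.sum_filter, Finset.sum_const, nsmul_eq_mul]
  have : (s.filter p).card ≤ 1 := Finset.card_le_one.mpr fun x hx y hy =>
    h x (Finset.mem_filter.mp hx).1 y (Finset.mem_filter.mp hy).1 (Finset.mem_filter.mp hx).2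
      (Finset.mem_filter.mp hy).2
  calc ((s.filter p).card : ℝ) * a ≤ 1 * a :=
        mul_le_mul_of_nonneg_right (by exact_mod_cast this) ha
    _ = a := one_mul a

theorem norm_chainInd (L : ℕ) (k k' : Mom) (b : Fin (m + m') → BLabel) :
    ‖chainInd L k k' b‖ =
      if momHom L k - momHom L k' = ∑ i : Fin m, momHom L (b (Fin.castAdd m' i)).2 then 1 else 0 := by
  rw [chainInd]
  simp only [sub_eq_zero]
  split_ifs <;> simp

/-- Conservation leaves at most one internal momentum; the factor 4 counts the sublattice indices of
the propagator. -/
theorem MRep.chain {c : ℝ} (hU : UVBounds P c) (h : MRep P m B T) (h' : MRep P m' B' T') :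
    MRep P (m + m') (4 * c * (B * B')) fun K => T K * covB P K * T' K := by
  have hB := h.nonneg
  have hB' := h'.nonneg
  obtain ⟨τ, hτ, hb, hc⟩ := h
  obtain ⟨τ', hτ', hb', hc'⟩ := h'
  obtain ⟨G, hG0, hGc, -, -, hGb, -⟩ := hU.fermion_sum
  have hc0 := hU.pos
  have hterm : ∀ K (q : Fin 1 → QLabel) (b : Fin (m + m') → BLabel), ∀ k ∈ fModes P K,
      ‖∑ ρ : Fin 2, ∑ ρ' : Fin 2, gUV P K k ρ ρ' * (chainInd P.L (q 0).2.1 k b *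
      (τ K (qlab ((q 0).2.1, (q 0).1.1) (k, ρ)) (fun i => b (Fin.castAdd m' i)) *
        τ' K (qlab (k, ρ') ((q 0).2.2, (q 0).1.2)) (fun i => b (Fin.natAdd m i))))‖ ≤
      if momHom P.L (q 0).2.1 - momHom P.L k =
        ∑ i : Fin m, momHom P.L (b (Fin.castAdd m' i)).2 then 4 * c * (B * B') else 0 := by
    intro K q b k hk
    have h1 : ∀ ρ ρ' : Fin 2, ‖gUV P K k ρ ρ' * (chainInd P.L (q 0).2.1 k b *
      (τ K (qlab ((q 0).2.1, (q 0).1.1) (k, ρ)) (fun i => b (Fin.castAdd m' i)) *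
        τ' K (qlab (k, ρ') ((q 0).2.2, (q 0).1.2)) (fun i => b (Fin.natAdd m i))))‖ ≤
        if momHom P.L (q 0).2.1 - momHom P.L k =
          ∑ i : Fin m, momHom P.L (b (Fin.castAdd m' i)).2 then c * (B * B') else 0 := by
      intro ρ ρ'
      rw [norm_mul, norm_mul, norm_mul, norm_chainInd]
      split_ifs with hi
      · rw [one_mul]
        exact mul_le_mul ((hGb K k hk ρ ρ').trans (hGc k)) (mul_le_mul (hb _ _ _) (hb' _ _ _)
          (norm_nonneg _) hB) (by positivity) hc0.le
      · simp
    refine (norm_sum_le_of_le _ fun ρ _ => norm_sum_le_of_le _ fun ρ' _ => h1 ρ ρ').trans ?_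
    simp only [Finset.sum_const, Finset.card_univ, Fintype.card_fin, nsmul_eq_mul]
    split_ifs
    · apply le_of_eq; push_cast; ring
    · simp
  refine ⟨fun K => chainKern P K (τ K) (τ' K), fun K => ?_, fun K q b => ?_, fun q b => ?_⟩
  · beta_reduce
    rw [hτ, hτ', matPoly_mul hU.vol_pos.ne']
  · refine (norm_sum_le_of_le _ fun k hk => hterm K q b k hk).trans
      (sum_ite_le_of_unique _ _ (by positivity) fun k hk k' hk' h1 h2 => ?_)
    refine momHom_injOn (inBZ_of_mem hk) (inBZ_of_mem hk') ?_
    have := h1.trans h2.symm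
    exact sub_right_injective this
  · set γ := ∑ i : Fin m, momHom P.L (b (Fin.castAdd m' i)).2 with hγ
    -- All internal momenta allowed by conservation, for every cutoff: the frequency is fixed and
    -- the Brillouin zone is finite.
    set F : Finset Mom := {(q 0).2.1.1 - γ.1} ×ˢ
      (Finset.Ico (0 : ℤ) P.L ×ˢ Finset.Ico (0 : ℤ) P.L) with hF
    refine conv_sum_of_dominated (g := fun k => if k ∈ F then 4 * c * (B * B') else 0)
      (summable_of_hasFiniteSupport ((Finset.finite_toSet F).subset fun k hk => ?_))
      (fun k => by split_ifs <;> positivity) (fun K k hk => ?_) fun k => ?_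
    · by_contra hc
      exact hk (if_neg hc)
    · refine (hterm K q b k hk).trans ?_
      split_ifs with h1 h2
      · exact le_rfl
      · exfalso
        apply h2
        rw [hF, Finset.mem_product, Finset.mem_singleton]
        refine ⟨?_, inBZ_of_mem hk⟩
        have h4 := congrArg Prod.fst (h1.trans hγ.symm)
        simp only [momHom, AddMonoidHom.coe_mk, ZeroHom.coe_mk, Prod.fst_sub] at h4
        omega
      · positivity
      · exact le_rfl
    · have h3 : Conv fun K => ∑ ρ : Fin 2, ∑ ρ' : Fin 2,
          (if k ∈ fModes P K then gUV P K k ρ ρ' else 0) * (chainInd P.L (q 0).2.1 k b *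
          (τ K (qlab ((q 0).2.1, (q 0).1.1) (k, ρ)) (fun i => b (Fin.castAdd m' i)) *
            τ' K (qlab (k, ρ') ((q 0).2.2, (q 0).1.2)) (fun i => b (Fin.natAdd m i)))) :=
        Conv.sum _ fun ρ _ => Conv.sum _ fun ρ' _ => (hU.fermion_lim k ρ ρ').mul
          ((Conv.const _).mul ((hc _ _).mul (hc' _ _)))
      convert h3 using 2 with K
      split_ifs <;> simp

/-- A closed chain with one propagator; the diagonal part of the propagator is odd in the
frequency. -/
theorem Rep.tadpole {c : ℝ} (hU : UVBounds P c) {τ : Kern 1 m} (hB : 0 ≤ B)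
    (hb : ∀ q b, ‖τ q b‖ ≤ B)
    (hdiag : ∀ ρ k k' b, τ (qlab (k, ρ) (k, ρ)) b = τ (qlab (k', ρ) (k', ρ)) b) :
    Rep P 0 m (2 * c ^ 2 * B) fun K =>
      (covB P K * matPoly P K τ).trace ⊗ₜ[ℂ] (1 : Grass) := by
  obtain ⟨G, hG0, -, hGs, hGt, -, hGo⟩ := hU.fermion_sum
  have hc0 := hU.pos
  have hv := hU.vol_pos
  -- Diagonal vertex entries do not depend on the momentum, so they factor out of the vanishing sum
  -- `tadpole`. Only off-diagonal entries, bounded by c G², remain.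
  have hred : ∀ K (b : Fin m → BLabel), ∑ k ∈ fModes P K, ∑ ρ : Fin 2, ∑ ρ' : Fin 2,
      gUV P K k ρ ρ' * τ (qlab (k, ρ') (k, ρ)) b =
      ∑ k ∈ fModes P K, (gUV P K k 0 1 * τ (qlab (k, 1) (k, 0)) b +
        gUV P K k 1 0 * τ (qlab (k, 0) (k, 1)) b) := by
    intro K b
    have h1 : ∀ ρ, ∑ k ∈ fModes P K, gUV P K k ρ ρ * τ (qlab (k, ρ) (k, ρ)) b = 0 := by
      intro ρ
      simp only [hdiag ρ _ 0 b]
      rw [← Finset.sum_mul, hU.tadpole, zero_mul]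
    simp only [Fin.sum_univ_two, Finset.sum_add_distrib, h1]
    ring
  have hterm : ∀ K (b : Fin m → BLabel), ∀ k ∈ fModes P K,
      ‖gUV P K k 0 1 * τ (qlab (k, 1) (k, 0)) b + gUV P K k 1 0 * τ (qlab (k, 0) (k, 1)) b‖ ≤
      G k ^ 2 * (2 * c * B) := by
    intro K b k hk
    refine (norm_add_le _ _).trans ?_
    rw [norm_mul, norm_mul]
    have h0 : (0 : ℝ) ≤ c * G k ^ 2 := by positivity
    have h1 := mul_le_mul (hGo K k hk 0 1 (by decide)) (hb (qlab (k, 1) (k, 0)) b)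
      (norm_nonneg _) h0
    have h2 := mul_le_mul (hGo K k hk 1 0 (by decide)) (hb (qlab (k, 0) (k, 1)) b)
      (norm_nonneg _) h0
    linarith
  refine ⟨fun K => loopKern P K τ, fun K => trace_matPoly hv.ne' τ, fun K q b => ?_,
    fun q b => ?_⟩
  · beta_reduce
    rw [loopKern_apply, hred, norm_mul, norm_inv, Complex.norm_real, Real.norm_of_nonneg hv.le]
    have h1 := norm_sum_le_of_dominated (hGs.mul_right (2 * c * B))
      (fun k => by positivity) (hterm K b)
    rw [tsum_mul_right] at h1
    calc (vol P)⁻¹ * ‖_‖ ≤ (vol P)⁻¹ * (c * vol P * (2 * c * B)) := by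
          gcongr
          exact h1.trans (mul_le_mul_of_nonneg_right hGt (by positivity))
      _ = _ := by field_simp
  · simp only [loopKern_apply, hred]
    refine (Conv.const _).mul (conv_sum_of_dominated (hGs.mul_right (2 * c * B))
      (fun k => by positivity) (fun K => hterm K b) fun k => ?_)
    have h3 := ((hU.fermion_lim k 0 1).mul (Conv.const (τ (qlab (k, 1) (k, 0)) b))).add
      ((hU.fermion_lim k 1 0).mul (Conv.const (τ (qlab (k, 0) (k, 1)) b)))
    convert h3 using 2 with K
    split_ifs <;> simp

/-- Every first component has at most one admissible partner, so the double sum is controlled by a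
single one. -/
theorem sum_pair_le {ι : Type*} [DecidableEq ι] (R : ι → ι → Prop) [∀ x y, Decidable (R x y)]
    (hR : ∀ x y y', R x y → R x y' → y = y') {f : ι → ℝ} (hf0 : ∀ x, 0 ≤ f x) (hf : Summable f)
    (u : Finset (ι × ι)) : ∑ x ∈ u, (if R x.1 x.2 then f x.1 else 0) ≤ ∑' x, f x := by
  have h1 : u ⊆ u.image Prod.fst ×ˢ u.image Prod.snd := fun x hx =>
    Finset.mem_product.mpr ⟨Finset.mem_image_of_mem _ hx, Finset.mem_image_of_mem _ hx⟩
  refine (Finset.sum_le_sum_of_subset_of_nonneg h1 fun x _ _ => by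
    split_ifs <;> simp [hf0]).trans ?_
  rw [Finset.sum_product]
  refine (Finset.sum_le_sum fun x _ => sum_ite_le_of_unique _ _ (hf0 x)
    fun y _ y' _ => hR x y y').trans (hf.sum_le_tsum _ fun x _ => hf0 x)

/-- A closed chain with at least two propagators. -/
theorem MRep.loop {c : ℝ} (hU : UVBounds P c) (h : MRep P m B T) (h' : MRep P m' B' T') :
    Rep P 0 (m + m') (16 * c * (B * B')) fun K =>
      (covB P K * (T K * covB P K * T' K)).trace ⊗ₜ[ℂ] (1 : Grass) := by
  have hB := h.nonneg
  have hB' := h'.nonneg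
  obtain ⟨τ, hτ, hb, hc⟩ := h
  obtain ⟨τ', hτ', hb', hc'⟩ := h'
  obtain ⟨G, hG0, -, hGs, hGt, hGb, -⟩ := hU.fermion_sum
  have hc0 := hU.pos
  have hv := hU.vol_pos
  set F : ℕ → (Fin (m + m') → BLabel) → Mom × Mom → ℂ := fun K b x =>
    ∑ ρ : Fin 2, ∑ ρ' : Fin 2, ∑ r : Fin 2, ∑ r' : Fin 2,
      gUV P K x.1 ρ ρ' * (gUV P K x.2 r r' * (chainInd P.L x.1 x.2 b *
        (τ K (qlab (x.1, ρ') (x.2, r)) (fun i => b (Fin.castAdd m' i)) *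
          τ' K (qlab (x.2, r') (x.1, ρ)) (fun i => b (Fin.natAdd m i))))) with hF
  have hred : ∀ K q b, loopKern P K (chainKern P K (τ K) (τ' K)) q b =
      (vol P : ℂ)⁻¹ * ∑ x ∈ fModes P K ×ˢ fModes P K, F K b x := by
    intro K q b
    rw [loopKern_apply, Finset.sum_product]
    congr 1
    refine Finset.sum_congr rfl fun k _ => ?_
    simp only [hF]
    symm
    rw [Finset.sum_comm]
    refine Finset.sum_congr rfl fun ρ _ => ?_
    rw [Finset.sum_comm]
    refine Finset.sum_congr rfl fun ρ' _ => ?_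
    rw [chainKern, Finset.mul_sum]
    refine Finset.sum_congr rfl fun k' _ => ?_
    simp only [Finset.mul_sum]
    rfl
  set γ : (Fin (m + m') → BLabel) → MomGrp P.L := fun b =>
    ∑ i : Fin m, momHom P.L (b (Fin.castAdd m' i)).2 with hγ
  -- G(k)G(k') ≤ (G(k)² + G(k')²)/2, and the constraint fixes k - k'. Thus each half is controlled
  -- by the sum of G², finite although G itself need not be summable. Sixteen index choices times
  -- 1/2 give the factor 8 below.
  set g₁ : (Fin (m + m') → BLabel) → Mom × Mom → ℝ := fun b x =>
    if (InBZ P.L x.1 ∧ InBZ P.L x.2) ∧ momHom P.L x.1 - momHom P.L x.2 = γ b then G x.1 ^ 2 else 0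
    with hg₁
  set g₂ : (Fin (m + m') → BLabel) → Mom × Mom → ℝ := fun b x =>
    if (InBZ P.L x.1 ∧ InBZ P.L x.2) ∧ momHom P.L x.1 - momHom P.L x.2 = γ b then G x.2 ^ 2 else 0
    with hg₂
  have h₁0 : ∀ b x, 0 ≤ g₁ b x := fun b x => by simp only [hg₁]; split_ifs <;> positivity
  have h₂0 : ∀ b x, 0 ≤ g₂ b x := fun b x => by simp only [hg₂]; split_ifs <;> positivity
  have h₁s : ∀ b u, ∑ x ∈ u, g₁ b x ≤ ∑' k, G k ^ 2 := fun b u =>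
    sum_pair_le (fun k k' => (InBZ P.L k ∧ InBZ P.L k') ∧ momHom P.L k - momHom P.L k' = γ b)
      (fun k y y' h1 h2 => momHom_injOn h1.1.2 h2.1.2
        (sub_right_injective (h1.2.trans h2.2.symm))) (fun k => sq_nonneg _) hGs u
  have h₂s : ∀ b u, ∑ x ∈ u, g₂ b x ≤ ∑' k, G k ^ 2 := by
    intro b u
    have h3 := sum_pair_le (fun k k' => (InBZ P.L k' ∧ InBZ P.L k) ∧
      momHom P.L k' - momHom P.L k = γ b)
      (fun k y y' h1 h2 => momHom_injOn h1.1.1 h2.1.1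
        (sub_left_injective (h1.2.trans h2.2.symm))) (fun k => sq_nonneg (G k)) hGs
        (u.map (Equiv.prodComm Mom Mom).toEmbedding)
    rw [Finset.sum_map] at h3
    exact h3
  have hsum : ∀ b, Summable fun x => (g₁ b x + g₂ b x) * (8 * (B * B')) := fun b =>
    ((summable_of_sum_le (h₁0 b) (h₁s b)).add (summable_of_sum_le (h₂0 b) (h₂s b))).mul_right _
  have hpos : ∀ b x, 0 ≤ (g₁ b x + g₂ b x) * (8 * (B * B')) := fun b x =>
    mul_nonneg (add_nonneg (h₁0 b x) (h₂0 b x)) (by positivity)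
  have hterm : ∀ K b, ∀ x ∈ fModes P K ×ˢ fModes P K,
      ‖F K b x‖ ≤ (g₁ b x + g₂ b x) * (8 * (B * B')) := by
    intro K b x hx
    rw [Finset.mem_product] at hx
    by_cases hi : momHom P.L x.1 - momHom P.L x.2 = γ b
    · have h1 : ∀ ρ ρ' r r' : Fin 2, ‖gUV P K x.1 ρ ρ' * (gUV P K x.2 r r' *
          (chainInd P.L x.1 x.2 b *
          (τ K (qlab (x.1, ρ') (x.2, r)) (fun i => b (Fin.castAdd m' i)) *
          τ' K (qlab (x.2, r') (x.1, ρ)) (fun i => b (Fin.natAdd m i)))))‖ ≤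
          G x.1 * (G x.2 * (B * B')) := by
        intro ρ ρ' r r'
        rw [norm_mul, norm_mul, norm_mul, norm_mul, norm_chainInd, if_pos hi, one_mul]
        have hA := hG0 x.1
        have hA' := hG0 x.2
        exact mul_le_mul (hGb K _ hx.1 _ _) (mul_le_mul (hGb K _ hx.2 _ _)
          (mul_le_mul (hb _ _ _) (hb' _ _ _) (norm_nonneg _) hB) (by positivity) hA')
          (by positivity) hA
      refine (norm_sum_le_of_le _ fun ρ _ => norm_sum_le_of_le _ fun ρ' _ =>
        norm_sum_le_of_le _ fun r _ => norm_sum_le_of_le _ fun r' _ => h1 ρ ρ' r r').trans ?_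
      simp only [Finset.sum_const, Finset.card_univ, Fintype.card_fin, nsmul_eq_mul]
      have e1 : g₁ b x = G x.1 ^ 2 := if_pos ⟨⟨inBZ_of_mem hx.1, inBZ_of_mem hx.2⟩, hi⟩
      have e2 : g₂ b x = G x.2 ^ 2 := if_pos ⟨⟨inBZ_of_mem hx.1, inBZ_of_mem hx.2⟩, hi⟩
      rw [e1, e2]
      push_cast
      have h3 : 0 ≤ (B * B') * (G x.1 - G x.2) ^ 2 := by positivity
      nlinarith [h3]
    · refine le_trans (le_of_eq ?_) (hpos b x)
      have h4 : chainInd P.L x.1 x.2 b = 0 := by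
        rw [← norm_eq_zero, norm_chainInd, if_neg hi]
      simp [hF, h4]
  refine ⟨fun K => loopKern P K (chainKern P K (τ K) (τ' K)), fun K => ?_, fun K q b => ?_,
    fun q b => ?_⟩
  · beta_reduce
    rw [hτ, hτ', matPoly_mul hv.ne', trace_matPoly hv.ne']
  · beta_reduce
    rw [hred, norm_mul, norm_inv, Complex.norm_real, Real.norm_of_nonneg hv.le]
    have h5 : ‖∑ x ∈ fModes P K ×ˢ fModes P K, F K b x‖ ≤ 16 * c * (B * B') * vol P := by
      refine (norm_sum_le_of_le _ (hterm K b)).trans ?_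
      rw [← Finset.sum_mul, Finset.sum_add_distrib]
      have h6 := (h₁s b (fModes P K ×ˢ fModes P K)).trans hGt
      have h7 := (h₂s b (fModes P K ×ˢ fModes P K)).trans hGt
      have h8 : 0 ≤ 8 * (B * B') := by positivity
      nlinarith [mul_le_mul_of_nonneg_right (add_le_add h6 h7) h8]
    calc (vol P)⁻¹ * ‖_‖ ≤ (vol P)⁻¹ * (16 * c * (B * B') * vol P) := by gcongr
      _ = _ := by field_simp
  · simp only [hred]
    refine (Conv.const _).mul (conv_sum_of_dominated (hsum b) (hpos b) (fun K => hterm K b)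
      fun x => ?_)
    have h3 : Conv fun K => ∑ ρ : Fin 2, ∑ ρ' : Fin 2, ∑ r : Fin 2, ∑ r' : Fin 2,
      (if x.1 ∈ fModes P K then gUV P K x.1 ρ ρ' else 0) *
        ((if x.2 ∈ fModes P K then gUV P K x.2 r r' else 0) * (chainInd P.L x.1 x.2 b *
        (τ K (qlab (x.1, ρ') (x.2, r)) (fun i => b (Fin.castAdd m' i)) *
          τ' K (qlab (x.2, r') (x.1, ρ)) (fun i => b (Fin.natAdd m i))))) :=
      Conv.sum _ fun ρ _ => Conv.sum _ fun ρ' _ => Conv.sum _ fun r _ => Conv.sum _ fun r' _ =>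
        (hU.fermion_lim _ _ _).mul ((hU.fermion_lim _ _ _).mul
          ((Conv.const _).mul ((hc _ _).mul (hc' _ _))))
    convert h3 using 2 with K
    simp only [Finset.mem_product]
    by_cases h1 : x.1 ∈ fModes P K <;> by_cases h2 : x.2 ∈ fModes P K <;> simp [h1, h2, hF]

end MRep

/-! ### The bare vertices -/

section Bare

variable (P : Params)

/-- The kernel of the interaction with `m` photons. -/
def bareKern (m : ℕ) : Kern 1 m := fun q b =>
  bareKernel P m (fun j => (q j).1) (fun i => (b i).1) (fun j => (q j).2) (fun i => (b i).2)

theorem toKernel_bareKern (m : ℕ) : (bareKern P m).toKernel = bareKernel P m := rfl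

theorem norm_exp_I_mul (x : ℝ) : ‖Complex.exp (Complex.I * (x : ℂ))‖ = 1 := by
  rw [mul_comm, Complex.norm_exp_ofReal_mul_I]

theorem norm_exp_neg_I_mul (x : ℝ) : ‖Complex.exp (-Complex.I * (x : ℂ))‖ = 1 := by
  have := norm_exp_I_mul (-x)
  rwa [Complex.ofReal_neg, mul_neg, ← neg_mul] at this

theorem norm_eta_le (j : Fin 3) (v : Fin 2 → ℝ) : ‖eta j v‖ ≤ 1 := by
  have := intervalIntegral.norm_integral_le_of_norm_le_const (a := (0 : ℝ)) (b := 1) (C := 1)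
    (f := fun s : ℝ => Complex.exp (-Complex.I * ((s * (v ⬝ᵥ nn j) : ℝ) : ℂ)))
    fun s _ => (norm_exp_neg_I_mul _).le
  simpa [eta] using this

theorem abs_nnComp_le (j μ : Fin 3) : |nnComp j μ| ≤ 1 := by
  have h3 : √3 ≤ 2 := by rw [Real.sqrt_le_left (by norm_num)]; norm_num
  have h0 := Real.sqrt_nonneg 3
  rw [abs_le]
  fin_cases j <;> fin_cases μ <;> simp [nnComp, nn] <;> constructor <;> linarith

theorem norm_prod_eta_le {m : ℕ} (j : Fin 3) (v : Fin m → Fin 2 → ℝ) (μ : Fin m → Fin 3) :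
    ‖∏ i, (eta j (v i) * (nnComp j (μ i) : ℂ))‖ ≤ 1 := by
  rw [norm_prod]
  refine Finset.prod_le_one (fun i _ => norm_nonneg _) fun i _ => ?_
  rw [norm_mul, Complex.norm_real]
  exact mul_le_one₀ (norm_eta_le _ _) (norm_nonneg _) (abs_nnComp_le _ _)

theorem norm_hopping_le {m : ℕ} (z : ℂ) (hz : ‖z‖ = 1) (e : Fin 3 → ℂ) (he : ∀ j, ‖e j‖ = 1)
    (v : Fin m → Fin 2 → ℝ) (μ : Fin m → Fin 3) :
    ‖(P.t : ℂ) * (z ^ m / (m.factorial : ℂ)) *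
      ∑ j : Fin 3, e j * ∏ i, (eta j (v i) * (nnComp j (μ i) : ℂ))‖ ≤ 3 * |P.t| := by
  have h1 : ‖∑ j : Fin 3, e j * ∏ i, (eta j (v i) * (nnComp j (μ i) : ℂ))‖ ≤ 3 := by
    refine (norm_sum_le_of_le (n := fun _ => (1 : ℝ)) _ fun j _ => ?_).trans (le_of_eq ?_)
    · rw [norm_mul, he, one_mul]; exact norm_prod_eta_le _ _ _
    · simp
  have h2 : ‖z ^ m / (m.factorial : ℂ)‖ ≤ 1 := by
    rw [norm_div, norm_pow, hz, one_pow, Complex.norm_natCast]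
    exact div_le_one_of_le₀ (by exact_mod_cast m.factorial_pos) (by positivity)
  rw [norm_mul, norm_mul, Complex.norm_real, Real.norm_eq_abs]
  calc |P.t| * ‖z ^ m / (m.factorial : ℂ)‖ * ‖_‖ ≤ |P.t| * 1 * 3 := by gcongr
    _ = _ := by ring

theorem norm_bareKern_le {m : ℕ} (q : Fin 1 → QLabel) (b : Fin m → BLabel) :
    ‖bareKern P m q b‖ ≤ 3 * |P.t| + 1 := by
  have ht := abs_nonneg P.t
  unfold bareKern bareKernel
  have hprod : ∀ f : Fin m → ℂ, (∀ i, ‖f i‖ ≤ 1) → ‖-Complex.I * ∏ i, f i‖ ≤ 3 * |P.t| + 1 := by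
    intro f hf
    rw [norm_mul, norm_neg, Complex.norm_I, one_mul, norm_prod]
    exact (Finset.prod_le_one (fun i _ => norm_nonneg _) fun i _ => hf i).trans (by linarith)
  by_cases h1 : (q 0).1.1 = 0 ∧ (q 0).1.2 = 1
  · rw [if_pos h1]
    exact (norm_hopping_le P _ Complex.norm_I _ (fun j => norm_exp_neg_I_mul _) _ _).trans
      (by linarith)
  rw [if_neg h1]
  by_cases h2 : (q 0).1.1 = 1 ∧ (q 0).1.2 = 0
  · rw [if_pos h2]
    exact (norm_hopping_le P _ (by simp) _ (fun j => norm_exp_I_mul _) _ _).trans (by linarith)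
  rw [if_neg h2]
  by_cases h3 : m = 1
  · rw [if_pos h3]
    refine hprod _ fun i => ?_
    split_ifs
    · simp
    · exact (norm_exp_neg_I_mul _).le
    · simp
  · rw [if_neg h3, norm_zero]; positivity

/-- The diagonal vertex is the density coupling: it depends on the photon momentum only. -/
theorem bareKern_diag {m : ℕ} (ρ : Fin 2) (k k' : Mom) (b : Fin m → BLabel) :
    bareKern P m (qlab (k, ρ) (k, ρ)) b = bareKern P m (qlab (k', ρ) (k', ρ)) b := by
  unfold bareKern bareKernel qlab
  fin_cases ρ <;> simp

variable (K : ℕ)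

/-- The matrix of the interaction of order `N`. -/
def bareMat (N : ℕ) : Matrix (FIdx P K) (FIdx P K) Bose :=
  if N = 0 then 0 else matPoly P K (bareKern P N)

theorem coeff_interaction (N : ℕ) :
    PowerSeries.coeff N (interaction P K) = quad (bareMat P K N) := by
  rw [interaction, PowerSeries.coeff_mk, bareMat]
  split_ifs with h
  · exact quad_zero.symm
  · rw [quad_matPoly, ← fieldPoly_toKernel, toKernel_bareKern]

end Bare

/-! ### Bounds after the integration of the fermions -/

section Fermions

variable {P : Params} {c : ℝ}

theorem Rep.of_eq {n m : ℕ} {B : ℝ} {X Y : ℕ → Fields} (h : Rep P n m B X)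
    (hX : ∀ K, Y K = X K) : Rep P n m B Y := by
  rwa [show Y = X from funext hX]

variable (P) in
/-- A bound on the bare vertices of order `N`. -/
def bareBound (N : ℕ) : ℝ := if N = 0 then 0 else 3 * |P.t| + 1

variable (P) in
/-- The growth rate of chains of vertices. -/
def chainRate (c : ℝ) : ℝ := 1 + 4 * c * (3 * |P.t| + 1)

theorem bareMat_rep (N : ℕ) : MRep P N (bareBound P N) fun K => bareMat P K N := by
  unfold bareBound bareMat
  split_ifs with h
  · exact MRep.zero P N
  · exact ⟨fun _ => bareKern P N, fun _ => rfl, fun _ q b => norm_bareKern_le P q b,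
      fun _ _ => Conv.const _⟩

/-- The rate D = `chainRate P c` satisfies D - 1 = 4c(3|t| + 1), so the left side is a telescoping
geometric sum. Prepending a vertex thus reproduces the same bound. -/
theorem sum_bareBound_le (hc : 0 ≤ c) (N : ℕ) :
    ∑ p ∈ antidiagonal N, 4 * c * (bareBound P p.1 * ((3 * |P.t| + 1) * chainRate P c ^ p.2)) ≤
      (3 * |P.t| + 1) * chainRate P c ^ N := by
  set r := 3 * |P.t| + 1 with hr
  have hr0 : 0 < r := by positivity
  set D := chainRate P c with hD
  have hD1 : D - 1 = 4 * c * r := by rw [hD, chainRate]; ring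
  have hD0 : 0 ≤ D := by rw [hD, chainRate]; positivity
  cases N with
  | zero => simp [bareBound]; positivity
  | succ N =>
    rw [Finset.Nat.sum_antidiagonal_succ]
    simp only [bareBound, if_true, Nat.add_eq_zero_iff, one_ne_zero, and_false, if_false, zero_mul,
      mul_zero, zero_add]
    rw [Finset.Nat.sum_antidiagonal_eq_sum_range_succ (fun _ k => 4 * c * (r * (r * D ^ k)))]
    have h5 := Finset.sum_range_reflect (fun k => 4 * c * (r * (r * D ^ k))) (N + 1)
    simp only [add_tsub_cancel_right] at h5
    rw [Nat.succ_eq_add_one, h5]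
    rw [show (fun k => 4 * c * (r * (r * D ^ k))) = fun k => r * ((D - 1) * D ^ k) by
      funext k; rw [hD1]; ring, ← Finset.mul_sum, ← Finset.mul_sum, mul_geom_sum]
    have : 0 ≤ D ^ (N + 1) := by positivity
    nlinarith

/-- The bound does not depend on the number j of propagators: the sum over the order of the first
vertex closes the induction. -/
theorem chainMat_rep (hU : UVBounds P c) (j N : ℕ) :
    MRep P N ((3 * |P.t| + 1) * chainRate P c ^ N) fun K => chainMat P K (bareMat P K) j N := by
  have hc := hU.pos
  have hD : 1 ≤ chainRate P c := by
    rw [chainRate]; have : 0 ≤ 4 * c * (3 * |P.t| + 1) := by positivity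
    linarith
  induction j generalizing N with
  | zero =>
    refine (bareMat_rep N).mono ?_
    have h1 : 1 ≤ chainRate P c ^ N := one_le_pow₀ hD
    have h2 : 0 < 3 * |P.t| + 1 := by positivity
    unfold bareBound
    split_ifs <;> nlinarith
  | succ j ih =>
    refine MRep.mono ?_ (sum_bareBound_le (P := P) hc.le N)
    refine MRep.sum _ fun p hp => ?_
    rw [Finset.HasAntidiagonal.mem_antidiagonal] at hp
    rw [← hp]
    exact (bareMat_rep p.1).chain hU (ih p.2)

variable (P) in
/-- A bound on the loops of vertices. -/
def loopBound (c : ℝ) : ℝ := 4 * c ^ 2 * (3 * |P.t| + 1) + 8 * (3 * |P.t| + 1)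

/-- j = 0 is the tadpole. For j ≥ 1 the first vertex is split off from the chain, so that the loop
has at least two propagators. -/
theorem loop_rep (hU : UVBounds P c) (j N : ℕ) :
    Rep P 0 N (loopBound P c * chainRate P c ^ N) fun K =>
      (-2 / ((j : ℂ) + 1)) • ((covB P K * chainMat P K (bareMat P K) j N).trace ⊗ₜ[ℂ]
        (1 : Grass)) := by
  have hc := hU.pos
  have hr0 : 0 < 3 * |P.t| + 1 := by positivity
  have hD : 1 ≤ chainRate P c := by
    rw [chainRate]; have : 0 ≤ 4 * c * (3 * |P.t| + 1) := by positivity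
    linarith
  have hDN : 1 ≤ chainRate P c ^ N := one_le_pow₀ hD
  have h2 : ‖-2 / ((j : ℂ) + 1)‖ ≤ 2 := by
    have e : ((j : ℂ) + 1) = ((j + 1 : ℕ) : ℂ) := by push_cast; rfl
    rw [norm_div, norm_neg, e, Complex.norm_natCast, Complex.norm_ofNat]
    exact div_le_self (by norm_num) (by norm_cast; omega)
  have key : Rep P 0 N (2 * c ^ 2 * (3 * |P.t| + 1) + 4 * ((3 * |P.t| + 1) * chainRate P c ^ N))
      fun K => (covB P K * chainMat P K (bareMat P K) j N).trace ⊗ₜ[ℂ] (1 : Grass) := by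
    cases j with
    | zero =>
      by_cases hN : N = 0
      · refine ((Rep.zero P 0 N).of_eq fun K => ?_).mono (by positivity)
        rw [chainMat, bareMat, if_pos hN, Matrix.mul_zero, Matrix.trace_zero,
          TensorProduct.zero_tmul]
      · refine ((Rep.tadpole hU (τ := bareKern P N) (B := 3 * |P.t| + 1) hr0.le
          (norm_bareKern_le P) fun ρ k k' b => bareKern_diag P ρ k k' b).of_eq fun K => ?_).mono
          (le_add_of_nonneg_right (by positivity))
        rw [chainMat, bareMat, if_neg hN]
    | succ j =>
      have h := Rep.sum (P := P) (n := 0) (m := N) (antidiagonal N)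
        (B := fun p => 16 * c * (bareBound P p.1 * ((3 * |P.t| + 1) * chainRate P c ^ p.2)))
        (X := fun p K => (covB P K * (bareMat P K p.1 * covB P K *
          chainMat P K (bareMat P K) j p.2)).trace ⊗ₜ[ℂ] (1 : Grass)) (fun p hp => by
            rw [Finset.HasAntidiagonal.mem_antidiagonal] at hp
            subst hp
            exact (bareMat_rep p.1).loop hU (chainMat_rep hU j p.2))
      refine (h.of_eq fun K => ?_).mono ?_
      · rw [chainMat, Matrix.mul_sum, Matrix.trace_sum, TensorProduct.sum_tmul]
      · have h3 := sum_bareBound_le (P := P) hc.le N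
        have h4 : ∑ p ∈ antidiagonal N,
            16 * c * (bareBound P p.1 * ((3 * |P.t| + 1) * chainRate P c ^ p.2)) =
            4 * ∑ p ∈ antidiagonal N,
            4 * c * (bareBound P p.1 * ((3 * |P.t| + 1) * chainRate P c ^ p.2)) := by
          rw [Finset.mul_sum]
          exact Finset.sum_congr rfl fun p _ => by ring
        rw [h4]
        have : 0 ≤ 2 * c ^ 2 * (3 * |P.t| + 1) := by positivity
        linarith
  refine (key.smul _).mono ((mul_le_mul_of_nonneg_right h2 key.nonneg).trans ?_)
  rw [loopBound]
  have : 0 ≤ 4 * c ^ 2 * (3 * |P.t| + 1) := by positivity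
  nlinarith

variable (P) in
/-- The exponential growth rate of the kernels after the integration of the fermions. -/
def fermiRate (c : ℝ) : ℝ := 2 * (loopBound P c + 1) * chainRate P c

variable (P) in
/-- The terms of order `N` after the integration of the fermions. -/
def fermiElem (K N : ℕ) : evenPart :=
  ∑ j ∈ Finset.range (N + 1), chainFlow P K (bareMat P K) N j

theorem fermiElem_zero (K : ℕ) : fermiElem P K 0 = 0 := by
  rw [fermiElem, zero_add, Finset.sum_range_one, chainFlow, bareMat, if_pos rfl]
  exact Subtype.ext quad_zero

/-- Every power of e carries exactly one photon leg, so order N means N photons. At most one fermion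
pair remains: `X` collects the chains, `Y` the loops. -/
theorem fermiElem_rep (hU : UVBounds P c) {N : ℕ} (hN : 1 ≤ N) :
    ∃ X Y : ℕ → Fields, Rep P 1 N (fermiRate P c ^ N) X ∧ Rep P 0 N (fermiRate P c ^ N) Y ∧
      ∀ K, (fermiElem P K N : Fields) = X K + Y K := by
  have hc := hU.pos
  have hr0 : 0 < 3 * |P.t| + 1 := by positivity
  have hD : 1 ≤ chainRate P c := by
    rw [chainRate]; have : 0 ≤ 4 * c * (3 * |P.t| + 1) := by positivity
    linarith
  have hL : 0 ≤ loopBound P c := by rw [loopBound]; positivity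
  -- The number of values of j is absorbed by N + 1 ≤ 2^N, the origin of the 2 in `fermiRate`.
  have hrate : ((N : ℝ) + 1) * ((loopBound P c + 1) * chainRate P c ^ N) ≤ fermiRate P c ^ N := by
    rw [fermiRate, mul_pow, mul_pow]
    have h1 : (N : ℝ) + 1 ≤ 2 ^ N := by exact_mod_cast Nat.lt_two_pow_self
    have h2 : loopBound P c + 1 ≤ (loopBound P c + 1) ^ N :=
      le_self_pow₀ (by linarith) (by omega)
    have h3 : 0 ≤ chainRate P c ^ N := by positivity
    rw [← mul_assoc]
    gcongr
  refine ⟨fun K => ∑ j ∈ Finset.range (N + 1), quad (chainMat P K (bareMat P K) j N),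
    fun K => ∑ j ∈ Finset.range N, (-2 / ((j : ℂ) + 1)) •
      ((covB P K * chainMat P K (bareMat P K) j N).trace ⊗ₜ[ℂ] (1 : Grass)),
    (Rep.sum _ fun j _ => (chainMat_rep hU j N).quad).mono ?_,
    (Rep.sum _ fun j _ => loop_rep hU j N).mono ?_, fun K => ?_⟩
  · rw [Finset.sum_const, Finset.card_range, nsmul_eq_mul]
    refine le_trans ?_ hrate
    push_cast
    gcongr
    rw [loopBound]
    nlinarith [sq_nonneg c]
  · rw [Finset.sum_const, Finset.card_range, nsmul_eq_mul]
    refine le_trans ?_ hrate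
    gcongr <;> linarith
  · beta_reduce
    rw [fermiElem, AddSubmonoidClass.coe_finsetSum, Finset.sum_range_succ' _ N]
    rw [Finset.sum_range_succ' _ N]
    simp only [chainFlow, Subalgebra.coe_add, Finset.sum_add_distrib]
    rw [add_right_comm]
    rfl

end Fermions

/-! ### The majorant of the photon integration -/

section Majorant

/-- By Vandermonde, C(2j, 2i) contains the term C(j, i)², which is at least C(j, i). -/
theorem choose_le_choose_two_mul (j i : ℕ) : j.choose i ≤ (2 * j).choose (2 * i) := by
  rw [two_mul, two_mul, Nat.add_choose_eq]
  have h : (i, i) ∈ antidiagonal (i + i) := by simp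
  refine le_trans ?_ (Finset.single_le_sum (f := fun x : ℕ × ℕ => j.choose x.1 * j.choose x.2)
    (fun _ _ => Nat.zero_le _) h)
  exact Nat.le_mul_self _

/-- Vandermonde's identity, keeping only even indices in the block of size 2j. -/
theorem sum_choose_mul_choose_le (j m r : ℕ) :
    ∑ i ∈ Finset.range (j + 1), (if 2 * i ≤ r then j.choose i * m.choose (r - 2 * i) else 0) ≤
      (m + 2 * j).choose r := by
  rw [add_comm m, Nat.add_choose_eq, ← Finset.sum_filter]
  calc ∑ i ∈ (Finset.range (j + 1)).filter fun i => 2 * i ≤ r, j.choose i * m.choose (r - 2 * i)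
      ≤ ∑ i ∈ (Finset.range (j + 1)).filter fun i => 2 * i ≤ r,
          (2 * j).choose (2 * i) * m.choose (r - 2 * i) :=
        Finset.sum_le_sum fun i _ => Nat.mul_le_mul_right _ (choose_le_choose_two_mul j i)
    _ = ∑ x ∈ ((Finset.range (j + 1)).filter fun i => 2 * i ≤ r).image
          (fun i => (2 * i, r - 2 * i)), (2 * j).choose x.1 * m.choose x.2 := by
        rw [Finset.sum_image]
        intro x _ y _ h
        have := congrArg Prod.fst h
        simp only at this
        omega
    _ ≤ _ := by
        refine Finset.sum_le_sum_of_subset fun x hx => ?_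
        simp only [Finset.mem_image, Finset.mem_filter] at hx
        obtain ⟨i, ⟨-, hi⟩, rfl⟩ := hx
        rw [Finset.HasAntidiagonal.mem_antidiagonal]
        simp only
        omega

/-- The majorant of the terms of order `N` with `j` photon contractions. -/
def maj (R γ : ℝ) (N j : ℕ) : ℝ :=
  R ^ N * γ ^ j * (N.factorial / ((N - 2 * j).factorial * j.factorial * (N : ℝ) ^ 2)) / 2

variable {R γ : ℝ}

theorem maj_nonneg (hR : 0 ≤ R) (hγ : 0 ≤ γ) (N j : ℕ) : 0 ≤ maj R γ N j := by
  unfold maj; positivity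

/-- The linear term of the flow is exact on the majorant: closing two of m + 2 legs turns (m+2)!
into m!, and j! into (j+1)! up to the factor j + 1. -/
theorem maj_lap (hγ : 0 < γ) (m j : ℕ) (c : ℝ) :
    3 / 2 * c * ((m + 1) * (m + 2)) * maj R γ (m + 2 + 2 * j) j =
      ((j : ℝ) + 1) * (3 / 2 * c / γ * maj R γ (m + 2 * (j + 1)) (j + 1)) := by
  unfold maj
  rw [show m + 2 * (j + 1) = m + 2 + 2 * j by ring, show m + 2 + 2 * j - 2 * (j + 1) = m by omega,
    show m + 2 + 2 * j - 2 * j = m + 2 by omega, Nat.factorial_succ (m + 1), Nat.factorial_succ m,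
    Nat.factorial_succ j, pow_succ γ]
  push_cast
  have h1 : (m.factorial : ℝ) ≠ 0 := by exact_mod_cast m.factorial_ne_zero
  have h2 : (j.factorial : ℝ) ≠ 0 := by exact_mod_cast j.factorial_ne_zero
  have h3 : (m : ℝ) + 2 + 2 * j ≠ 0 := by positivity
  field_simp
  ring

/-- The majorant of a term with one leg differentiated. -/
def majLeg (R γ : ℝ) (N j : ℕ) : ℝ := ((N - 2 * j : ℕ) : ℝ) * maj R γ N j

theorem majLeg_eq_zero {N j : ℕ} (h : N ≤ 2 * j) : majLeg R γ N j = 0 := by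
  simp [majLeg, Nat.sub_eq_zero_of_le h]

/-- Differentiating a leg removes one power of the weight: order a + 1 contributes a!/(a+1). The
other factorials combine into two binomials, up to the common m! j!. -/
theorem majLeg_mul {m j a e i i' : ℕ} (hi : i + i' = j) (hae : a + e = m + 2 * j) (ha : 2 * i ≤ a)
    (he : 2 * i' ≤ e) :
    majLeg R γ (a + 1) i * majLeg R γ (e + 1) i' =
      R ^ (a + e + 2) * γ ^ j / (4 * (m.factorial * j.factorial)) *
        ((a.factorial * e.factorial : ℝ) / ((a + 1) * (e + 1))) *
          (j.choose i * m.choose (a - 2 * i) : ℕ) := by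
  have hm : m = (a - 2 * i) + (e - 2 * i') := by omega
  have key : ∀ a i : ℕ, 2 * i ≤ a → majLeg R γ (a + 1) i =
      R ^ (a + 1) * γ ^ i * (a.factorial / ((a - 2 * i).factorial * i.factorial * (a + 1))) / 2 := by
    intro a i h
    unfold majLeg maj
    rw [show a + 1 - 2 * i = (a - 2 * i) + 1 by omega, Nat.factorial_succ, Nat.factorial_succ]
    push_cast
    field_simp
  rw [key a i ha, key e i' he]
  obtain ⟨x, rfl⟩ := Nat.exists_eq_add_of_le ha
  obtain ⟨y, rfl⟩ := Nat.exists_eq_add_of_le he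
  simp only [add_tsub_cancel_left] at hm ⊢
  subst hi hm
  rw [Nat.cast_mul, Nat.cast_add_choose, Nat.cast_add_choose]
  push_cast
  have h1 : ∀ n : ℕ, (n.factorial : ℝ) ≠ 0 := fun n => by exact_mod_cast n.factorial_ne_zero
  have := h1 x
  have := h1 y
  have := h1 i
  have := h1 i'
  have := h1 (x + y)
  have := h1 (i + i')
  field_simp
  ring

/-- There are n + 1 terms, and (a+1)(b+1) ≥ a + b + 1 = n + 1. -/
theorem sum_inv_mul_inv_le (n : ℕ) :
    ∑ p ∈ antidiagonal n, (1 : ℝ) / ((p.1 + 1) * (p.2 + 1)) ≤ 1 := by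
  have h : ∀ p ∈ antidiagonal n, (1 : ℝ) / ((p.1 + 1) * (p.2 + 1)) ≤ 1 / (n + 1) := by
    intro p hp
    rw [Finset.HasAntidiagonal.mem_antidiagonal] at hp
    rw [← hp]
    push_cast
    gcongr
    have : (0 : ℝ) ≤ p.1 * p.2 := by positivity
    nlinarith
  refine (Finset.sum_le_sum h).trans ?_
  rw [Finset.sum_const, Finset.Nat.card_antidiagonal, nsmul_eq_mul]
  push_cast
  rw [mul_one_div_cancel (by positivity)]

theorem sum_antidiagonal_add_two {M : Type*} [AddCommMonoid M] (n : ℕ) (f : ℕ → ℕ → M)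
    (h0 : ∀ k, f 0 k = 0) (h1 : ∀ k, f k 0 = 0) :
    ∑ p ∈ antidiagonal (n + 2), f p.1 p.2 = ∑ p ∈ antidiagonal n, f (p.1 + 1) (p.2 + 1) := by
  rw [Finset.Nat.sum_antidiagonal_succ, h0, zero_add, Finset.Nat.sum_antidiagonal_succ', h1,
    zero_add]

/-- Summing over the distribution of the contractions gives at most C(n, a), which turns a! b! into
n! for n = a + b. The weights 1/((a+1)(b+1)) then sum to at most 1, and the last comparison is 1 ≤
2(n+1)/(n+2). -/
theorem sum_majLeg_le (hR : 0 ≤ R) (hγ : 0 < γ) (m j : ℕ) :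
    ∑ p ∈ antidiagonal (m + 2 * (j + 1)), ∑ q ∈ antidiagonal j,
      majLeg R γ p.1 q.1 * majLeg R γ p.2 q.2 ≤
      ((j : ℝ) + 1) * (1 / γ * maj R γ (m + 2 * (j + 1)) (j + 1)) := by
  -- Factors of order zero have no leg to differentiate; removing them shifts both orders by one.
  rw [show m + 2 * (j + 1) = (m + 2 * j) + 2 by ring,
    sum_antidiagonal_add_two (m + 2 * j) (fun x y => ∑ q ∈ antidiagonal j,
      majLeg R γ x q.1 * majLeg R γ y q.2)
      (fun k => Finset.sum_eq_zero fun q _ => by rw [majLeg_eq_zero (Nat.zero_le _), zero_mul])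
      (fun k => Finset.sum_eq_zero fun q _ => by
        rw [majLeg_eq_zero (N := 0) (Nat.zero_le _), mul_zero])]
  set n := m + 2 * j with hn
  set A : ℝ := R ^ (n + 2) * γ ^ j / (4 * (m.factorial * j.factorial)) with hA
  have hA0 : 0 ≤ A := by positivity
  have h1 : ∀ p ∈ antidiagonal n, ∑ q ∈ antidiagonal j,
      majLeg R γ (p.1 + 1) q.1 * majLeg R γ (p.2 + 1) q.2 ≤
      A * n.factorial * (1 / ((p.1 + 1) * (p.2 + 1))) := by
    intro p hp
    rw [Finset.HasAntidiagonal.mem_antidiagonal] at hp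
    set B : ℝ := (p.1.factorial * p.2.factorial : ℝ) / ((p.1 + 1) * (p.2 + 1)) with hB
    have hB0 : 0 ≤ B := by positivity
    have h2 : ∀ q ∈ antidiagonal j, majLeg R γ (p.1 + 1) q.1 * majLeg R γ (p.2 + 1) q.2 ≤
        A * B * ((if 2 * q.1 ≤ p.1 then j.choose q.1 * m.choose (p.1 - 2 * q.1) else 0 : ℕ) : ℝ) := by
      intro q hq
      rw [Finset.HasAntidiagonal.mem_antidiagonal] at hq
      by_cases ha : 2 * q.1 ≤ p.1
      · by_cases he : 2 * q.2 ≤ p.2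
        · rw [majLeg_mul hq (hp.trans hn) ha he, if_pos ha, hp]
        · rw [majLeg_eq_zero (N := p.2 + 1) (by omega), mul_zero]; positivity
      · rw [majLeg_eq_zero (N := p.1 + 1) (by omega), zero_mul]; positivity
    refine (Finset.sum_le_sum h2).trans ?_
    rw [← Finset.mul_sum, Finset.Nat.sum_antidiagonal_eq_sum_range_succ
      (fun i _ => ((if 2 * i ≤ p.1 then j.choose i * m.choose (p.1 - 2 * i) else 0 : ℕ) : ℝ)),
      ← Nat.cast_sum]
    have h3 : ((∑ i ∈ Finset.range (j + 1),
        (if 2 * i ≤ p.1 then j.choose i * m.choose (p.1 - 2 * i) else 0) : ℕ) : ℝ) ≤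
        ((p.1 + p.2).choose p.1 : ℕ) := by
      rw [hp]
      exact_mod_cast sum_choose_mul_choose_le j m p.1
    refine (mul_le_mul_of_nonneg_left h3 (by positivity)).trans (le_of_eq ?_)
    rw [Nat.cast_add_choose, ← hp, hB]
    have h4 : ∀ n : ℕ, (n.factorial : ℝ) ≠ 0 := fun n => by exact_mod_cast n.factorial_ne_zero
    have := h4 p.1
    have := h4 p.2
    field_simp
  refine (Finset.sum_le_sum h1).trans ?_
  rw [← Finset.mul_sum]
  refine (mul_le_mul_of_nonneg_left (sum_inv_mul_inv_le n) (by positivity)).trans ?_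
  unfold maj
  rw [show n + 2 - 2 * (j + 1) = m by omega, Nat.factorial_succ (n + 1), Nat.factorial_succ n,
    Nat.factorial_succ j, pow_succ γ, hA]
  have h4 : ∀ n : ℕ, (0 : ℝ) < n.factorial := fun n => by exact_mod_cast n.factorial_pos
  have := h4 m
  have := h4 j
  have := h4 n
  have e : ((j : ℝ) + 1) * (1 / γ * (R ^ (n + 2) * (γ ^ j * γ) *
      ((((n + 1 + 1 : ℕ) * ((n + 1 : ℕ) * n.factorial : ℕ) : ℕ) : ℝ) /
        (m.factorial * ((j + 1 : ℕ) * j.factorial : ℕ) * ((n + 2 : ℕ) : ℝ) ^ 2)) / 2)) =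
      R ^ (n + 2) * γ ^ j / (4 * (m.factorial * j.factorial)) * n.factorial *
        (2 * (n + 1) / (n + 2)) := by
    push_cast
    field_simp
    ring
  rw [e]
  refine mul_le_mul_of_nonneg_left ?_ (by positivity)
  rw [le_div_iff₀ (by positivity)]
  have : (0 : ℝ) ≤ n := by positivity
  linarith

end Majorant

/-! ### Sums of field polynomials with a fixed number of photons -/

/-- Sequences of sums of field polynomials with at most `d` fermion pairs and `m` photons, the
sum of the bounds on the kernels being at most `b`. -/
def RepSum (P : Params) (d m : ℕ) (b : ℝ) (Y : ℕ → Fields) : Prop :=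
  ∃ (ι : Type) (_ : Fintype ι) (n : ι → ℕ) (B : ι → ℝ) (X : ι → ℕ → Fields),
    (∀ i, n i ≤ d) ∧ (∀ i, Rep P (n i) m (B i) (X i)) ∧ (∀ K, Y K = ∑ i, X i K) ∧ ∑ i, B i ≤ b

section RepSum

variable {P : Params} {d m : ℕ} {b b' : ℝ} {Y Y' : ℕ → Fields}

theorem Rep.repSum {n : ℕ} {B : ℝ} {X : ℕ → Fields} (h : Rep P n m B X) (hn : n ≤ d) :
    RepSum P d m B X :=
  ⟨Unit, inferInstance, fun _ => n, fun _ => B, fun _ => X, fun _ => hn, fun _ => h,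
    fun K => by simp, by simp⟩

theorem RepSum.mono (h : RepSum P d m b Y) (hb : b ≤ b') : RepSum P d m b' Y := by
  obtain ⟨ι, _, n, B, X, hn, hX, hY, hB⟩ := h
  exact ⟨ι, _, n, B, X, hn, hX, hY, hB.trans hb⟩

theorem RepSum.of_eq (h : RepSum P d m b Y) (hY : ∀ K, Y' K = Y K) : RepSum P d m b Y' := by
  rwa [show Y' = Y from funext hY]

theorem RepSum.zero (P : Params) (d m : ℕ) : RepSum P d m 0 fun _ => 0 :=
  (Rep.zero P 0 m).repSum (Nat.zero_le d)

theorem RepSum.add (h : RepSum P d m b Y) (h' : RepSum P d m b' Y') :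
    RepSum P d m (b + b') fun K => Y K + Y' K := by
  obtain ⟨ι, _, n, B, X, hn, hX, hY, hB⟩ := h
  obtain ⟨ι', _, n', B', X', hn', hX', hY', hB'⟩ := h'
  refine ⟨ι ⊕ ι', inferInstance, Sum.elim n n', Sum.elim B B', Sum.elim X X', ?_, ?_, fun K => ?_,
    ?_⟩
  · rintro (i | i)
    · exact hn i
    · exact hn' i
  · rintro (i | i)
    · exact hX i
    · exact hX' i
  · beta_reduce
    rw [hY, hY', Fintype.sum_sum_type]
    rfl
  · rw [Fintype.sum_sum_type]
    exact add_le_add hB hB'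

theorem RepSum.sum {ι : Type*} (s : Finset ι) {b : ι → ℝ} {Y : ι → ℕ → Fields}
    (h : ∀ i ∈ s, RepSum P d m (b i) (Y i)) :
    RepSum P d m (∑ i ∈ s, b i) fun K => ∑ i ∈ s, Y i K := by
  classical
  induction s using Finset.induction_on with
  | empty => simpa using RepSum.zero P d m
  | insert a s ha ih =>
    simp only [Finset.sum_insert ha]
    exact (h a (Finset.mem_insert_self a s)).add
      (ih fun i hi => h i (Finset.mem_insert_of_mem hi))

theorem RepSum.smul (h : RepSum P d m b Y) (a : ℂ) :
    RepSum P d m (‖a‖ * b) fun K => a • Y K := by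
  obtain ⟨ι, _, n, B, X, hn, hX, hY, hB⟩ := h
  refine ⟨ι, _, n, fun i => ‖a‖ * B i, fun i K => a • X i K, hn, fun i => (hX i).smul a,
    fun K => by beta_reduce; rw [hY, Finset.smul_sum], ?_⟩
  rw [← Finset.mul_sum]
  exact mul_le_mul_of_nonneg_left hB (norm_nonneg a)

theorem RepSum.nonneg (h : RepSum P d m b Y) : 0 ≤ b := by
  obtain ⟨ι, _, n, B, X, hn, hX, hY, hB⟩ := h
  exact (Finset.sum_nonneg fun i _ => (hX i).nonneg).trans hB

theorem RepSum.lapA {c : ℝ} (hU : UVBounds P c) (h : RepSum P d (m + 2) b Y) :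
    RepSum P d m (3 / 2 * c * ((m + 1) * (m + 2)) * b) fun K => lapA P K (Y K) := by
  have hc := hU.pos
  obtain ⟨ι, _, n, B, X, hn, hX, hY, hB⟩ := h
  refine ⟨ι, _, n, _, _, hn, fun i => (hX i).lapA hU, fun K => by beta_reduce; rw [hY, map_sum], ?_⟩
  rw [← Finset.mul_sum]
  exact mul_le_mul_of_nonneg_left hB (by positivity)

theorem RepSum.lapA_eq_zero {c : ℝ} (hU : UVBounds P c) (h : RepSum P d m b Y) (hm : m < 2)
    (K : ℕ) : Graphene.lapA P K (Y K) = 0 := by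
  obtain ⟨ι, _, n, B, X, hn, hX, hY, hB⟩ := h
  rw [hY, map_sum]
  refine Finset.sum_eq_zero fun i _ => ?_
  obtain ⟨w, hw, -⟩ := hX i
  rw [hw, lapA_gpoly_of_lt_two hm (hU.neg_mem K)]

theorem RepSum.bosD_eq_zero (h : RepSum P d 0 b Y) (K : ℕ) (x : BLabel) :
    bosD x (Y K) = 0 := by
  obtain ⟨ι, _, n, B, X, hn, hX, hY, hB⟩ := h
  rw [hY, map_sum]
  refine Finset.sum_eq_zero fun i _ => ?_
  obtain ⟨w, hw, -⟩ := hX i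
  rw [hw, gpoly, bosD_fpoly_zero]

theorem RepSum.contract {c : ℝ} (hU : UVBounds P c) {d' m' : ℕ} (h : RepSum P d (m + 1) b Y)
    (h' : RepSum P d' (m' + 1) b' Y') :
    RepSum P (d + d') (m + m') (27 / 2 * c * ((m + 1) * (m' + 1)) * (b * b')) fun K =>
      ∑ p ∈ bModes P K, ∑ μ : Fin 3,
        ((1 / 2 * (P.β * area P.L) * photonPropUV P K p : ℝ) : ℂ) •
          (bosD (μ, p) (Y K) * bosD (μ, -p) (Y' K)) := by
  have hc := hU.pos
  have hb' := h'.nonneg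
  obtain ⟨ι, _, n, B, X, hn, hX, hY, hB⟩ := h
  obtain ⟨ι', _, n', B', X', hn', hX', hY', hB'⟩ := h'
  refine ⟨ι × ι', inferInstance, fun i => n i.1 + n' i.2, _, _,
    fun i => add_le_add (hn i.1) (hn' i.2), fun i => (hX i.1).contract hU (hX' i.2), fun K => ?_, ?_⟩
  · rw [Finset.sum_comm]
    refine Finset.sum_congr rfl fun p _ => ?_
    rw [Finset.sum_comm]
    refine Finset.sum_congr rfl fun μ _ => ?_
    rw [hY, hY', map_sum, map_sum, Finset.sum_mul_sum, ← Finset.smul_sum, Fintype.sum_prod_type]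
  · rw [← Finset.mul_sum, Fintype.sum_prod_type, ← Finset.sum_mul_sum]
    refine mul_le_mul_of_nonneg_left (mul_le_mul hB hB'
      (Finset.sum_nonneg fun i _ => (hX' i).nonneg) ?_) (by positivity)
    exact (Finset.sum_nonneg fun i _ => (hX i).nonneg).trans hB

theorem sum_bosD_swap (K : ℕ) (x y : evenPart) :
    ∑ p ∈ bModes P K, ∑ μ : Fin 3,
      ((1 / 2 * (P.β * area P.L) * photonPropUV P K p : ℝ) : ℂ) •
        (bosD (μ, -p) (x : Fields) * bosD (μ, p) (y : Fields)) =
    ∑ p ∈ bModes P K, ∑ μ : Fin 3,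
      ((1 / 2 * (P.β * area P.L) * photonPropUV P K p : ℝ) : ℂ) •
        (bosD (μ, p) (y : Fields) * bosD (μ, -p) (x : Fields)) :=
  Finset.sum_congr rfl fun p _ => Finset.sum_congr rfl fun μ _ => by
    rw [even_comm (bosD_mem_evenPart _ x.2)]

/-- Γ for the photon Laplacian joins the polynomials in both orientations, which doubles the
constant of `contract`. -/
theorem RepSum.carre {c : ℝ} (hU : UVBounds P c) {d' m' D : ℕ} {x y : ℕ → evenPart}
    (h : RepSum P d (m + 1) b fun K => (x K : Fields))
    (h' : RepSum P d' (m' + 1) b' fun K => (y K : Fields)) (hD : d + d' = D) :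
    RepSum P D (m + m') (27 * c * ((m + 1) * (m' + 1)) * (b * b')) fun K =>
      ((Graphene.carre (lapAE P K) (x K) (y K) : evenPart) : Fields) := by
  subst hD
  have h1 := h.contract hU h'
  have h2 := h'.contract hU h
  rw [add_comm d' d, add_comm m' m] at h2
  refine ((h1.add h2).of_eq fun K => ?_).mono (le_of_eq (by ring))
  rw [coe_carre_lapAE]
  simp only [smul_add, Finset.sum_add_distrib]
  rw [sum_bosD_swap]

theorem RepSum.carre_eq_zero {x : ℕ → evenPart} (h : RepSum P d 0 b fun K => (x K : Fields))
    (K : ℕ) (y : evenPart) : Graphene.carre (lapAE P K) (x K) y = 0 := by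
  apply Subtype.ext
  rw [coe_carre_lapAE]
  refine Finset.sum_eq_zero fun p _ => Finset.sum_eq_zero fun μ _ => ?_
  rw [h.bosD_eq_zero, h.bosD_eq_zero, zero_mul, zero_mul, add_zero, smul_zero]

/-- Collection of the terms with `n` fermion pairs. -/
theorem RepSum.exists_rep (h : RepSum P d m b Y) :
    ∃ X : ℕ → ℕ → Fields, (∀ n, Rep P n m b (X n)) ∧
      ∀ K, Y K = ∑ n ∈ Finset.range (d + 1), X n K := by
  have hb := h.nonneg
  obtain ⟨ι, _, n, B, X, hn, hX, hY, hB⟩ := h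
  refine ⟨fun k K => ∑ i with n i = k, X i K, fun k => ?_, fun K => ?_⟩
  · refine (Rep.sum (Finset.univ.filter fun i => n i = k) fun i hi => ?_).mono
      ((Finset.sum_le_sum_of_subset_of_nonneg (Finset.filter_subset _ _)
        fun i _ _ => (hX i).nonneg).trans hB)
    have h1 := hX i
    rwa [(Finset.mem_filter.mp hi).2] at h1
  · rw [hY]
    symm
    exact Finset.sum_fiberwise_of_maps_to
      (fun i _ => Finset.mem_range.mpr (Nat.lt_succ_of_le (hn i))) _

end RepSum

/-! ### Integration of the photons -/

section Flow

variable (P : Params) (K : ℕ)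

/-- The terms of order `N` with `j` photon contractions, starting from `v`. -/
def photonFlow (v : ℕ → evenPart) (N : ℕ) : ℕ → evenPart
  | 0 => v N
  | j + 1 => ((j : ℂ) + 1)⁻¹ • (lapAE P K (photonFlow v N j) + (1 / 2 : ℂ) •
      ∑ p ∈ antidiagonal N, ∑ i : Fin (j + 1),
        carre (lapAE P K) (photonFlow v p.1 i) (photonFlow v p.2 (j - i)))
  termination_by j => j
  decreasing_by all_goals omega

theorem photonFlow_zero (v : ℕ → evenPart) (N : ℕ) : photonFlow P K v N 0 = v N := by
  rw [photonFlow]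

/-- The definition sums over `Fin (j + 1)` only to make the recursion visibly well founded; the
antidiagonal form is the flow equation. -/
theorem photonFlow_succ (v : ℕ → evenPart) (N j : ℕ) :
    photonFlow P K v N (j + 1) = ((j : ℂ) + 1)⁻¹ • (lapAE P K (photonFlow P K v N j) +
      (1 / 2 : ℂ) • ∑ p ∈ antidiagonal N, ∑ q ∈ antidiagonal j,
        carre (lapAE P K) (photonFlow P K v p.1 q.1) (photonFlow P K v p.2 q.2)) := by
  rw [photonFlow]
  congr 3
  refine Finset.sum_congr rfl fun p _ => ?_
  rw [Finset.Nat.sum_antidiagonal_eq_sum_range_succ (fun i i' =>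
    carre (lapAE P K) (photonFlow P K v p.1 i) (photonFlow P K v p.2 i')), Finset.sum_range]

theorem photonFlow_order_zero (v : ℕ → evenPart) (hv : v 0 = 0) (j : ℕ) :
    photonFlow P K v 0 j = 0 := by
  induction j using Nat.strong_induction_on with
  | _ j ih =>
    cases j with
    | zero => rw [photonFlow_zero, hv]
    | succ j =>
      rw [photonFlow_succ, ih j (Nat.lt_succ_self j), map_zero, zero_add]
      refine (congrArg _ (congrArg _ (Finset.sum_eq_zero fun p hp => Finset.sum_eq_zero
        fun q hq => ?_))).trans (by rw [smul_zero, smul_zero])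
      rw [Finset.HasAntidiagonal.mem_antidiagonal] at hp hq
      beta_reduce
      rw [show p.1 = 0 by omega, ih q.1 (by omega), carre_zero_left]

end Flow

section FlowBounds

variable {P : Params} {c R : ℝ} {v : ℕ → ℕ → evenPart}

/-- The flow of the photon integration is bounded by the majorant. -/
theorem photonFlow_rep (hU : UVBounds P c) (hR : 0 ≤ R) (hv0 : ∀ K, v K 0 = 0)
    (hv : ∀ N, 1 ≤ N → RepSum P N N (maj R (15 * c) N 0) fun K => (v K N : Fields)) (j : ℕ) :
    (∀ N m, 1 ≤ N → N = m + 2 * j → RepSum P N m (maj R (15 * c) N j) fun K =>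
      (photonFlow P K (v K) N j : Fields)) ∧
    ∀ N, N < 2 * j → ∀ K, photonFlow P K (v K) N j = 0 := by
  have hc := hU.pos
  -- The constant 15 is chosen so that the induction closes exactly: the linear and quadratic terms
  -- contribute (3/2)/15 and (27/2)/15, that is 1/10 + 9/10 = 1.
  have hγ : 0 < 15 * c := by positivity
  induction j using Nat.strong_induction_on with
  | _ j ih =>
  cases j with
  | zero =>
    refine ⟨fun N m hN hm => ?_, fun N h => absurd h (Nat.not_lt_zero N)⟩
    rw [Nat.mul_zero, Nat.add_zero] at hm
    subst hm
    exact (hv N hN).of_eq fun K => by rw [photonFlow_zero]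
  | succ j =>
    have hj : (j : ℂ) + 1 ≠ 0 := by exact_mod_cast Nat.succ_ne_zero j
    refine ⟨fun N m hN hm => ?_, fun N h K => ?_⟩
    · have h1 : RepSum P N m (((j : ℝ) + 1) * (3 / 2 * c / (15 * c) * maj R (15 * c) N (j + 1)))
          fun K => (lapAE P K (photonFlow P K (v K) N j) : Fields) := by
        have h2 := ((ih j (Nat.lt_succ_self j)).1 N (m + 2) hN (by omega)).lapA hU
        refine (h2.of_eq fun K => by rw [coe_lapAE]).mono (le_of_eq ?_)
        have h3 := maj_lap (R := R) hγ m j c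
        rw [show m + 2 + 2 * j = N by omega, ← hm] at h3
        exact h3
      have h4 : RepSum P N m (27 * c * (((j : ℝ) + 1) *
          (1 / (15 * c) * maj R (15 * c) N (j + 1)))) fun K =>
          ∑ p ∈ antidiagonal N, ∑ q ∈ antidiagonal j,
            ((carre (lapAE P K) (photonFlow P K (v K) p.1 q.1)
              (photonFlow P K (v K) p.2 q.2) : evenPart) : Fields) := by
        have h5 := sum_majLeg_le (R := R) hR hγ m j
        rw [← hm] at h5
        refine RepSum.mono ?_ (mul_le_mul_of_nonneg_left h5 (by positivity : 0 ≤ 27 * c))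
        rw [Finset.mul_sum]
        refine RepSum.sum _ fun p hp => ?_
        rw [Finset.mul_sum]
        refine RepSum.sum _ fun q hq => ?_
        rw [Finset.HasAntidiagonal.mem_antidiagonal] at hp hq
        have i1 := ih q.1 (by omega)
        have i2 := ih q.2 (by omega)
        have hz : 0 ≤ 27 * c * (majLeg R (15 * c) p.1 q.1 * majLeg R (15 * c) p.2 q.2) := by
          have := maj_nonneg hR hγ.le p.1 q.1
          have := maj_nonneg hR hγ.le p.2 q.2
          unfold majLeg
          positivity
        have hz' := (RepSum.zero P N m).mono hz
        -- Γ needs a photon leg on each side: a factor whose order is below twice its contractions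
        -- is zero, and one with equality has no leg left.
        rcases lt_trichotomy p.1 (2 * q.1) with h6 | h6 | h6
        · exact hz'.of_eq fun K => by rw [i1.2 p.1 h6 K, carre_zero_left]; rfl
        · refine hz'.of_eq fun K => ?_
          rcases Nat.eq_zero_or_pos p.1 with h7 | h7
          · rw [h7, photonFlow_order_zero P K _ (hv0 K), carre_zero_left]; rfl
          · rw [(i1.1 p.1 0 h7 (by omega)).carre_eq_zero K]; rfl
        rcases lt_trichotomy p.2 (2 * q.2) with h8 | h8 | h8
        · exact hz'.of_eq fun K => by rw [i2.2 p.2 h8 K, carre_zero_right]; rfl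
        · refine hz'.of_eq fun K => ?_
          rcases Nat.eq_zero_or_pos p.2 with h7 | h7
          · rw [h7, photonFlow_order_zero P K _ (hv0 K), carre_zero_right]; rfl
          · rw [carre_comm, (i2.1 p.2 0 h7 (by omega)).carre_eq_zero K]; rfl
        have h9 := (i1.1 p.1 (p.1 - 2 * q.1 - 1 + 1) (by omega) (by omega)).carre hU
          (i2.1 p.2 (p.2 - 2 * q.2 - 1 + 1) (by omega) (by omega)) hp
        rw [show p.1 - 2 * q.1 - 1 + (p.2 - 2 * q.2 - 1) = m by omega] at h9
        refine h9.mono (le_of_eq ?_)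
        unfold majLeg
        have e : ∀ a i : ℕ, 2 * i < a →
            (((a - 2 * i - 1 : ℕ) : ℝ) + 1) = ((a - 2 * i : ℕ) : ℝ) := by
          intro a i h
          have : a - 2 * i = (a - 2 * i - 1) + 1 := by omega
          rw [this]
          push_cast
          simp
        rw [e _ _ h6, e _ _ h8]
        ring
      have h10 := (h1.add (h4.smul (1 / 2))).smul (((j : ℂ) + 1)⁻¹)
      refine (h10.of_eq fun K => ?_).mono ?_
      · rw [photonFlow_succ]
        simp only [Subalgebra.coe_smul, Subalgebra.coe_add, AddSubmonoidClass.coe_finsetSum]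
      · have e1 : ‖((j : ℂ) + 1)⁻¹‖ = ((j : ℝ) + 1)⁻¹ := by
          rw [norm_inv, show ((j : ℂ) + 1) = ((j + 1 : ℕ) : ℂ) by push_cast; rfl,
            Complex.norm_natCast]
          push_cast
          rfl
        have e2 : ‖(1 / 2 : ℂ)‖ = 1 / 2 := by simp
        rw [e1, e2]
        apply le_of_eq
        field_simp
        ring
    -- With N < 2(j+1) there are not enough legs for another contraction: every term of the
    -- recursion vanishes.
    · have i0 := ih j (Nat.lt_succ_self j)
      rw [photonFlow_succ]
      have h1 : lapAE P K (photonFlow P K (v K) N j) = 0 := by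
        rcases Nat.eq_zero_or_pos N with h7 | h7
        · rw [h7, photonFlow_order_zero P K _ (hv0 K), map_zero]
        rcases Nat.lt_or_ge N (2 * j) with h8 | h8
        · rw [i0.2 N h8 K, map_zero]
        · apply Subtype.ext
          rw [coe_lapAE, (i0.1 N (N - 2 * j) h7 (by omega)).lapA_eq_zero hU (by omega)]
          rfl
      rw [h1, zero_add]
      refine (congrArg _ (congrArg _ (Finset.sum_eq_zero fun p hp => Finset.sum_eq_zero
        fun q hq => ?_))).trans (by rw [smul_zero, smul_zero])
      rw [Finset.HasAntidiagonal.mem_antidiagonal] at hp hq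
      beta_reduce
      have i1 := ih q.1 (by omega)
      have i2 := ih q.2 (by omega)
      rcases lt_trichotomy p.1 (2 * q.1) with h6 | h6 | h6
      · rw [i1.2 p.1 h6 K, carre_zero_left]
      · rcases Nat.eq_zero_or_pos p.1 with h7 | h7
        · rw [h7, photonFlow_order_zero P K _ (hv0 K), carre_zero_left]
        · rw [(i1.1 p.1 0 h7 (by omega)).carre_eq_zero K]
      rcases lt_trichotomy p.2 (2 * q.2) with h8 | h8 | h8
      · rw [i2.2 p.2 h8 K, carre_zero_right]
      · rcases Nat.eq_zero_or_pos p.2 with h7 | h7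
        · rw [h7, photonFlow_order_zero P K _ (hv0 K), carre_zero_right]
        · rw [carre_comm, (i2.1 p.2 0 h7 (by omega)).carre_eq_zero K]
      · omega

end FlowBounds

/-! ### The effective action -/

section Action

variable {P : Params} (K : ℕ)

theorem chainFlow_order_zero {M : ℕ → Matrix (FIdx P K) (FIdx P K) Bose} (hM : M 0 = 0) (j : ℕ) :
    chainFlow P K M 0 j = 0 := by
  cases j with
  | zero => rw [chainFlow, hM]; exact Subtype.ext quad_zero
  | succ j =>
    rw [chainFlow, chainMat_eq_zero hM (Nat.zero_le _), chainMat_eq_zero hM (Nat.zero_le _)]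
    apply Subtype.ext
    simp [quadElem, bosElem, quad_zero]

theorem chainFlow_of_lt {M : ℕ → Matrix (FIdx P K) (FIdx P K) Bose} (hM : M 0 = 0) {N j : ℕ}
    (h : N < j) : chainFlow P K M N j = 0 := by
  cases j with
  | zero => omega
  | succ j =>
    rw [chainFlow, chainMat_eq_zero hM h.le, chainMat_eq_zero hM (Nat.lt_succ_iff.mp h)]
    apply Subtype.ext
    simp [quadElem, bosElem, quad_zero]

theorem coe_expSum {f : evenPart →ₗ[ℂ] evenPart} {g : Fields →ₗ[ℂ] Fields}
    (hfg : ∀ s x, (((f ^ s) x : evenPart) : Fields) = (g ^ s) x) {x : evenPart} {I : ℕ}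
    (h : ∀ i, I ≤ i → (f ^ i) x = 0) : ((expSum f x : evenPart) : Fields) = expSum g x := by
  rw [expSum_eq_sum f x I h, expSum_eq_sum g x I fun i hi => by rw [← hfg, h i hi]; rfl,
    AddSubmonoidClass.coe_finsetSum]
  exact Finset.sum_congr rfl fun s _ => by rw [Subalgebra.coe_smul, hfg]

theorem photonFlow_rec (v : ℕ → evenPart) (N j : ℕ) :
    ((j : ℂ) + 1) • photonFlow P K v N (j + 1) = lapAE P K (photonFlow P K v N j) +
      (1 / 2 : ℂ) • ∑ p ∈ antidiagonal N, ∑ q ∈ antidiagonal j,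
        carre (lapAE P K) (photonFlow P K v p.1 q.1) (photonFlow P K v p.2 q.2) := by
  have hj : (j : ℂ) + 1 ≠ 0 := by exact_mod_cast Nat.succ_ne_zero j
  rw [photonFlow_succ, smul_inv_smul₀ hj]

/-- The partition function is the exponential of the even series obtained from the two successive
flows, so the formal logarithm simply returns that series. -/
theorem coeff_effectiveAction
    (hfin : ∀ N j, N < j → photonFlow P K (fermiElem P K) N j = 0) (N : ℕ) :
    PowerSeries.coeff N (effectiveAction P K) =
      ∑ j ∈ Finset.range (N + 1), (photonFlow P K (fermiElem P K) N j : Fields) := by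
  have hM : bareMat P K 0 = 0 := if_pos rfl
  set E : PowerSeries evenPart := PowerSeries.mk fun n =>
    ∑ j ∈ Finset.range (n + 1), photonFlow P K (fermiElem P K) n j with hE
  have hE0 : PowerSeries.coeff 0 E = 0 := by
    rw [hE, PowerSeries.coeff_mk, zero_add, Finset.sum_range_one,
      photonFlow_order_zero P K _ (fermiElem_zero K)]
  have hV : interaction P K = PowerSeries.map (evenPart.val : evenPart →+* Fields)
      (PowerSeries.mk fun n => chainFlow P K (bareMat P K) n 0) := by
    ext n
    rw [coeff_interaction, PowerSeries.coeff_map, PowerSeries.coeff_mk, chainFlow]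
    rfl
  have hZ : partitionUV P K = pexp (PowerSeries.map (evenPart.val : evenPart →+* Fields) E) := by
    rw [← map_pexp]
    ext n
    have h1 : PowerSeries.coeff n (partitionUV P K) =
        expectUV P K (PowerSeries.coeff n (pexp (interaction P K))) := by
      rw [partitionUV, PowerSeries.coeff_mk, pexp, PowerSeries.coeff_mk]
    obtain ⟨⟨I, hI⟩, h2⟩ := expSum_pexp (lapFE_isSecondOrder P K)
      (chainFlow P K (bareMat P K)) (chainFlow_order_zero K hM)
      (fun N j h => chainFlow_of_lt K hM h) (chainFlow_rec (bareMat P K)) n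
    obtain ⟨⟨J, hJ⟩, h3⟩ := expSum_pexp (lapAE_isSecondOrder P K)
      (photonFlow P K (fermiElem P K)) (photonFlow_order_zero P K _ (fermiElem_zero K)) hfin
      (photonFlow_rec K (fermiElem P K)) n
    have h4 : (PowerSeries.mk fun n => photonFlow P K (fermiElem P K) n 0) =
        PowerSeries.mk fun n => ∑ j ∈ Finset.range (n + 1), chainFlow P K (bareMat P K) n j := by
      ext n
      rw [PowerSeries.coeff_mk, PowerSeries.coeff_mk, photonFlow_zero, fermiElem]
    rw [h1, hV, ← map_pexp, PowerSeries.coeff_map, PowerSeries.coeff_map, expectUV_eq]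
    have hI' : ∀ i, I ≤ i → ((lapF P K) ^ i) ((PowerSeries.coeff n (pexp (PowerSeries.mk fun n =>
        chainFlow P K (bareMat P K) n 0)) : evenPart) : Fields) = 0 := fun i hi => by
      rw [← coe_lapFE_pow, hI i hi]; rfl
    -- Fermions first. Nilpotence of `lapF` on the exponential is a by-product of the fermionic
    -- flow; its endpoint is the initial datum of the photonic one.
    refine (expSum_add _ _ (commute_lapA_lapF P K) _ I hI' (lapA_locally_nilpotent P K)).trans ?_
    refine (congrArg _ (coe_expSum (coe_lapFE_pow P K) hI).symm).trans ?_
    rw [h2, ← h4]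
    exact (coe_expSum (coe_lapAE_pow P K) hJ).symm.trans (congrArg _ h3)
  rw [effectiveAction, PowerSeries.coeff_mk, hZ, log_pexp, PowerSeries.coeff_map, hE,
    PowerSeries.coeff_mk]
  · exact AddSubmonoidClass.coe_finsetSum _ _
  · rw [PowerSeries.coeff_map, hE0, map_zero]

end Action

/-! ### Evaluation at vanishing fields -/

section AtZero

variable {P : Params} {K : ℕ}

theorem atZero_tmul (b : Bose) (g : Grass) : atZero (b ⊗ₜ[ℂ] g) =
    MvPolynomial.aeval (fun _ : BLabel => (0 : ℂ)) b * ExteriorAlgebra.algebraMapInv g := by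
  rw [atZero, Algebra.TensorProduct.lift_tmul]

theorem aeval_bmon {m : ℕ} (hm : m ≠ 0) (b : Fin m → BLabel) :
    MvPolynomial.aeval (fun _ : BLabel => (0 : ℂ)) (bmon b) = 0 := by
  rw [bmon, map_prod]
  simp [hm]

theorem algebraMapInv_gmon {n : ℕ} (hn : n ≠ 0) (σ : Fin n → Fin 2) (q : Fin n → QLabel) :
    (ExteriorAlgebra.algebraMapInv (gmon σ q) : ℂ) = 0 := by
  obtain ⟨n, rfl⟩ := Nat.exists_eq_succ_of_ne_zero hn
  have h : ∀ i, (ExteriorAlgebra.algebraMapInv (psi i) : ℂ) = 0 := fun i => by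
    rw [psi, ExteriorAlgebra.algebraMapInv, ExteriorAlgebra.lift_ι_apply]; rfl
  rw [gmon, List.ofFn_succ, List.prod_cons, map_mul, gpair, map_mul, h, zero_mul, zero_mul]

theorem atZero_gpoly {n m : ℕ} (h : 1 ≤ n + m) (w : Kern n m) : atZero (gpoly P K w) = 0 := by
  rw [gpoly, fpoly, map_sum]
  refine Finset.sum_eq_zero fun σ _ => ?_
  rw [map_sum]
  refine Finset.sum_eq_zero fun q _ => ?_
  rw [atZero_tmul]
  by_cases hn : n = 0
  · have hm : m ≠ 0 := by omega
    rw [bpoly, map_sum, Finset.sum_eq_zero fun b _ => ?_, zero_mul]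
    rw [map_smul, aeval_bmon hm, smul_zero]
  · rw [algebraMapInv_gmon hn, mul_zero]

/-- The delta function at zero total momentum is the volume, which the normalization of the free
energy divides out. -/
theorem gpoly_zero_zero (w : Kern 0 0) :
    gpoly P K w = algebraMap ℂ Fields ((vol P : ℂ) * w Fin.elim0 Fin.elim0) := by
  rw [gpoly_zero_pairs, bpoly,
    Finset.sum_eq_single_of_mem (Fin.elim0 : Fin 0 → BLabel) (Fintype.mem_piFinset.mpr fun i => i.elim0)
      fun q _ h => absurd (Subsingleton.elim _ _) h]
  have h1 : pref P (Fin.elim0 : Fin 0 → QLabel) (Fin.elim0 : Fin 0 → BLabel) = (vol P : ℂ) := by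
    rw [pref, if_pos (by simp [totMom])]
    simp
  rw [h1, bmon, Finset.univ_eq_empty, Finset.prod_empty, Algebra.algebraMap_eq_smul_one,
    ← TensorProduct.smul_tmul']
  rfl

end AtZero

/-! ### Bounds on the majorant -/

section Gamma

/-- Monotonicity of Γ on [2, ∞). The factor 2 is for N = 1, where Γ(3/2) = √π/2 is smaller than 1.
-/
theorem factorial_le_gamma {N j : ℕ} (hN : 1 ≤ N) (hj : 2 * j ≤ N) :
    (j.factorial : ℝ) ≤ 2 * Real.Gamma ((N : ℝ) / 2 + 1) := by
  have hmono := Real.Gamma_strictMonoOn_Ici.monotoneOn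
  have h2 : Real.Gamma 2 = 1 := Real.Gamma_two
  rcases Nat.lt_or_ge N 2 with h | h
  · have hN1 : N = 1 := by omega
    have hj0 : j = 0 := by omega
    subst hN1 hj0
    rw [Nat.cast_one, Real.Gamma_add_one (by norm_num), Real.Gamma_one_half_eq]
    have : (1 : ℝ) ≤ √Real.pi := Real.one_le_sqrt.mpr (by linarith [Real.pi_gt_three])
    rw [Nat.factorial_zero, Nat.cast_one]
    linarith
  · have hN2 : (2 : ℝ) ≤ (N : ℝ) / 2 + 1 := by
      have : (2 : ℝ) ≤ N := by exact_mod_cast h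
      linarith
    have h1 : 1 ≤ Real.Gamma ((N : ℝ) / 2 + 1) := by
      have := hmono (Set.mem_Ici.mpr le_rfl) hN2 hN2
      rwa [h2] at this
    rcases Nat.eq_zero_or_pos j with h0 | h0
    · subst h0; simp; linarith
    · rw [← Real.Gamma_nat_eq_factorial]
      have h3 : (j : ℝ) + 1 ≤ (N : ℝ) / 2 + 1 := by
        have : (2 : ℝ) * j ≤ N := by exact_mod_cast hj
        linarith
      have h4 : (2 : ℝ) ≤ (j : ℝ) + 1 := by
        have : (1 : ℝ) ≤ j := by exact_mod_cast h0
        linarith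
      have := hmono h4 hN2 h3
      linarith

/-- The quotient is C(m+2j, 2j) C(2j, j) j!, and each binomial is at most 2^(m+2j). -/
theorem factorial_div_le (m j : ℕ) :
    ((m + 2 * j).factorial : ℝ) / (m.factorial * j.factorial) ≤ 4 ^ (m + 2 * j) * j.factorial := by
  have h1 : (m + 2 * j).factorial = (m + 2 * j).choose (2 * j) * ((2 * j).choose j *
      (j.factorial * j.factorial)) * m.factorial := by
    have e1 := Nat.choose_mul_factorial_mul_factorial (Nat.le_add_left (2 * j) m)
    have e2 := Nat.choose_mul_factorial_mul_factorial (show j ≤ 2 * j by omega)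
    rw [show m + 2 * j - 2 * j = m by omega] at e1
    rw [show 2 * j - j = j by omega] at e2
    rw [← e1, ← e2]; ring
  have h2 : (((m + 2 * j).choose (2 * j) : ℕ) : ℝ) ≤ 2 ^ (m + 2 * j) := by
    exact_mod_cast Nat.choose_le_two_pow _ _
  have h3 : (((2 * j).choose j : ℕ) : ℝ) ≤ 2 ^ (m + 2 * j) := by
    have h4 : (2 * j).choose j ≤ 2 ^ (2 * j) := Nat.choose_le_two_pow _ _
    exact_mod_cast h4.trans (Nat.pow_le_pow_right (by norm_num) (by omega))
  have hm : (0 : ℝ) < m.factorial := by exact_mod_cast m.factorial_pos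
  have hj : (0 : ℝ) < j.factorial := by exact_mod_cast j.factorial_pos
  rw [div_le_iff₀ (by positivity), h1]
  push_cast
  rw [show (4 : ℝ) = 2 * 2 by norm_num, mul_pow]
  calc _ ≤ (2 : ℝ) ^ (m + 2 * j) * (2 ^ (m + 2 * j) * (j.factorial * j.factorial)) *
        m.factorial := by gcongr
    _ = _ := by ring

/-- The factorials of the majorant reduce to j! up to exponentials, and j ≤ N/2: this is the source
of (N/2)!. -/
theorem maj_le {R γ : ℝ} (hR : 0 ≤ R) (hγ : 1 ≤ γ) {N m j : ℕ} (hN : 1 ≤ N)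
    (h : N = m + 2 * j) :
    maj R γ N j ≤ (8 * R * γ) ^ N * Real.Gamma ((N : ℝ) / 2 + 1) := by
  have hG := factorial_le_gamma hN (show 2 * j ≤ N by omega)
  have hG0 : 0 < Real.Gamma ((N : ℝ) / 2 + 1) := Real.Gamma_pos_of_pos (by positivity)
  have h1 : (N.factorial : ℝ) / ((N - 2 * j).factorial * j.factorial * (N : ℝ) ^ 2) ≤
      4 ^ N * j.factorial := by
    rw [← div_div]
    have hN1 : (1 : ℝ) ≤ (N : ℝ) ^ 2 := one_le_pow₀ (by exact_mod_cast hN)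
    refine (div_le_self (by positivity) hN1).trans ?_
    rw [show N - 2 * j = m by omega, h]
    exact factorial_div_le m j
  have h2 : γ ^ j ≤ γ ^ N := pow_le_pow_right₀ hγ (by omega)
  have hγ0 : 0 ≤ γ := by linarith
  have h3 : (2 : ℝ) ≤ 2 ^ N := le_self_pow₀ (by norm_num) (by omega)
  calc maj R γ N j ≤ R ^ N * γ ^ N * (4 ^ N * (2 * Real.Gamma ((N : ℝ) / 2 + 1))) / 2 := by
        unfold maj
        gcongr
        exact h1.trans (by gcongr)
    _ = R ^ N * γ ^ N * 4 ^ N * 1 * Real.Gamma ((N : ℝ) / 2 + 1) := by ring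
    _ ≤ R ^ N * γ ^ N * 4 ^ N * 2 ^ N * Real.Gamma ((N : ℝ) / 2 + 1) := by
        gcongr
        linarith
    _ = _ := by
        rw [show (8 : ℝ) * R * γ = R * γ * 4 * 2 by ring]
        simp only [mul_pow]

end Gamma

/-! ### Kernels of the effective potential -/

section Final

variable {P : Params} {c : ℝ}

variable (P) in
/-- The exponential growth rate of the kernels of the effective potential. -/
def effRate (c : ℝ) : ℝ := 8 * (16 * fermiRate P c) * (15 * c)

theorem fermiRate_pos (hc : 0 < c) : 0 < fermiRate P c := by
  unfold fermiRate loopBound chainRate; positivity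

theorem effRate_pos (hc : 0 < c) : 0 < effRate P c := by
  have := fermiRate_pos (P := P) hc
  unfold effRate; positivity

theorem fermiElem_repSum (hU : UVBounds P c) {N : ℕ} (hN : 1 ≤ N) :
    RepSum P N N (maj (16 * fermiRate P c) (15 * c) N 0) fun K => (fermiElem P K N : Fields) := by
  obtain ⟨X, Y, hX, hY, h⟩ := fermiElem_rep hU hN
  have hf := fermiRate_pos (P := P) hU.pos
  refine (((hX.repSum hN).add (hY.repSum (Nat.zero_le N))).of_eq h).mono ?_
  unfold maj
  have h1 : (N : ℝ) ≤ 2 ^ N := by exact_mod_cast Nat.lt_two_pow_self.le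
  have h2 : (4 : ℝ) ≤ 4 ^ N := le_self_pow₀ (by norm_num) (by omega)
  have hN0 : (0 : ℝ) < N := by exact_mod_cast hN
  have hfac : (N.factorial : ℝ) ≠ 0 := by exact_mod_cast N.factorial_ne_zero
  -- The factor 16 in the rate pays for the two families of kernels and for the 2N² in the
  -- denominator of the majorant at j = 0.
  have h3 : 4 * (N : ℝ) ^ 2 ≤ 16 ^ N := by
    calc 4 * (N : ℝ) ^ 2 ≤ 4 ^ N * (2 ^ N) ^ 2 := by gcongr
      _ = 16 ^ N := by rw [← pow_mul, mul_comm N 2, pow_mul, ← mul_pow]; norm_num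
  rw [Nat.mul_zero, Nat.sub_zero, pow_zero, mul_one, Nat.factorial_zero, Nat.cast_one, mul_one,
    mul_pow, ← div_div, div_self hfac, mul_one_div, div_div, le_div_iff₀ (by positivity)]
  have : 0 ≤ fermiRate P c ^ N := by positivity
  nlinarith

/-- At order N, exactly m photons survive only after (N - m)/2 contractions. All other kernels are
set to zero, so that every triple of indices has a kernel. -/
theorem exists_kern (hU : UVBounds P c) (N m : ℕ) :
    ∃ w : (n : ℕ) → ℕ → Kern n m,
      (∀ n K q b, ‖w n K q b‖ ≤ effRate P c ^ N * Real.Gamma ((N : ℝ) / 2 + 1)) ∧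
      (∀ n q b, Conv fun K => w n K q b) ∧ (∀ n, N < n → w n = 0) ∧
      ((1 ≤ N ∧ ∃ j, N = m + 2 * j) → ∀ K,
        (photonFlow P K (fermiElem P K) N ((N - m) / 2) : Fields) =
          ∑ n ∈ Finset.range (N + 1), gpoly P K (w n K)) ∧
      (¬ (1 ≤ N ∧ ∃ j, N = m + 2 * j) → w = 0) := by
  have hc := hU.pos
  have hE := effRate_pos (P := P) hc
  have hG0 : 0 < Real.Gamma ((N : ℝ) / 2 + 1) := Real.Gamma_pos_of_pos (by positivity)
  by_cases h : 1 ≤ N ∧ ∃ j, N = m + 2 * j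
  · obtain ⟨hN, j, hj⟩ := h
    have hR : 0 ≤ 16 * fermiRate P c := by have := fermiRate_pos (P := P) hc; positivity
    have h1 := ((photonFlow_rep hU hR fermiElem_zero (fun N hN => fermiElem_repSum hU hN) j).1
      N m hN hj).mono (maj_le hR (by linarith [hU.one_le]) hN hj)
    obtain ⟨X, hX, hY⟩ := h1.exists_rep
    choose w hw hb hl using hX
    refine ⟨fun n => if n ≤ N then w n else 0, fun n K q b => ?_, fun n q b => ?_, fun n hn => ?_,
      fun _ K => ?_, fun h2 => absurd ⟨hN, j, hj⟩ h2⟩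
    · beta_reduce
      split_ifs
      · exact hb n K q b
      · simp only [Pi.zero_apply, norm_zero]; positivity
    · beta_reduce
      split_ifs
      · exact hl n q b
      · exact Conv.const 0
    · exact if_neg (by omega)
    · rw [show (N - m) / 2 = j by omega, hY]
      refine Finset.sum_congr rfl fun n hn => ?_
      beta_reduce
      rw [if_pos (Nat.lt_succ_iff.mp (Finset.mem_range.mp hn)), hw]
  · refine ⟨0, fun n K q b => ?_, fun n q b => Conv.const 0, fun n _ => rfl,
      fun h2 => absurd h2 h, fun _ => rfl⟩
    simp only [Pi.zero_apply, norm_zero]; positivity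

/-- Reindexes the contractions j by the remaining photons m = N - 2j; the junk indices on both sides
carry zero. -/
theorem sum_range_halves {M : Type*} [AddCommMonoid M] (N : ℕ) (f g : ℕ → M)
    (hf : ∀ j, N < 2 * j → f j = 0) (hg : ∀ m, (¬ ∃ j, N = m + 2 * j) → g m = 0)
    (hfg : ∀ m j, N = m + 2 * j → f j = g m) :
    ∑ j ∈ Finset.range (N + 1), f j = ∑ m ∈ Finset.range (N + 1), g m := by
  have h1 : ∑ j ∈ Finset.range (N + 1), f j =
      ∑ j ∈ (Finset.range (N + 1)).filter (fun j => 2 * j ≤ N), f j := by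
    rw [Finset.sum_filter]
    refine Finset.sum_congr rfl fun j _ => ?_
    split_ifs with h
    · rfl
    · exact hf j (by omega)
  have h2 : ∑ m ∈ Finset.range (N + 1), g m =
      ∑ m ∈ (Finset.range (N + 1)).filter (fun m => (N - m) % 2 = 0), g m := by
    rw [Finset.sum_filter]
    refine Finset.sum_congr rfl fun m hm => ?_
    split_ifs with h
    · rfl
    · exact hg m (by rintro ⟨j, hj⟩; omega)
  rw [h1, h2]
  refine Finset.sum_nbij' (fun j => N - 2 * j) (fun m => (N - m) / 2) ?_ ?_ ?_ ?_ ?_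
  · intro j hj
    simp only [Finset.mem_filter, Finset.mem_range] at hj ⊢
    omega
  · intro j hj
    simp only [Finset.mem_filter, Finset.mem_range] at hj ⊢
    omega
  · intro j hj
    simp only [Finset.mem_filter, Finset.mem_range] at hj ⊢
    omega
  · intro j hj
    simp only [Finset.mem_filter, Finset.mem_range] at hj ⊢
    omega
  · intro j hj
    simp only [Finset.mem_filter, Finset.mem_range] at hj
    exact hfg _ _ (by omega)

/-- The effective potential has bounded convergent kernels if the propagators are bounded. -/
theorem effectivePotential_kernels (hU : UVBounds P c) :
    (∀ K N : ℕ, ‖freeEnergy P K N‖ ≤ effRate P c ^ N * Real.Gamma ((N : ℝ) / 2 + 1)) ∧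
    (∀ N : ℕ, ∃ F : ℂ, Filter.Tendsto (fun K : ℕ => freeEnergy P K N) Filter.atTop (nhds F)) ∧
    ∃ W : ℕ → ℕ → (n m : ℕ) → Kernel n m,
      (∀ K N n m : ℕ, N < n ∨ N < m → W K N n m = 0) ∧
      (∀ K N : ℕ, effectivePotential P K N =
        ∑ nm ∈ (Finset.range (N + 1) ×ˢ Finset.range (N + 1)).filter
            (fun nm : ℕ × ℕ => 1 ≤ nm.1 + nm.2), fieldPoly P K (W K N nm.1 nm.2)) ∧
      (∀ (K N n m : ℕ) ρ μ k p, ‖W K N n m ρ μ k p‖ ≤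
        effRate P c ^ N * Real.Gamma ((N : ℝ) / 2 + 1)) ∧
      (∀ (N n m : ℕ) ρ μ k p, ∃ W₀ : ℂ, Filter.Tendsto
        (fun K : ℕ => W K N n m ρ μ k p) Filter.atTop (nhds W₀)) := by
  have hR : 0 ≤ 16 * fermiRate P c := by
    have := fermiRate_pos (P := P) hU.pos; positivity
  have hflow := photonFlow_rep hU hR fermiElem_zero (fun N hN => fermiElem_repSum hU hN)
  choose w hwb hwc hwn hwj hw0 using exists_kern hU
  have hcoeff : ∀ K N, PowerSeries.coeff N (effectiveAction P K) =
      ∑ nm ∈ Finset.range (N + 1) ×ˢ Finset.range (N + 1), gpoly P K (w N nm.2 nm.1 K) := by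
    intro K N
    rw [coeff_effectiveAction K (fun N j h => (hflow j).2 N (by omega) K),
      Finset.sum_product_right]
    refine sum_range_halves N _ (fun m => ∑ n ∈ Finset.range (N + 1), gpoly P K (w N m n K))
      (fun j h => by rw [(hflow j).2 N h K]; rfl) (fun m h => ?_) fun m j h => ?_
    · rw [hw0 N m fun h2 => h h2.2]
      exact Finset.sum_eq_zero fun n _ => gpoly_zero
    · rcases Nat.eq_zero_or_pos N with hN | hN
      · rw [hw0 N m fun h2 => by omega, Finset.sum_eq_zero fun n _ => ?_, hN,
          photonFlow_order_zero P K _ (fermiElem_zero K)]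
        · rfl
        · exact gpoly_zero
      · rw [← hwj N m ⟨hN, j, h⟩ K, show (N - m) / 2 = j by omega]
  have hzero : ∀ K N, atZero (PowerSeries.coeff N (effectiveAction P K)) =
      (vol P : ℂ) * w N 0 0 K Fin.elim0 Fin.elim0 := by
    intro K N
    rw [hcoeff, map_sum, Finset.sum_eq_single_of_mem (0, 0) (by simp)]
    · rw [gpoly_zero_zero, AlgHom.commutes]; rfl
    · intro nm _ h
      refine atZero_gpoly ?_ _
      by_contra h1
      exact h (Prod.ext (by simp; omega) (by simp; omega))
  have hv : (vol P : ℂ) ≠ 0 := by exact_mod_cast hU.vol_pos.ne'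
  have hF : ∀ K N, freeEnergy P K N = -w N 0 0 K Fin.elim0 Fin.elim0 := by
    intro K N
    rw [freeEnergy, hzero, ← vol, neg_div, mul_div_cancel_left₀ _ hv]
  refine ⟨fun K N => ?_, fun N => ?_, fun K N n m => (w N m n K).toKernel, ?_, fun K N => ?_, ?_, ?_⟩
  · rw [hF, norm_neg]
    exact hwb _ _ _ _ _ _
  · obtain ⟨l, hl⟩ := hwc N 0 0 Fin.elim0 Fin.elim0
    exact ⟨-l, by simpa only [hF] using hl.neg⟩
  · rintro K N n m (h | h) <;> beta_reduce
    · rw [hwn N m n h]; rfl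
    · rw [hw0 N m (by rintro ⟨-, j, hj⟩; omega)]; rfl
  · rw [effectivePotential, hzero, ← gpoly_zero_zero (K := K), hcoeff]
    simp only [fieldPoly_toKernel]
    -- The subtracted constant is exactly the term without legs.
    rw [sub_eq_iff_eq_add, ← Finset.sum_filter_add_sum_filter_not _ (fun nm : ℕ × ℕ =>
      1 ≤ nm.1 + nm.2)]
    congr 1
    rw [Finset.sum_eq_single_of_mem (0, 0) (by simp)]
    intro nm h1 h2
    rw [Finset.mem_filter] at h1
    exact absurd (Prod.ext (by simp; omega) (by simp; omega)) h2
  · exact fun K N n m ρ μ k p => hwb _ _ _ _ _ _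
  · exact fun N n m ρ μ k p => hwc _ _ _ _ _

end Final

/-! ### The photon propagator -/

/-- Outside a compact interval `χ` is 0 or 1. No bound 0 ≤ χ ≤ 1 is assumed, whence the constant X
in the later estimates. -/
theorem IsCutoff.exists_bound {a₀ M : ℝ} {χ : ℝ → ℝ} (hχ : IsCutoff a₀ M χ) :
    ∃ X, 1 ≤ X ∧ ∀ s, |χ s| ≤ X := by
  obtain ⟨B, hB⟩ := (isCompact_Icc (a := a₀) (b := a₀ * M)).exists_bound_of_continuousOn
    hχ.smooth.continuous.continuousOn
  refine ⟨max 1 B, le_max_left _ _, fun s => ?_⟩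
  rcases le_total s a₀ with h | h
  · rw [hχ.eq_one s h, abs_one]; exact le_max_left _ _
  rcases le_total (a₀ * M) s with h' | h'
  · rw [hχ.eq_zero s h', abs_zero]; exact zero_le_one.trans (le_max_left _ _)
  · exact (hB s ⟨h, h'⟩).trans (le_max_right _ _)

section Photon

variable {P : Params} {X : ℝ}

theorem dotProduct_self_nonneg_real (v : Fin 2 → ℝ) : 0 ≤ v ⬝ᵥ v := by
  simp only [dotProduct, Fin.sum_univ_two]
  exact add_nonneg (mul_self_nonneg _) (mul_self_nonneg _)

theorem stLen_sq (p₀ : ℝ) (v : Fin 2 → ℝ) : stLen p₀ v ^ 2 = p₀ ^ 2 + v ⬝ᵥ v :=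
  Real.sq_sqrt (add_nonneg (sq_nonneg _) (dotProduct_self_nonneg_real v))

theorem abs_le_len3 (v : Fin 2 → ℝ) (p₃ : ℝ) : |p₃| ≤ len3 v p₃ :=
  Real.abs_le_sqrt (le_add_of_nonneg_left (dotProduct_self_nonneg_real v))

theorem len3_nonneg (v : Fin 2 → ℝ) (p₃ : ℝ) : 0 ≤ len3 v p₃ := Real.sqrt_nonneg _

theorem chiUV_eq_one (hχ : IsCutoff P.a₀ P.M P.χ) (hM : 1 < P.M) {K : ℕ} {x : ℝ}
    (hx : |x| ≤ P.a₀ * P.M ^ K) : chiUV P K x = 1 := by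
  refine hχ.eq_one _ ?_
  rw [div_le_iff₀ (by positivity)]
  exact hx

theorem one_le_zpow_neg_hstar (hM : 1 < P.M) (hh : P.hstar < 0) : 1 ≤ P.M ^ (-P.hstar) :=
  one_le_zpow₀ hM.le (by omega)

/-- A quotient with numerator vanishing where the denominator is small is integrable. -/
theorem intervalIntegrable_div {f g : ℝ → ℝ} (hf : Continuous f) (hg : Continuous g) {a b B ε : ℝ}
    (hε : 0 < ε) (hB : ∀ x, |f x| ≤ B) (h : ∀ x, f x = 0 ∨ ε ≤ g x) :
    IntervalIntegrable (fun x => (2 * Real.pi)⁻¹ * (f x / g x)) MeasureTheory.volume a b := by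
  apply IntervalIntegrable.const_mul
  rw [intervalIntegrable_iff]
  refine MeasureTheory.Measure.integrableOn_of_bounded (M := B / ε) (by simp)
    (hf.measurable.div hg.measurable).aestronglyMeasurable
    (Filter.Eventually.of_forall fun x => ?_)
  have hB0 : 0 ≤ B := (abs_nonneg _).trans (hB x)
  rcases h x with h0 | h0
  · simp only [h0, zero_div, norm_zero]; positivity
  · rw [Real.norm_eq_abs, abs_div, abs_of_pos (hε.trans_le h0)]
    gcongr
    exact hB x

theorem continuous_len3 (v : Fin 2 → ℝ) : Continuous (len3 v) := by
  unfold len3; fun_prop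

/-- Both integrals live on |p₃| ≤ a₀M, since the cutoffs of the full propagator vanish outside. In
the difference the two terms with χ(M^(-h*)|p̲|) cancel, and with them all dependence on h*. -/
theorem photonPropUV_eq (ha : 0 < P.a₀) (hM : 1 < P.M) (hχ : IsCutoff P.a₀ P.M P.χ)
    (hh : P.hstar < 0) (hX : ∀ s, |P.χ s| ≤ X) (K : ℕ) (p : Mom) :
    photonPropUV P K p = ∫ p₃ in (-(P.a₀ * P.M))..(P.a₀ * P.M), (2 * Real.pi)⁻¹ *
      ((chiUV P K (bFreq P.β p) * P.χ (len3 (vec P.L p) p₃) -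
        P.χ (stLen (bFreq P.β p) (vec P.L p))) /
        (stLen (bFreq P.β p) (vec P.L p) ^ 2 + p₃ ^ 2)) := by
  have hX0 : 0 ≤ X := (abs_nonneg _).trans (hX 0)
  have hcont := hχ.smooth.continuous
  have hl := continuous_len3 (vec P.L p)
  have hMh := one_le_zpow_neg_hstar hM hh
  have hMh0 : 0 < P.M ^ (-P.hstar) := by linarith
  have haM : 0 < P.a₀ * P.M := by positivity
  set x := chiUV P K (bFreq P.β p) with hx
  have hxX : |x| ≤ X := hX _
  set S := stLen (bFreq P.β p) (vec P.L p) ^ 2 with hS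
  have hS0 : 0 ≤ S := sq_nonneg _
  set l := len3 (vec P.L p) with hldef
  -- The integrands can be singular only at p = 0, p₃ = 0, and there all cutoffs equal 1 in a
  -- neighbourhood. Its size ε may depend on h*, as it only serves to make the separate integrals
  -- converge.
  obtain ⟨ε, hε, hsing⟩ : ∃ ε, 0 < ε ∧ ∀ p₃ : ℝ,
      (x = 1 ∧ P.χ (l p₃) = 1 ∧ P.χ (P.M ^ (-P.hstar) * l p₃) = 1 ∧
        P.χ (stLen (bFreq P.β p) (vec P.L p)) = 1) ∨ ε ≤ S + p₃ ^ 2 := by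
    by_cases hS1 : 0 < S
    · exact ⟨S, hS1, fun p₃ => Or.inr (le_add_of_nonneg_right (sq_nonneg _))⟩
    have hS2 : S = 0 := le_antisymm (not_lt.mp hS1) hS0
    have hst : stLen (bFreq P.β p) (vec P.L p) = 0 := pow_eq_zero_iff two_ne_zero |>.mp hS2
    have h3 : bFreq P.β p ^ 2 + vec P.L p ⬝ᵥ vec P.L p = 0 := by rw [← stLen_sq, hst]; norm_num
    have h4 := dotProduct_self_nonneg_real (vec P.L p)
    have h5 := sq_nonneg (bFreq P.β p)
    have h6 : bFreq P.β p = 0 := pow_eq_zero_iff two_ne_zero |>.mp (by linarith)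
    have h7 : vec P.L p ⬝ᵥ vec P.L p = 0 := by linarith
    have hl0 : ∀ p₃, l p₃ = |p₃| := fun p₃ => by
      rw [hldef, len3, h7, zero_add, Real.sqrt_sq_eq_abs]
    refine ⟨(P.a₀ / P.M ^ (-P.hstar)) ^ 2, by positivity, fun p₃ => ?_⟩
    rcases le_total (|p₃|) (P.a₀ / P.M ^ (-P.hstar)) with h8 | h8
    · left
      have h9 : P.M ^ (-P.hstar) * |p₃| ≤ P.a₀ := by
        rw [le_div_iff₀ hMh0] at h8; linarith
      refine ⟨?_, hχ.eq_one _ ?_, hχ.eq_one _ ?_, hχ.eq_one _ ?_⟩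
      · rw [hx, h6]
        refine chiUV_eq_one hχ hM ?_
        rw [abs_zero]; positivity
      · rw [hl0]; nlinarith [abs_nonneg p₃]
      · rw [hl0]; exact h9
      · rw [hst]; exact ha.le
    · right
      rw [hS2, zero_add, ← sq_abs p₃]
      have : 0 ≤ P.a₀ / P.M ^ (-P.hstar) := by positivity
      gcongr
  have hden : Continuous fun p₃ : ℝ => S + p₃ ^ 2 := by fun_prop
  have hI1 : IntervalIntegrable (fun p₃ => (2 * Real.pi)⁻¹ * (x * chiIR P (l p₃) / (S + p₃ ^ 2)))
      MeasureTheory.volume (-(P.a₀ * P.M)) (P.a₀ * P.M) := by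
    refine intervalIntegrable_div (B := X * (X + X)) ?_ hden hε (fun p₃ => ?_) fun p₃ => ?_
    · unfold chiIR; fun_prop
    · rw [abs_mul]
      refine mul_le_mul hxX ((abs_sub _ _).trans (add_le_add (hX _) (hX _))) (abs_nonneg _) hX0
    · refine (hsing p₃).imp_left fun h => ?_
      rw [chiIR, h.2.1, h.2.2.1, sub_self, mul_zero]
  have hI2 : IntervalIntegrable (fun p₃ => (2 * Real.pi)⁻¹ *
      ((P.χ (stLen (bFreq P.β p) (vec P.L p)) - x * P.χ (P.M ^ (-P.hstar) * l p₃)) /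
        (S + p₃ ^ 2))) MeasureTheory.volume (-(P.a₀ * P.M)) (P.a₀ * P.M) := by
    refine intervalIntegrable_div (B := X + X * X) ?_ hden hε (fun p₃ => ?_) fun p₃ => ?_
    · fun_prop
    · refine (abs_sub _ _).trans (add_le_add (hX _) ?_)
      rw [abs_mul]
      exact mul_le_mul hxX (hX _) (abs_nonneg _) hX0
    · refine (hsing p₃).imp_left fun h => ?_
      rw [h.1, h.2.2.1, h.2.2.2]; norm_num
  have h1 : photonProp P K p = ∫ p₃ in (-(P.a₀ * P.M))..(P.a₀ * P.M),
      (2 * Real.pi)⁻¹ * (x * chiIR P (l p₃) / (S + p₃ ^ 2)) := by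
    rw [photonProp]
    symm
    refine intervalIntegral.integral_eq_integral_of_support_subset fun p₃ hp => ?_
    by_contra hc
    apply hp
    have h2 : P.a₀ * P.M ≤ |p₃| := by
      rw [Set.mem_Ioc, not_and_or, not_lt, not_le] at hc
      rcases hc with h | h
      · exact (le_neg_of_le_neg h).trans (neg_le_abs p₃)
      · exact h.le.trans (le_abs_self p₃)
    have h3 := h2.trans (abs_le_len3 (vec P.L p) p₃)
    have h4 : chiIR P (l p₃) = 0 := by
      rw [chiIR, hχ.eq_zero _ h3, hχ.eq_zero, sub_zero]
      have := len3_nonneg (vec P.L p) p₃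
      nlinarith
    beta_reduce
    rw [h4, mul_zero, zero_div, mul_zero]
  rw [photonPropUV, h1, photonPropIR, ← intervalIntegral.integral_sub hI1 hI2]
  refine intervalIntegral.integral_congr fun p₃ _ => ?_
  simp only [chiIR]
  ring

/-- The numerator vanishes where p² + p₃² ≤ a₀². Elsewhere the denominator dominates a multiple of 1
+ p₀², and the p₃-interval is bounded. -/
theorem abs_photonPropUV_le (ha : 0 < P.a₀) (hM : 1 < P.M) (hχ : IsCutoff P.a₀ P.M P.χ)
    (hh : P.hstar < 0) (hX1 : 1 ≤ X) (hX : ∀ s, |P.χ s| ≤ X) (K : ℕ) (p : Mom) :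
    |photonPropUV P K p| ≤ 2 * P.a₀ * P.M * X ^ 2 * ((1 + P.a₀ ^ 2) / P.a₀ ^ 2) /
      (1 + bFreq P.β p ^ 2) := by
  rw [photonPropUV_eq ha hM hχ hh hX]
  set q := bFreq P.β p
  set v := vec P.L p
  set D : ℝ := (1 + P.a₀ ^ 2) / P.a₀ ^ 2 with hD
  have hD0 : 0 < D := by positivity
  have hv := dotProduct_self_nonneg_real v
  have key : ∀ p₃ : ℝ, |(chiUV P K q * P.χ (len3 v p₃) - P.χ (stLen q v)) /
      (stLen q v ^ 2 + p₃ ^ 2)| ≤ 2 * X ^ 2 * D / (1 + q ^ 2) := by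
    intro p₃
    have hnum : |chiUV P K q * P.χ (len3 v p₃) - P.χ (stLen q v)| ≤ 2 * X ^ 2 := by
      refine (abs_sub _ _).trans ?_
      rw [abs_mul]
      have h1 : |chiUV P K q| * |P.χ (len3 v p₃)| ≤ X * X :=
        mul_le_mul (hX _) (hX _) (abs_nonneg _) (by linarith)
      have := hX (stLen q v)
      nlinarith
    -- Used with e = p₀² when |p₀| ≥ a₀ and with e = a₀² otherwise; D is the constant that makes 1 +
    -- p₀² ≤ D e hold in both cases.
    have hle : ∀ e, 0 < e → e ≤ stLen q v ^ 2 + p₃ ^ 2 → 1 + q ^ 2 ≤ D * e →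
        |(chiUV P K q * P.χ (len3 v p₃) - P.χ (stLen q v)) / (stLen q v ^ 2 + p₃ ^ 2)| ≤
          2 * X ^ 2 * D / (1 + q ^ 2) := by
      intro e he h1 h2
      rw [abs_div, abs_of_pos (he.trans_le h1), div_le_div_iff₀ (he.trans_le h1) (by positivity)]
      calc _ ≤ 2 * X ^ 2 * (D * e) := by gcongr
        _ ≤ 2 * X ^ 2 * (D * (stLen q v ^ 2 + p₃ ^ 2)) := by gcongr
        _ = _ := by ring
    rw [stLen_sq] at hle ⊢
    have ha2 : 0 < P.a₀ ^ 2 := by positivity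
    rcases le_or_gt P.a₀ |q| with hq | hq
    · have hq2 : P.a₀ ^ 2 ≤ q ^ 2 := by rw [← sq_abs q]; gcongr
      refine hle (q ^ 2) (by linarith) (by nlinarith [sq_nonneg p₃]) ?_
      rw [hD, div_mul_eq_mul_div, le_div_iff₀ ha2]
      nlinarith
    · have hq2 : q ^ 2 ≤ P.a₀ ^ 2 := by
        rw [← sq_abs q]; gcongr
      rcases le_or_gt (q ^ 2 + v ⬝ᵥ v + p₃ ^ 2) (P.a₀ ^ 2) with h1 | h1
      · have e1 : chiUV P K q = 1 := chiUV_eq_one hχ hM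
          (hq.le.trans (le_mul_of_one_le_right ha.le (one_le_pow₀ hM.le)))
        have e2 : P.χ (len3 v p₃) = 1 := hχ.eq_one _ (by
          rw [len3, Real.sqrt_le_left ha.le]; nlinarith [sq_nonneg q])
        have e3 : P.χ (stLen q v) = 1 := hχ.eq_one _ (by
          rw [stLen, Real.sqrt_le_left ha.le]; nlinarith [sq_nonneg p₃])
        rw [e1, e2, e3]
        simp only [mul_one, sub_self, zero_div, abs_zero]
        positivity
      · refine hle (P.a₀ ^ 2) ha2 h1.le ?_
        rw [hD, div_mul_cancel₀ _ ha2.ne']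
        linarith
  have hpi : (2 * Real.pi)⁻¹ ≤ 2⁻¹ := inv_anti₀ (by norm_num) (by linarith [Real.pi_gt_three])
  have hpi0 : 0 < (2 * Real.pi)⁻¹ := by positivity
  have h := intervalIntegral.norm_integral_le_of_norm_le_const (a := -(P.a₀ * P.M))
    (b := P.a₀ * P.M) (C := 2⁻¹ * (2 * X ^ 2 * D / (1 + q ^ 2)))
    (f := fun p₃ => (2 * Real.pi)⁻¹ * ((chiUV P K q * P.χ (len3 v p₃) - P.χ (stLen q v)) /
      (stLen q v ^ 2 + p₃ ^ 2))) fun p₃ _ => by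
        rw [norm_mul, Real.norm_of_nonneg hpi0.le]
        exact mul_le_mul hpi (key p₃) (norm_nonneg _) (by norm_num)
  refine h.trans (le_of_eq ?_)
  rw [sub_neg_eq_add, abs_of_pos (by positivity)]
  ring

end Photon

/-! ### The dispersion relation -/

section Dispersion

theorem dot_b₁ (v : Fin 2 → ℝ) : b₁ ⬝ᵥ v = 2 * Real.pi / 3 * (v 0 + √3 * v 1) := by
  simp only [dotProduct, Fin.sum_univ_two, b₁, Matrix.cons_val_zero, Matrix.cons_val_one]
  ring

theorem dot_b₂ (v : Fin 2 → ℝ) : b₂ ⬝ᵥ v = 2 * Real.pi / 3 * (v 0 - √3 * v 1) := by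
  simp only [dotProduct, Fin.sum_univ_two, b₂, Matrix.cons_val_zero, Matrix.cons_val_one]
  ring

theorem Om_eq (x y : ℝ) : Om (x • b₁ + y • b₂) =
    1 + Complex.exp (((-(2 * Real.pi * y) : ℝ) : ℂ) * Complex.I) +
      Complex.exp (((-(2 * Real.pi * x) : ℝ) : ℂ) * Complex.I) := by
  have h3 : √3 * √3 = 3 := Real.mul_self_sqrt (by norm_num)
  have e1 : (x • b₁ + y • b₂) ⬝ᵥ (nn 1 - nn 0) = -(2 * Real.pi * y) := by
    rw [add_dotProduct, smul_dotProduct, smul_dotProduct, dot_b₁, dot_b₂]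
    simp [nn]
    linear_combination (Real.pi / 3 * x - Real.pi / 3 * y) * h3
  have e2 : (x • b₁ + y • b₂) ⬝ᵥ (nn 2 - nn 0) = -(2 * Real.pi * x) := by
    rw [add_dotProduct, smul_dotProduct, smul_dotProduct, dot_b₁, dot_b₂]
    simp [nn]
    linear_combination (-Real.pi / 3 * x + Real.pi / 3 * y) * h3
  rw [Om, Fin.sum_univ_three, e1, e2, sub_self, dotProduct_zero]
  simp only [mul_comm Complex.I]
  simp

theorem norm_Om_le (v : Fin 2 → ℝ) : ‖Om v‖ ≤ 3 := by
  refine (norm_sum_le_of_le (n := fun _ => (1 : ℝ)) _ fun j _ => ?_).trans (le_of_eq (by simp))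
  exact (norm_exp_I_mul _).le

theorem fermiPt_zero : fermiPt 0 = (2 / 3 : ℝ) • b₁ + (1 / 3 : ℝ) • b₂ := by
  have h3 : √3 * √3 = 3 := Real.mul_self_sqrt (by norm_num)
  have h0 : √3 ≠ 0 := by positivity
  funext i
  fin_cases i
  · simp [fermiPt, b₁, b₂]; ring
  · simp [fermiPt, b₁, b₂]; field_simp; nlinarith

theorem fermiPt_one : fermiPt 1 = (1 / 3 : ℝ) • b₁ + (2 / 3 : ℝ) • b₂ := by
  have h3 : √3 * √3 = 3 := Real.mul_self_sqrt (by norm_num)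
  have h0 : √3 ≠ 0 := by positivity
  funext i
  fin_cases i
  · simp [fermiPt, b₁, b₂]; ring
  · simp [fermiPt, b₁, b₂]; field_simp; nlinarith

theorem cos_two_pi_div_three : Real.cos (2 * Real.pi / 3) = -1 / 2 := by
  rw [show 2 * Real.pi / 3 = Real.pi - Real.pi / 3 by ring, Real.cos_pi_sub, Real.cos_pi_div_three]
  norm_num

theorem sin_two_pi_div_three_pos : 0 < Real.sin (2 * Real.pi / 3) :=
  Real.sin_pos_of_pos_of_lt_pi (by positivity) (by linarith [Real.pi_pos])

/-- The zeros of `Ω` are the Fermi points. -/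
theorem eq_fermiPt_of_Om_eq_zero {x y : ℝ} (h : Om (x • b₁ + y • b₂) = 0) :
    ∃ (ω : Fin 2) (z : ℤ × ℤ),
      x • b₁ + y • b₂ - fermiPt ω - (z.1 : ℝ) • b₁ - (z.2 : ℝ) • b₂ = 0 := by
  rw [Om_eq] at h
  have hre := congrArg Complex.re h
  have him := congrArg Complex.im h
  simp only [Complex.add_re, Complex.one_re, Complex.exp_ofReal_mul_I_re, Complex.zero_re,
    Complex.add_im, Complex.one_im, Complex.exp_ofReal_mul_I_im, Complex.zero_im, Real.cos_neg,
    Real.sin_neg] at hre him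
  set A := 2 * Real.pi * x with hA
  set B := 2 * Real.pi * y with hB
  have hsA := Real.sin_sq_add_cos_sq A
  have hsB := Real.sin_sq_add_cos_sq B
  have hs : Real.sin A = -Real.sin B := by linarith
  -- Opposite sines give equal squared cosines; as the cosines add up to -1, they coincide.
  have hc : Real.cos A = -1 / 2 := by
    have h1 : (Real.cos A - Real.cos B) * (Real.cos A + Real.cos B) = 0 := by
      rw [hs] at hsA; nlinarith
    rw [show Real.cos A + Real.cos B = -1 by linarith] at h1
    linarith
  have hc' : Real.cos B = -1 / 2 := by linarith
  rw [← cos_two_pi_div_three, Real.cos_eq_cos_iff] at hc hc'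
  obtain ⟨k, hk⟩ := hc
  obtain ⟨l, hl⟩ := hc'
  have hsin := sin_two_pi_div_three_pos
  have hp : ∀ (u : ℝ) (k : ℤ), 2 * Real.pi / 3 = 2 * k * Real.pi + u →
      Real.sin u = Real.sin (2 * Real.pi / 3) := by
    intro u k h
    rw [h, show 2 * (k : ℝ) * Real.pi + u = u + k * (2 * Real.pi) by ring,
      Real.sin_add_int_mul_two_pi]
  have hm : ∀ (u : ℝ) (k : ℤ), 2 * Real.pi / 3 = 2 * k * Real.pi - u →
      Real.sin u = -Real.sin (2 * Real.pi / 3) := by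
    intro u k h
    rw [← hp (-u) k (by rw [h]; ring), Real.sin_neg, neg_neg]
  have hpi : Real.pi ≠ 0 := Real.pi_ne_zero
  rcases hk with hk | hk <;> rcases hl with hl | hl
  -- Both angles are ±2π/3 modulo 2π. Equal signs contradict sin A + sin B = 0; the mixed cases are
  -- the two Fermi points.
  · have := hp A k hk; have := hp B l hl; linarith
  · refine ⟨1, (-k, l - 1), ?_⟩
    have e1 : x = 1 / 3 - k := by
      have : Real.pi * (2 / 3 - 2 * k - 2 * x) = 0 := by rw [hA] at hk; linarith
      have := (mul_eq_zero.mp this).resolve_left hpi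
      linarith
    have e2 : y = l - 1 / 3 := by
      have : Real.pi * (2 / 3 - 2 * l + 2 * y) = 0 := by rw [hB] at hl; linarith
      have := (mul_eq_zero.mp this).resolve_left hpi
      linarith
    rw [fermiPt_one, e1, e2]
    push_cast
    module
  · refine ⟨0, (k - 1, -l), ?_⟩
    have e1 : x = k - 1 / 3 := by
      have : Real.pi * (2 / 3 - 2 * k + 2 * x) = 0 := by rw [hA] at hk; linarith
      have := (mul_eq_zero.mp this).resolve_left hpi
      linarith
    have e2 : y = 1 / 3 - l := by
      have : Real.pi * (2 / 3 - 2 * l - 2 * y) = 0 := by rw [hB] at hl; linarith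
      have := (mul_eq_zero.mp this).resolve_left hpi
      linarith
    rw [fermiPt_zero, e1, e2]
    push_cast
    module
  · have := hm A k hk; have := hm B l hl; linarith

theorem continuous_len : Continuous len := by
  unfold len dotProduct
  fun_prop

theorem len_zero : len 0 = 0 := by simp [len]

/-- `Ω` is bounded below away from the Fermi points. -/
theorem exists_Om_ge {a : ℝ} (ha : 0 < a) :
    ∃ c, 0 < c ∧ ∀ x ∈ Set.Icc (0 : ℝ) 1, ∀ y ∈ Set.Icc (0 : ℝ) 1,
      (∀ (ω : Fin 2) (z : ℤ × ℤ),
        a ≤ len (x • b₁ + y • b₂ - fermiPt ω - (z.1 : ℝ) • b₁ - (z.2 : ℝ) • b₂)) →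
      c ≤ ‖Om (x • b₁ + y • b₂)‖ := by
  -- A compact part of the unit cell containing no zero of Ω, so that a minimum of |Ω| on it is
  -- positive.
  set S : Set (ℝ × ℝ) := (Set.Icc (0 : ℝ) 1 ×ˢ Set.Icc (0 : ℝ) 1) ∩
    ⋂ (ω : Fin 2) (z : ℤ × ℤ), {u | a ≤ len (u.1 • b₁ + u.2 • b₂ - fermiPt ω - (z.1 : ℝ) • b₁ -
      (z.2 : ℝ) • b₂)} with hS
  have hcomp : IsCompact S := by
    refine (isCompact_Icc.prod isCompact_Icc).inter_right (isClosed_iInter fun ω =>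
      isClosed_iInter fun z => isClosed_le continuous_const (continuous_len.comp ?_))
    fun_prop
  have hcont : Continuous fun u : ℝ × ℝ => ‖Om (u.1 • b₁ + u.2 • b₂)‖ := by
    simp only [Om_eq]
    fun_prop
  rcases S.eq_empty_or_nonempty with he | hne
  · refine ⟨1, one_pos, fun x hx y hy h => ?_⟩
    have : (x, y) ∈ S := ⟨⟨hx, hy⟩, Set.mem_iInter₂.mpr h⟩
    rw [he] at this
    exact absurd this (Set.notMem_empty _)
  · obtain ⟨u, hu, hmin⟩ := hcomp.exists_isMinOn hne hcont.continuousOn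
    refine ⟨‖Om (u.1 • b₁ + u.2 • b₂)‖, ?_, fun x hx y hy h => ?_⟩
    · rw [norm_pos_iff]
      intro h0
      obtain ⟨ω, z, hz⟩ := eq_fermiPt_of_Om_eq_zero h0
      have := Set.mem_iInter₂.mp hu.2 ω z
      rw [Set.mem_ofPred_eq, hz, len_zero] at this
      linarith
    · have hxy : (x, y) ∈ S := ⟨⟨hx, hy⟩, Set.mem_iInter₂.mpr h⟩
      exact isMinOn_iff.mp hmin (x, y) hxy

theorem abs_snd_le_len (v : Fin 2 → ℝ) : |v 1| ≤ len v := by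
  refine Real.abs_le_sqrt ?_
  simp only [dotProduct, Fin.sum_univ_two]
  nlinarith [mul_self_nonneg (v 0)]

theorem torusDist_le (v w : Fin 2 → ℝ) (z : ℤ × ℤ) :
    torusDist v w ≤ len (v - w - (z.1 : ℝ) • b₁ - (z.2 : ℝ) • b₂) :=
  ciInf_le ⟨0, by rintro _ ⟨z, rfl⟩; exact Real.sqrt_nonneg _⟩ z

theorem torusDist_nonneg (v w : Fin 2 → ℝ) : 0 ≤ torusDist v w :=
  Real.iInf_nonneg fun _ => Real.sqrt_nonneg _

/-- The Fermi points are separated. -/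
theorem fermiPt_separated (v : Fin 2 → ℝ) {ω ω' : Fin 2} (hω : ω ≠ ω') (z z' : ℤ × ℤ) :
    Real.pi / 4 ≤ len (v - fermiPt ω - (z.1 : ℝ) • b₁ - (z.2 : ℝ) • b₂) +
      len (v - fermiPt ω' - (z'.1 : ℝ) • b₁ - (z'.2 : ℝ) • b₂) := by
  set u := v - fermiPt ω - (z.1 : ℝ) • b₁ - (z.2 : ℝ) • b₂ with hu
  set u' := v - fermiPt ω' - (z'.1 : ℝ) • b₁ - (z'.2 : ℝ) • b₂ with hu'
  have h3 : √3 * √3 = 3 := Real.mul_self_sqrt (by norm_num)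
  have h30 : 0 < √3 := by positivity
  have h32 : √3 ≤ 2 := by nlinarith
  -- In the second coordinate the distance is an integer multiple of 2π√3/9. The integer is ±2
  -- modulo 3, hence nonzero.
  obtain ⟨s, hs, hss⟩ : ∃ s : ℤ, s ≠ 0 ∧ u 1 - u' 1 = 2 * Real.pi / 9 * √3 * s := by
    have e0 : ∀ i, u i - u' i = fermiPt ω' i - fermiPt ω i + ((z'.1 - z.1 : ℝ)) * b₁ i +
        ((z'.2 - z.2 : ℝ)) * b₂ i := by
      intro i
      simp only [hu, hu', Pi.sub_apply, Pi.smul_apply, smul_eq_mul]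
      ring
    have e1 := e0 1
    fin_cases ω <;> fin_cases ω'
    · exact absurd rfl hω
    · refine ⟨3 * (z'.1 - z.1 - (z'.2 - z.2)) - 2, by omega, ?_⟩
      rw [e1]
      simp only [Fin.zero_eta, Fin.mk_one, fermiPt_zero, fermiPt_one, Pi.add_apply, Pi.smul_apply, smul_eq_mul, b₁,
        b₂, Matrix.cons_val_one]
      push_cast
      simp
      ring
    · refine ⟨3 * (z'.1 - z.1 - (z'.2 - z.2)) + 2, by omega, ?_⟩
      rw [e1]
      simp only [Fin.zero_eta, Fin.mk_one, fermiPt_zero, fermiPt_one, Pi.add_apply, Pi.smul_apply, smul_eq_mul, b₁,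
        b₂, Matrix.cons_val_one]
      push_cast
      simp
      ring
    · exact absurd rfl hω
  have h1 : (1 : ℝ) ≤ |(s : ℝ)| := by exact_mod_cast Int.one_le_abs hs
  have h2 : Real.pi / 4 ≤ |u 1 - u' 1| := by
    rw [hss, abs_mul, abs_of_pos (by positivity)]
    have h5 : (9 / 8 : ℝ) ≤ √3 := by
      apply Real.le_sqrt_of_sq_le; norm_num
    have hpi := Real.pi_pos
    calc Real.pi / 4 = 2 * Real.pi / 9 * (9 / 8) * 1 := by ring
      _ ≤ 2 * Real.pi / 9 * √3 * |(s : ℝ)| := by gcongr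
  have h6 := abs_sub (u 1) (u' 1)
  linarith [abs_snd_le_len u, abs_snd_le_len u']

end Dispersion

/-! ### The fermion propagator -/

section Fermion

variable {P : Params} {X : ℝ}

variable (P) in
/-- The ultraviolet cutoff around the Fermi points. -/
def fermiCut (k : Mom) : ℝ :=
  1 - ∑ ω : Fin 2, P.χ (√(fFreq P.β k ^ 2 + torusDist (vec P.L k) (fermiPt ω) ^ 2))

variable (P) in
/-- The denominator of the fermion propagator. -/
def fermiDen (k : Mom) : ℝ := fFreq P.β k ^ 2 + P.t ^ 2 * ‖Om (vec P.L k)‖ ^ 2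

theorem fFreq_ne_zero (hβ : 0 < P.β) (k : Mom) : fFreq P.β k ≠ 0 := by
  have hpi := Real.pi_pos
  have h : (k.1 : ℝ) + 1 / 2 ≠ 0 := by
    intro h
    have : (2 * k.1 + 1 : ℝ) = 0 := by linarith
    have h2 : 2 * k.1 + 1 = 0 := by exact_mod_cast this
    omega
  unfold fFreq
  positivity

theorem fermiDen_pos (hβ : 0 < P.β) (k : Mom) : 0 < fermiDen P k := by
  have h := fFreq_ne_zero hβ k
  unfold fermiDen
  positivity

theorem gUV_eq_mul (K : ℕ) (k : Mom) (ρ ρ' : Fin 2) :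
    gUV P K k ρ ρ' = (fermiCut P k : ℂ) * (chiUV P K (fFreq P.β k) : ℂ) *
      (kinetic P (fFreq P.β k) (vec P.L k))⁻¹ ρ ρ' := by
  unfold gUV fermionPropUV fermionPropIR fermionProp fermiCut
  simp only [Matrix.sub_apply, Matrix.smul_apply, smul_eq_mul]
  push_cast
  ring

theorem det_kinetic (k : Mom) : (kinetic P (fFreq P.β k) (vec P.L k)).det = -(fermiDen P k : ℂ) := by
  rw [kinetic, Matrix.det_fin_two_of, fermiDen]
  have h1 : star (Om (vec P.L k)) * Om (vec P.L k) = ((‖Om (vec P.L k)‖ ^ 2 : ℝ) : ℂ) := by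
    rw [Complex.star_def, mul_comm, Complex.mul_conj, Complex.normSq_eq_norm_sq]
  push_cast at h1 ⊢
  linear_combination (fFreq P.β k : ℂ) ^ 2 * Complex.I_sq - (P.t : ℂ) ^ 2 * h1

theorem kinetic_inv (k : Mom) : (kinetic P (fFreq P.β k) (vec P.L k))⁻¹ =
    (-(fermiDen P k : ℂ))⁻¹ • !![-Complex.I * fFreq P.β k, P.t * star (Om (vec P.L k));
      P.t * Om (vec P.L k), -Complex.I * fFreq P.β k] := by
  rw [Matrix.inv_def, det_kinetic, Ring.inverse_eq_inv', kinetic, Matrix.adjugate_fin_two_of]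
  simp only [neg_mul, neg_neg]

theorem gUV_diag (K : ℕ) (k : Mom) (ρ : Fin 2) :
    gUV P K k ρ ρ = ((fermiCut P k * chiUV P K (fFreq P.β k) * (fFreq P.β k / fermiDen P k) : ℝ) : ℂ) *
      Complex.I := by
  rw [gUV_eq_mul, kinetic_inv]
  fin_cases ρ <;>
  · simp only [Fin.zero_eta, Fin.mk_one, Matrix.smul_apply, Matrix.of_apply, Matrix.cons_val_zero,
      Matrix.cons_val_one, Matrix.cons_val', smul_eq_mul, inv_neg]
    push_cast
    rw [div_eq_mul_inv]
    ring

theorem norm_gUV_diag (hβ : 0 < P.β) (K : ℕ) (k : Mom) (ρ : Fin 2) :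
    ‖gUV P K k ρ ρ‖ = |fermiCut P k| * |chiUV P K (fFreq P.β k)| *
      (|fFreq P.β k| / fermiDen P k) := by
  rw [gUV_diag, norm_mul, Complex.norm_I, mul_one, Complex.norm_real, Real.norm_eq_abs, abs_mul,
    abs_mul, abs_div, abs_of_pos (fermiDen_pos hβ k)]

theorem norm_gUV_off (hβ : 0 < P.β) (ht : 0 < P.t) (K : ℕ) (k : Mom) {ρ ρ' : Fin 2} (h : ρ ≠ ρ') :
    ‖gUV P K k ρ ρ'‖ = |fermiCut P k| * |chiUV P K (fFreq P.β k)| *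
      (P.t * ‖Om (vec P.L k)‖ / fermiDen P k) := by
  have hD := fermiDen_pos hβ k
  have h1 : ‖(kinetic P (fFreq P.β k) (vec P.L k))⁻¹ ρ ρ'‖ =
      P.t * ‖Om (vec P.L k)‖ / fermiDen P k := by
    rw [kinetic_inv]
    fin_cases ρ <;> fin_cases ρ'
    · exact absurd rfl h
    · simp [abs_of_pos hD, abs_of_pos ht]; field_simp
    · simp [abs_of_pos hD, abs_of_pos ht]; field_simp
    · exact absurd rfl h
  rw [gUV_eq_mul, norm_mul, norm_mul, h1, Complex.norm_real, Complex.norm_real]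
  rfl

theorem abs_fermiCut_le (hX1 : 1 ≤ X) (hX : ∀ s, |P.χ s| ≤ X) (k : Mom) :
    |fermiCut P k| ≤ 3 * X := by
  unfold fermiCut
  refine (abs_sub _ _).trans ?_
  rw [abs_one, Fin.sum_univ_two]
  have := abs_add_le (P.χ (√(fFreq P.β k ^ 2 + torusDist (vec P.L k) (fermiPt 0) ^ 2)))
    (P.χ (√(fFreq P.β k ^ 2 + torusDist (vec P.L k) (fermiPt 1) ^ 2)))
  linarith [hX (√(fFreq P.β k ^ 2 + torusDist (vec P.L k) (fermiPt 0) ^ 2)),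
    hX (√(fFreq P.β k ^ 2 + torusDist (vec P.L k) (fermiPt 1) ^ 2))]

/-- The cutoff vanishes near the Fermi points. -/
theorem fermiCut_eq_zero (ha : 0 < P.a₀) (hM : 1 < P.M) (haM : P.a₀ * P.M < Real.pi / 6)
    (hχ : IsCutoff P.a₀ P.M P.χ) {k : Mom} (hk : |fFreq P.β k| < P.a₀ / 2) {ω : Fin 2} {z : ℤ × ℤ}
    (hz : len (vec P.L k - fermiPt ω - (z.1 : ℝ) • b₁ - (z.2 : ℝ) • b₂) < P.a₀ / 2) :
    fermiCut P k = 0 := by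
  have hnear : P.χ (√(fFreq P.β k ^ 2 + torusDist (vec P.L k) (fermiPt ω) ^ 2)) = 1 := by
    refine hχ.eq_one _ ?_
    rw [Real.sqrt_le_left ha.le]
    have h1 := (torusDist_le (vec P.L k) (fermiPt ω) z).trans hz.le
    have h2 := torusDist_nonneg (vec P.L k) (fermiPt ω)
    have h3 : fFreq P.β k ^ 2 ≤ (P.a₀ / 2) ^ 2 := by rw [← sq_abs]; gcongr
    have h4 : torusDist (vec P.L k) (fermiPt ω) ^ 2 ≤ (P.a₀ / 2) ^ 2 := by gcongr
    nlinarith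
  have hfar : ∀ ω', ω ≠ ω' →
      P.χ (√(fFreq P.β k ^ 2 + torusDist (vec P.L k) (fermiPt ω') ^ 2)) = 0 := by
    intro ω' hω
    refine hχ.eq_zero _ (Real.le_sqrt_of_sq_le ?_)
    have h1 : P.a₀ * P.M ≤ torusDist (vec P.L k) (fermiPt ω') := by
      -- π/4 - a₀/2 > π/4 - π/12 = π/6 > a₀M, by the assumption on a₀M.
      refine le_ciInf fun z' => ?_
      have h2 := fermiPt_separated (vec P.L k) hω z z'
      have h3 : P.a₀ ≤ P.a₀ * P.M := le_mul_of_one_le_right ha.le hM.le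
      linarith
    have h4 : 0 ≤ P.a₀ * P.M := by positivity
    nlinarith [sq_nonneg (fFreq P.β k)]
  unfold fermiCut
  rw [Fin.sum_univ_two]
  fin_cases ω
  · rw [hfar 1 (by decide)]
    have : P.χ (√(fFreq P.β k ^ 2 + torusDist (vec P.L k) (fermiPt 0) ^ 2)) = 1 := hnear
    rw [this]; norm_num
  · rw [hfar 0 (by decide)]
    have : P.χ (√(fFreq P.β k ^ 2 + torusDist (vec P.L k) (fermiPt 1) ^ 2)) = 1 := hnear
    rw [this]; norm_num

/-- The constant in the bound on the fermion propagator. -/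
def fermiConst (t a₀ X c₀ : ℝ) : ℝ :=
  3 * X * (1 + 4 / a₀ ^ 2) + 3 * X * (1 + a₀ ^ 2 / 4) / (t ^ 2 * c₀ ^ 2)

/-- Three regions: for |k₀| ≥ a₀/2 the frequency controls the denominator; for small k₀ near a Fermi
point the cutoff vanishes; for small k₀ elsewhere |Ω| ≥ c₀. The two terms of `fermiConst` belong to
the first and third. -/
theorem fermiCut_div_fermiDen_le (hβ : 0 < P.β) (ht : 0 < P.t) (ha : 0 < P.a₀) (hM : 1 < P.M)
    (haM : P.a₀ * P.M < Real.pi / 6) (hχ : IsCutoff P.a₀ P.M P.χ) (hX1 : 1 ≤ X)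
    (hX : ∀ s, |P.χ s| ≤ X) {c₀ : ℝ} (hc₀ : 0 < c₀)
    (hΩ : ∀ x ∈ Set.Icc (0 : ℝ) 1, ∀ y ∈ Set.Icc (0 : ℝ) 1, (∀ (ω : Fin 2) (z : ℤ × ℤ),
      P.a₀ / 2 ≤ len (x • b₁ + y • b₂ - fermiPt ω - (z.1 : ℝ) • b₁ - (z.2 : ℝ) • b₂)) →
      c₀ ≤ ‖Om (x • b₁ + y • b₂)‖) (hL : 1 ≤ P.L) {k : Mom} (hk : InBZ P.L k) :
    |fermiCut P k| / fermiDen P k ≤ fermiConst P.t P.a₀ X c₀ / (1 + fFreq P.β k ^ 2) := by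
  have hD := fermiDen_pos hβ k
  have hcut := abs_fermiCut_le hX1 hX k
  have hX0 : 0 < X := by linarith
  rw [div_le_div_iff₀ hD (by positivity)]
  set q := fFreq P.β k with hq
  have hC2 : 0 ≤ 3 * X * (1 + P.a₀ ^ 2 / 4) / (P.t ^ 2 * c₀ ^ 2) := by positivity
  have hC1 : 0 ≤ 3 * X * (1 + 4 / P.a₀ ^ 2) := by positivity
  rcases le_or_gt (P.a₀ / 2) |q| with h | h
  · have h1 : P.a₀ ^ 2 / 4 ≤ q ^ 2 := by
      rw [← sq_abs q]; nlinarith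
    have h2 : 1 + q ^ 2 ≤ (1 + 4 / P.a₀ ^ 2) * q ^ 2 := by
      have : 1 ≤ 4 / P.a₀ ^ 2 * q ^ 2 := by
        rw [div_mul_eq_mul_div, le_div_iff₀ (by positivity)]; linarith
      linarith
    calc |fermiCut P k| * (1 + q ^ 2) ≤ 3 * X * ((1 + 4 / P.a₀ ^ 2) * q ^ 2) := by gcongr
      _ = 3 * X * (1 + 4 / P.a₀ ^ 2) * q ^ 2 := by ring
      _ ≤ fermiConst P.t P.a₀ X c₀ * fermiDen P k := by
        refine mul_le_mul (le_add_of_nonneg_right hC2) (le_add_of_nonneg_right (by positivity))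
          (sq_nonneg _) (add_nonneg hC1 hC2)
  · by_cases hnear : ∃ (ω : Fin 2) (z : ℤ × ℤ),
        len (vec P.L k - fermiPt ω - (z.1 : ℝ) • b₁ - (z.2 : ℝ) • b₂) < P.a₀ / 2
    · obtain ⟨ω, z, hz⟩ := hnear
      rw [fermiCut_eq_zero ha hM haM hχ h hz, abs_zero, zero_mul]
      exact mul_nonneg (add_nonneg hC1 hC2) hD.le
    · push Not at hnear
      have hL0 : (0 : ℝ) < P.L := by exact_mod_cast hL
      simp only [InBZ, Finset.mem_product, Finset.mem_Ico] at hk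
      have hI : ∀ n : ℤ, 0 ≤ n → n < P.L → ((n : ℝ) / P.L) ∈ Set.Icc (0 : ℝ) 1 := by
        intro n h1 h2
        have h1' : (0 : ℝ) ≤ n := by exact_mod_cast h1
        have h2' : (n : ℝ) ≤ P.L := by exact_mod_cast h2.le
        exact ⟨by positivity, by rw [div_le_one hL0]; exact h2'⟩
      have hΩ1 : c₀ ≤ ‖Om (vec P.L k)‖ :=
        hΩ _ (hI _ hk.1.1 hk.1.2) _ (hI _ hk.2.1 hk.2.2) hnear
      have h1 : q ^ 2 ≤ P.a₀ ^ 2 / 4 := by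
        rw [← sq_abs q]; nlinarith [abs_nonneg q]
      calc |fermiCut P k| * (1 + q ^ 2) ≤ 3 * X * (1 + P.a₀ ^ 2 / 4) := by gcongr
        _ = 3 * X * (1 + P.a₀ ^ 2 / 4) / (P.t ^ 2 * c₀ ^ 2) * (P.t ^ 2 * c₀ ^ 2) := by
          field_simp
        _ ≤ fermiConst P.t P.a₀ X c₀ * fermiDen P k := by
          refine mul_le_mul (le_add_of_nonneg_left hC1) ?_ (by positivity) (add_nonneg hC1 hC2)
          unfold fermiDen
          have : P.t ^ 2 * c₀ ^ 2 ≤ P.t ^ 2 * ‖Om (vec P.L k)‖ ^ 2 := by gcongr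
          nlinarith [sq_nonneg (fFreq P.β k)]

end Fermion

/-! ### Sums over frequencies -/

section Sums

/-- Since (1 + y)² ≤ 2(1 + y²), each term is dominated by a telescoping difference of 2/(h(1 + hn)).
-/
theorem sum_inv_one_add_sq_le {h : ℝ} (hh : 0 < h) (n : ℕ) :
    ∑ i ∈ Finset.range n, 1 / (1 + (h * (i : ℝ)) ^ 2) ≤ 1 + 2 / h := by
  have key : ∀ n : ℕ, ∑ i ∈ Finset.range (n + 1), 1 / (1 + (h * (i : ℝ)) ^ 2) ≤
      1 + 2 / h - 2 / h * (1 / (1 + h * n)) := by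
    intro n
    induction n with
    | zero => simp
    | succ n ih =>
      rw [Finset.sum_range_succ]
      have h1 : 1 / (1 + (h * ((n + 1 : ℕ) : ℝ)) ^ 2) ≤
          2 / h * (1 / (1 + h * n)) - 2 / h * (1 / (1 + h * ((n + 1 : ℕ) : ℝ))) := by
        have e : 2 / h * (1 / (1 + h * n)) - 2 / h * (1 / (1 + h * ((n + 1 : ℕ) : ℝ))) =
            2 / ((1 + h * n) * (1 + h * ((n + 1 : ℕ) : ℝ))) := by
          push_cast
          field_simp
          ring
        rw [e, div_le_div_iff₀ (by positivity) (by positivity)]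
        push_cast
        have h2 : 0 ≤ h * n := by positivity
        nlinarith [sq_nonneg (1 - h * ((n : ℝ) + 1))]
      linarith
  cases n with
  | zero => simp; positivity
  | succ n =>
    refine (key n).trans ?_
    have : 0 ≤ 2 / h * (1 / (1 + h * n)) := by positivity
    linarith

theorem tsum_int_le {f : ℤ → ℝ} {h : ℝ} (hh : 0 < h) (hf0 : ∀ n, 0 ≤ f n)
    (hf : ∀ n : ℕ, f n ≤ 1 / (1 + (h * (n : ℝ)) ^ 2))
    (hf' : ∀ n : ℕ, f (-(n + 1 : ℤ)) ≤ 1 / (1 + (h * (n : ℝ)) ^ 2)) :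
    Summable f ∧ ∑' n, f n ≤ 2 + 4 / h := by
  have h1 : ∀ n, ∑ i ∈ Finset.range n, f (i : ℤ) ≤ 1 + 2 / h := fun n =>
    (Finset.sum_le_sum fun i _ => hf i).trans (sum_inv_one_add_sq_le hh n)
  have h2 : ∀ n, ∑ i ∈ Finset.range n, f (-(i + 1 : ℤ)) ≤ 1 + 2 / h := fun n =>
    (Finset.sum_le_sum fun i _ => hf' i).trans (sum_inv_one_add_sq_le hh n)
  have s1 : Summable fun n : ℕ => f (n : ℤ) := summable_of_sum_range_le (fun n => hf0 _) h1
  have s2 : Summable fun n : ℕ => f (-(n + 1 : ℤ)) := summable_of_sum_range_le (fun n => hf0 _) h2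
  refine ⟨Summable.of_nat_of_neg_add_one s1 s2, ?_⟩
  rw [tsum_of_nat_of_neg_add_one s1 s2]
  have t1 := Real.tsum_le_of_sum_range_le (fun n => hf0 _) h1
  have t2 := Real.tsum_le_of_sum_range_le (fun n => hf0 _) h2
  have : 4 / h = 2 / h + 2 / h := by ring
  linarith

/-- The summand depends on the frequency alone, so a finite box of spatial labels multiplies the
frequency sum by its cardinality. -/
theorem tsum_box_le {φ : ℤ → ℝ} (hφ0 : ∀ n, 0 ≤ φ n) (hφ : Summable φ) (s : Finset (ℤ × ℤ)) :
    (Summable fun p : Mom => if p.2 ∈ s then φ p.1 else 0) ∧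
      ∑' p : Mom, (if p.2 ∈ s then φ p.1 else 0) ≤ s.card * ∑' n, φ n := by
  have h0 : ∀ p : Mom, 0 ≤ if p.2 ∈ s then φ p.1 else 0 := fun p => by
    split_ifs <;> simp [hφ0]
  have key : ∀ u : Finset Mom, ∑ p ∈ u, (if p.2 ∈ s then φ p.1 else 0) ≤
      s.card * ∑' n, φ n := by
    intro u
    rw [← Finset.sum_filter]
    have h1 : u.filter (fun p => p.2 ∈ s) ⊆ u.image Prod.fst ×ˢ s := fun p hp => by
      rw [Finset.mem_filter] at hp
      exact Finset.mem_product.mpr ⟨Finset.mem_image_of_mem _ hp.1, hp.2⟩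
    refine (Finset.sum_le_sum_of_subset_of_nonneg h1 fun p _ _ => hφ0 _).trans ?_
    rw [Finset.sum_product_right]
    dsimp only
    rw [Finset.sum_const, nsmul_eq_mul]
    exact mul_le_mul_of_nonneg_left (hφ.sum_le_tsum _ fun n _ => hφ0 n) (by positivity)
  exact ⟨summable_of_sum_le h0 key, Real.tsum_le_of_sum_le h0 key⟩

end Sums

/-! ### Uniform bounds on the propagators -/

section Uniform

variable {P : Params}

theorem Conv.of_eventually_eq {f : ℕ → ℂ} {a : ℂ} {K₀ : ℕ} (h : ∀ K, K₀ ≤ K → f K = a) : Conv f :=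
  ⟨a, tendsto_const_nhds.congr' (Filter.eventually_atTop.mpr ⟨K₀, fun K hK => (h K hK).symm⟩)⟩

theorem exists_cutoff_large (ha : 0 < P.a₀) (hM : 1 < P.M) (x : ℝ) :
    ∃ K₀ : ℕ, ∀ K, K₀ ≤ K → |x| < P.a₀ * P.M ^ K := by
  obtain ⟨K₀, hK₀⟩ := pow_unbounded_of_one_lt (|x| / P.a₀) hM
  refine ⟨K₀, fun K hK => ?_⟩
  rw [div_lt_iff₀ ha, mul_comm] at hK₀
  exact hK₀.trans_le (by gcongr; exact hM.le)

/-- The label box adds no constraint: since 2π > 1, the frequency bound already confines the integer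
label to it. -/
theorem mem_bModes_iff (hβ : 0 < P.β) {K : ℕ} {p : Mom} :
    p ∈ bModes P K ↔ (p.2 ∈ Finset.Icc (-(P.L : ℤ)) P.L ×ˢ Finset.Icc (-(P.L : ℤ)) P.L ∧
      len (vec P.L p) < P.a₀ * P.M) ∧ |bFreq P.β p| < P.a₀ * P.M ^ (K + 1) := by
  simp only [bModes, Finset.mem_filter, Finset.mem_product, freqBox]
  refine ⟨fun h => ⟨⟨h.1.2, h.2.2⟩, h.2.1⟩, fun h => ⟨⟨?_, h.1.1⟩, h.2, h.1.2⟩⟩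
  set A := P.a₀ * P.M ^ (K + 1)
  have h1 : |(p.1 : ℝ)| ≤ P.β * A := by
    have h2 := h.2
    have hpi := Real.pi_gt_three
    rw [bFreq, abs_mul, abs_of_pos (by positivity), div_mul_eq_mul_div, div_lt_iff₀ hβ] at h2
    nlinarith [abs_nonneg (p.1 : ℝ)]
  have h3 : (|p.1| : ℝ) ≤ ⌈P.β * A⌉ := h1.trans (Int.le_ceil _)
  have h4 : |p.1| ≤ ⌈P.β * A⌉ := by exact_mod_cast h3
  rw [Finset.mem_Icc]
  exact abs_le.mp h4

theorem mem_fModes_iff (hβ : 0 < P.β) {K : ℕ} {k : Mom} :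
    k ∈ fModes P K ↔ InBZ P.L k ∧ |fFreq P.β k| < P.a₀ * P.M ^ (K + 1) := by
  simp only [fModes, Finset.mem_filter, Finset.mem_product, freqBox, InBZ]
  refine ⟨fun h => ⟨h.1.2, h.2⟩, fun h => ⟨⟨?_, h.1⟩, h.2⟩⟩
  set A := P.a₀ * P.M ^ (K + 1)
  have h0 : (1 / 2 : ℝ) ≤ |(k.1 : ℝ) + 1 / 2| := by
    rcases le_or_gt 0 k.1 with h1 | h1
    · have : (0 : ℝ) ≤ k.1 := by exact_mod_cast h1
      rw [abs_of_nonneg (by linarith)]; linarith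
    · have : (k.1 : ℝ) ≤ -1 := by exact_mod_cast (show k.1 ≤ -1 by omega)
      rw [abs_of_nonpos (by linarith)]; linarith
  have h1 : |(k.1 : ℝ)| ≤ P.β * A := by
    have h2 := h.2
    have hpi := Real.pi_gt_three
    rw [fFreq, abs_mul, abs_of_pos (by positivity), div_mul_eq_mul_div, div_lt_iff₀ hβ] at h2
    have h5 : |(k.1 : ℝ)| ≤ |(k.1 : ℝ) + 1 / 2| + 1 / 2 := by
      have := abs_sub ((k.1 : ℝ) + 1 / 2) (1 / 2)
      rw [add_sub_cancel_right, abs_of_pos (by norm_num : (0 : ℝ) < 1 / 2)] at this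
      exact this
    nlinarith [abs_nonneg ((k.1 : ℝ) + 1 / 2)]
  have h3 : (|k.1| : ℝ) ≤ ⌈P.β * A⌉ := h1.trans (Int.le_ceil _)
  have h4 : |k.1| ≤ ⌈P.β * A⌉ := by exact_mod_cast h3
  rw [Finset.mem_Icc]
  exact abs_le.mp h4

theorem neg_mem_bModes (hβ : 0 < P.β) {K : ℕ} {p : Mom} (hp : p ∈ bModes P K) :
    -p ∈ bModes P K := by
  rw [mem_bModes_iff hβ] at hp ⊢
  simp only [Finset.mem_product, Finset.mem_Icc] at hp ⊢
  have h1 : vec P.L (-p) = -vec P.L p := by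
    simp only [vec, Prod.snd_neg, Prod.fst_neg]; push_cast; module
  have h2 : bFreq P.β (-p) = -bFreq P.β p := by
    simp only [bFreq, Prod.fst_neg]; push_cast; ring
  have h3 : len (-vec P.L p) = len (vec P.L p) := by simp [len]
  rw [h1, h2, h3, abs_neg]
  refine ⟨⟨?_, hp.1.2⟩, hp.2⟩
  simp only [Prod.snd_neg, Prod.fst_neg]
  omega

/-- K enters only through χ_K(p₀) and the mode set, and both stabilize once a₀M^K exceeds |p₀|. -/
theorem photon_conv (hβ : 0 < P.β) (ha : 0 < P.a₀) (hM : 1 < P.M) (hχ : IsCutoff P.a₀ P.M P.χ)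
    (p : Mom) : Conv fun K => if p ∈ bModes P K then (photonPropUV P K p : ℂ) else 0 := by
  by_cases hp : p.2 ∈ Finset.Icc (-(P.L : ℤ)) P.L ×ˢ Finset.Icc (-(P.L : ℤ)) P.L ∧
      len (vec P.L p) < P.a₀ * P.M
  · obtain ⟨K₀, hK₀⟩ := exists_cutoff_large ha hM (bFreq P.β p)
    refine Conv.of_eventually_eq (a := photonPropUV P K₀ p) (K₀ := K₀) fun K hK => ?_
    rw [if_pos ((mem_bModes_iff hβ).mpr ⟨hp, hK₀ (K + 1) (by omega)⟩)]
    have h1 : chiUV P K (bFreq P.β p) = chiUV P K₀ (bFreq P.β p) := by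
      rw [chiUV_eq_one hχ hM (hK₀ K hK).le, chiUV_eq_one hχ hM (hK₀ K₀ le_rfl).le]
    simp only [photonPropUV, photonProp, photonPropIR, h1]
  · refine Conv.of_eventually_eq (a := 0) (K₀ := 0) fun K _ => ?_
    rw [if_neg fun h => hp ((mem_bModes_iff hβ).mp h).1]

theorem fermion_conv (hβ : 0 < P.β) (ha : 0 < P.a₀) (hM : 1 < P.M) (hχ : IsCutoff P.a₀ P.M P.χ)
    (k : Mom) (ρ ρ' : Fin 2) : Conv fun K => if k ∈ fModes P K then gUV P K k ρ ρ' else 0 := by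
  by_cases hk : InBZ P.L k
  · obtain ⟨K₀, hK₀⟩ := exists_cutoff_large ha hM (fFreq P.β k)
    refine Conv.of_eventually_eq (a := gUV P K₀ k ρ ρ') (K₀ := K₀) fun K hK => ?_
    rw [if_pos ((mem_fModes_iff hβ).mpr ⟨hk, hK₀ (K + 1) (by omega)⟩), gUV_eq_mul, gUV_eq_mul,
      chiUV_eq_one hχ hM (hK₀ K hK).le, chiUV_eq_one hχ hM (hK₀ K₀ le_rfl).le]
  · refine Conv.of_eventually_eq (a := 0) (K₀ := 0) fun K _ => ?_
    rw [if_neg fun h => hk ((mem_fModes_iff hβ).mp h).1]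

/-- The diagonal part of the fermion propagator is odd in the frequency. -/
theorem sum_gUV_diag (hβ : 0 < P.β) (K : ℕ) (ρ : Fin 2) : ∑ k ∈ fModes P K, gUV P K k ρ ρ = 0 := by
  have hfreq : ∀ k : Mom, fFreq P.β (-1 - k.1, k.2) = -fFreq P.β k := fun k => by
    simp only [fFreq]; push_cast; ring
  have hvec : ∀ k : Mom, vec P.L (-1 - k.1, k.2) = vec P.L k := fun k => rfl
  -- The reflection k₀ ↦ -k₀ acts on labels as n ↦ -1 - n, without fixed point because Matsubara
  -- frequencies are half-integer.
  refine Finset.sum_involution (fun k _ => ((-1 - k.1, k.2) : Mom)) (fun k _ => ?_)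
    (fun k _ _ h => ?_) (fun k hk => ?_) fun k _ => ?_
  · rw [gUV_diag, gUV_diag]
    simp only [fermiCut, fermiDen, chiUV, hfreq, hvec, abs_neg, neg_sq]
    push_cast
    ring
  · have := congrArg Prod.fst h
    simp only at this
    omega
  · rw [mem_fModes_iff hβ] at hk ⊢
    rw [hfreq, abs_neg]
    exact hk
  · exact Prod.ext (by simp) rfl

theorem sum_freq_le {β β₀ : ℝ} (hβ₀ : 0 < β₀) (hβ : β₀ ≤ β) {f : ℤ → ℝ} (hf0 : ∀ n, 0 ≤ f n)
    (hf : ∀ n : ℕ, f n ≤ 1 / (1 + (2 * Real.pi / β * (n : ℝ)) ^ 2))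
    (hf' : ∀ n : ℕ, f (-(n + 1 : ℤ)) ≤ 1 / (1 + (2 * Real.pi / β * (n : ℝ)) ^ 2)) :
    Summable f ∧ ∑' n, f n ≤ (2 / β₀ + 1) * β := by
  have hβ1 : 0 < β := hβ₀.trans_le hβ
  obtain ⟨h1, h2⟩ := tsum_int_le (h := 2 * Real.pi / β) (by positivity) hf0 hf hf'
  refine ⟨h1, h2.trans ?_⟩
  -- The additive constant of the frequency sum is turned into a multiple of β; this is where the
  -- temperature must stay bounded.
  have h3 : 2 ≤ 2 / β₀ * β := by rw [div_mul_eq_mul_div, le_div_iff₀ hβ₀]; linarith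
  have h4 : 4 / (2 * Real.pi / β) ≤ β := by
    rw [div_div_eq_mul_div, div_le_iff₀ (by positivity)]
    nlinarith [Real.pi_gt_three]
  linarith

theorem inv_one_add_sq_le {x y : ℝ} (h : |y| ≤ |x|) : 1 / (1 + x ^ 2) ≤ 1 / (1 + y ^ 2) := by
  have := sq_le_sq.mpr h
  gcongr

theorem bFreq_sum {β β₀ : ℝ} (hβ₀ : 0 < β₀) (hβ : β₀ ≤ β) :
    (Summable fun n : ℤ => 1 / (1 + (2 * Real.pi / β * (n : ℝ)) ^ 2)) ∧
      ∑' n : ℤ, 1 / (1 + (2 * Real.pi / β * (n : ℝ)) ^ 2) ≤ (2 / β₀ + 1) * β := by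
  have hβ1 : 0 < β := hβ₀.trans_le hβ
  refine sum_freq_le hβ₀ hβ (fun n => by positivity) (fun n => by simp) fun n =>
    inv_one_add_sq_le ?_
  rw [abs_mul, abs_mul]
  refine mul_le_mul_of_nonneg_left ?_ (abs_nonneg _)
  push_cast
  rw [abs_neg, abs_of_nonneg (by positivity), abs_of_nonneg (by positivity)]
  linarith

theorem fFreq_sum {β β₀ : ℝ} (hβ₀ : 0 < β₀) (hβ : β₀ ≤ β) :
    (Summable fun n : ℤ => 1 / (1 + (2 * Real.pi / β * ((n : ℝ) + 1 / 2)) ^ 2)) ∧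
      ∑' n : ℤ, 1 / (1 + (2 * Real.pi / β * ((n : ℝ) + 1 / 2)) ^ 2) ≤ (2 / β₀ + 1) * β := by
  have hβ1 : 0 < β := hβ₀.trans_le hβ
  refine sum_freq_le hβ₀ hβ (fun n => by positivity) (fun n => inv_one_add_sq_le ?_) fun n =>
    inv_one_add_sq_le ?_
  · rw [abs_mul, abs_mul]
    refine mul_le_mul_of_nonneg_left ?_ (abs_nonneg _)
    push_cast
    rw [abs_of_nonneg (by positivity), abs_of_nonneg (by positivity)]
    linarith
  · rw [abs_mul, abs_mul]
    refine mul_le_mul_of_nonneg_left ?_ (abs_nonneg _)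
    push_cast
    have : (0 : ℝ) ≤ n := by positivity
    rw [abs_of_nonneg this, abs_of_nonpos (by linarith)]
    linarith

end Uniform

-- Pointwise decay in the frequency, times spatial boxes of at most 9L² points, gives sums
-- proportional to βL², the volume. No constant below involves β, L or h*.
set_option maxHeartbeats 1000000 in
theorem exists_uvBounds {t a₀ M : ℝ} {χ : ℝ → ℝ} (ht : 0 < t) (ha₀ : 0 < a₀) (hM : 1 < M)
    (haM : a₀ * M < Real.pi / 6) (hχ : IsCutoff a₀ M χ) {β₀ : ℝ} (hβ₀ : 0 < β₀) :
    ∃ c, 0 < c ∧ ∀ (β : ℝ) (L : ℕ) (hstar : ℤ), β₀ ≤ β → 1 ≤ L → hstar < 0 →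
      UVBounds ⟨t, a₀, M, χ, β, L, hstar⟩ c := by
  obtain ⟨X, hX1, hX⟩ := hχ.exists_bound
  obtain ⟨c₀, hc₀, hΩ⟩ := exists_Om_ge (show 0 < a₀ / 2 by positivity)
  have hX0 : 0 < X := by linarith
  set Cw := 2 * a₀ * M * X ^ 2 * ((1 + a₀ ^ 2) / a₀ ^ 2) with hCw
  have hCw0 : 0 < Cw := by positivity
  set Cs := 2 / β₀ + 1 with hCs
  have hCs0 : 0 < Cs := by positivity
  set Cd := fermiConst t a₀ X c₀ with hCd
  have hCd0 : 0 < Cd := by rw [hCd, fermiConst]; positivity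
  -- XCd serves the diagonal and 3tXCd the off-diagonal entries, as |Ω| ≤ 3. The final 1 gives Cg ≤
  -- Cg².
  set Cg := X * Cd * (1 + 3 * t) + 1 with hCg
  have hCg1 : 1 ≤ Cg := by
    have : 0 ≤ X * Cd * (1 + 3 * t) := by positivity
    linarith
  have hCg0 : 0 < Cg := by linarith
  -- One summand for each numerical requirement of `UVBounds`; the 9 comes from (2L + 1)² ≤ 9L².
  set c := 1 + Cw + 9 * (Cw * Cs) + Cg + Cg ^ 2 * Cs with hc
  have hA := mul_pos hCw0 hCs0
  have hB : 0 < Cg ^ 2 * Cs := by positivity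
  refine ⟨c, by linarith, fun β L hstar hβ hL hh => ?_⟩
  have hβ1 : 0 < β := hβ₀.trans_le hβ
  set P : Params := ⟨t, a₀, M, χ, β, L, hstar⟩ with hP
  have hL1 : (1 : ℝ) ≤ L := by exact_mod_cast hL
  have hvol : vol P = β * (L : ℝ) ^ 2 := rfl
  have havol : vol P ≤ avol P := by
    have h3 : (1 : ℝ) ≤ √3 := Real.one_le_sqrt.mpr (by norm_num)
    have h : avol P = 3 * √3 / 2 * vol P := by unfold avol vol area sites; ring
    have h0 : 0 < vol P := by rw [hvol]; positivity
    rw [h]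
    nlinarith
  have hw : ∀ K p, |photonPropUV P K p| ≤ Cw / (1 + bFreq β p ^ 2) := fun K p =>
    abs_photonPropUV_le (P := P) ha₀ hM hχ hh hX1 hX K p
  have hdiv : ∀ C x : ℝ, 0 ≤ C → C / (1 + x ^ 2) ≤ C := fun C x hC =>
    div_le_self hC (by nlinarith [sq_nonneg x])
  refine ⟨hβ1, hL, by linarith, fun K p hp => neg_mem_bModes hβ1 hp, fun K p _ => ?_, ?_,
    photon_conv hβ1 ha₀ hM hχ, ?_, fermion_conv hβ1 ha₀ hM hχ, sum_gUV_diag hβ1⟩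
  · exact ((hw K p).trans (hdiv _ _ hCw0.le)).trans (by linarith)
  · obtain ⟨s1, s2⟩ := bFreq_sum hβ₀ hβ
    obtain ⟨s3, s4⟩ := tsum_box_le (φ := fun n : ℤ => Cw * (1 / (1 + (2 * Real.pi / β * (n : ℝ)) ^ 2)))
      (fun n => by positivity) (s1.mul_left Cw)
      (Finset.Icc (-(L : ℤ)) L ×ˢ Finset.Icc (-(L : ℤ)) L)
    refine ⟨_, fun p => ?_, s3, s4.trans ?_, fun K p hp => ?_⟩
    · split_ifs <;> positivity
    · rw [tsum_mul_left, Finset.card_product, Int.card_Icc]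
      have h1 : (((L : ℤ) + 1 - -(L : ℤ)).toNat : ℝ) ≤ 3 * L := by
        have : ((L : ℤ) + 1 - -(L : ℤ)).toNat ≤ 3 * L := by omega
        exact_mod_cast this
      rw [Nat.cast_mul]
      calc _ ≤ (3 * (L : ℝ)) * (3 * L) * (Cw * (Cs * β)) := by gcongr
        _ = 9 * (Cw * Cs) * vol P := by rw [hvol]; ring
        _ ≤ c * avol P := by
          refine mul_le_mul (by linarith) havol ?_ (by linarith)
          rw [hvol]; positivity
    · rw [if_pos ((mem_bModes_iff (P := P) hβ1).mp hp).1.1, mul_one_div]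
      exact hw K p
  · obtain ⟨s1, s2⟩ := fFreq_sum hβ₀ hβ
    obtain ⟨s3, s4⟩ := tsum_box_le
      (φ := fun n : ℤ => Cg ^ 2 * (1 / (1 + (2 * Real.pi / β * ((n : ℝ) + 1 / 2)) ^ 2)))
      (fun n => by positivity) (s1.mul_left (Cg ^ 2))
      (Finset.Ico (0 : ℤ) L ×ˢ Finset.Ico (0 : ℤ) L)
    -- Decay of order 1/|k₀| is what the diagonal part allows; G² then has the decay of the
    -- off-diagonal part.
    set G : Mom → ℝ := fun k => if InBZ L k then Cg / √(1 + fFreq β k ^ 2) else 0 with hG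
    have hsq : ∀ x : ℝ, √(1 + x ^ 2) ^ 2 = 1 + x ^ 2 := fun x => Real.sq_sqrt (by positivity)
    have hG2 : ∀ k, G k ^ 2 = if k.2 ∈ Finset.Ico (0 : ℤ) L ×ˢ Finset.Ico (0 : ℤ) L then
        Cg ^ 2 * (1 / (1 + (2 * Real.pi / β * ((k.1 : ℝ) + 1 / 2)) ^ 2)) else 0 := by
      intro k
      by_cases h : k.2 ∈ Finset.Ico (0 : ℤ) L ×ˢ Finset.Ico (0 : ℤ) L
      · have e : G k = Cg / √(1 + fFreq β k ^ 2) := if_pos (show InBZ L k from h)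
        rw [if_pos h, e, div_pow, hsq, mul_one_div]; rfl
      · have e : G k = 0 := if_neg (show ¬ InBZ L k from h)
        rw [if_neg h, e]; norm_num
    have h1s : ∀ x : ℝ, 1 ≤ √(1 + x ^ 2) := fun x =>
      Real.one_le_sqrt.mpr (by nlinarith [sq_nonneg x])
    have hcd : ∀ k, InBZ L k → |fermiCut P k| / fermiDen P k ≤ Cd / (1 + fFreq β k ^ 2) :=
      fun k hk => fermiCut_div_fermiDen_le (P := P) hβ1 ht ha₀ hM haM hχ hX1 hX hc₀ hΩ hL hk
    have hoff : ∀ K, ∀ k ∈ fModes P K, ∀ ρ ρ', ρ ≠ ρ' →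
        ‖gUV P K k ρ ρ'‖ ≤ Cg / (1 + fFreq β k ^ 2) := by
      intro K k hk ρ ρ' hρ
      have hbz := inBZ_of_mem hk
      rw [norm_gUV_off (P := P) hβ1 ht K k hρ]
      have hx : |chiUV P K (fFreq P.β k)| ≤ X := hX _
      have hO := norm_Om_le (vec P.L k)
      have hD := fermiDen_pos (P := P) hβ1 k
      have hT : P.t = t := rfl
      rw [hT]
      calc |fermiCut P k| * |chiUV P K (fFreq P.β k)| * (t * ‖Om (vec P.L k)‖ / fermiDen P k)
          = (|fermiCut P k| / fermiDen P k) * (|chiUV P K (fFreq P.β k)| *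
            (t * ‖Om (vec P.L k)‖)) := by ring
        _ ≤ (Cd / (1 + fFreq β k ^ 2)) * (X * (t * 3)) :=
          mul_le_mul (hcd k hbz) (by gcongr) (by positivity) (by positivity)
        _ = X * Cd * (3 * t) / (1 + fFreq β k ^ 2) := by ring
        _ ≤ Cg / (1 + fFreq β k ^ 2) := by
          gcongr
          have : 0 ≤ X * Cd := by positivity
          rw [hCg]
          linarith
    have hdg : ∀ K, ∀ k ∈ fModes P K, ∀ ρ, ‖gUV P K k ρ ρ‖ ≤ Cg / √(1 + fFreq β k ^ 2) := by
      intro K k hk ρ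
      have hbz := inBZ_of_mem hk
      rw [norm_gUV_diag (P := P) hβ1 K k]
      have hx : |chiUV P K (fFreq P.β k)| ≤ X := hX _
      have hD := fermiDen_pos (P := P) hβ1 k
      have hk0 : |fFreq P.β k| ≤ √(1 + fFreq β k ^ 2) :=
        Real.abs_le_sqrt (le_add_of_nonneg_left zero_le_one)
      have hs0 := h1s (fFreq β k)
      calc |fermiCut P k| * |chiUV P K (fFreq P.β k)| * (|fFreq P.β k| / fermiDen P k)
          = (|fermiCut P k| / fermiDen P k) * (|chiUV P K (fFreq P.β k)| * |fFreq P.β k|) := by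
            ring
        _ ≤ (Cd / (1 + fFreq β k ^ 2)) * (X * √(1 + fFreq β k ^ 2)) :=
          mul_le_mul (hcd k hbz) (by gcongr) (by positivity) (by positivity)
        _ = X * Cd / √(1 + fFreq β k ^ 2) := by
          have hs := hsq (fFreq β k)
          generalize √(1 + fFreq β k ^ 2) = s at hs hs0
          have : s ≠ 0 := by linarith
          rw [← hs]
          field_simp
        _ ≤ Cg / √(1 + fFreq β k ^ 2) := by
          gcongr
          have : 0 ≤ X * Cd * (3 * t) := by positivity
          rw [hCg]
          linarith
    have hGk : ∀ K, ∀ k ∈ fModes P K, G k = Cg / √(1 + fFreq β k ^ 2) := fun K k hk =>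
      if_pos (inBZ_of_mem hk)
    refine ⟨G, fun k => ?_, fun k => ?_, ?_, ?_, fun K k hk ρ ρ' => ?_, fun K k hk ρ ρ' hρ => ?_⟩
    · simp only [hG]; split_ifs <;> positivity
    · simp only [hG]
      split_ifs
      · exact (div_le_self hCg0.le (h1s _)).trans (by linarith)
      · linarith
    · simp only [hG2]; exact s3
    · simp only [hG2]
      refine s4.trans ?_
      rw [tsum_mul_left, Finset.card_product, Int.card_Ico]
      simp only [sub_zero, Int.toNat_natCast]
      rw [Nat.cast_mul]
      calc _ ≤ (L : ℝ) * L * (Cg ^ 2 * (Cs * β)) := by gcongr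
        _ = Cg ^ 2 * Cs * vol P := by rw [hvol]; ring
        _ ≤ c * vol P := by
          refine mul_le_mul_of_nonneg_right (by linarith) ?_
          rw [hvol]; positivity
    · rw [hGk K k hk]
      by_cases hρ : ρ = ρ'
      · subst hρ; exact hdg K k hk ρ
      · refine (hoff K k hk ρ ρ' hρ).trans ?_
        have h2 : √(1 + fFreq β k ^ 2) ≤ 1 + fFreq β k ^ 2 := by
          calc √(1 + fFreq β k ^ 2) ≤ √(1 + fFreq β k ^ 2) ^ 2 := le_self_pow₀ (h1s _) two_ne_zero
            _ = _ := hsq _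
        have := h1s (fFreq β k)
        gcongr
    · rw [hGk K k hk, div_pow, hsq]
      refine (hoff K k hk ρ ρ' hρ).trans ?_
      rw [mul_div_assoc']
      gcongr
      have h1c : 1 ≤ c := by linarith
      calc Cg ≤ Cg ^ 2 := le_self_pow₀ hCg1 two_ne_zero
        _ ≤ c * Cg ^ 2 := le_mul_of_one_le_left (by positivity) h1c
end Graphene

end

/-! ### Conclusion. -/

open Graphene in
theorem lemma2 (t a₀ M : ℝ) (χ : ℝ → ℝ) (ht : 0 < t) (ha₀ : 0 < a₀) (hM : 1 < M)
    (haM : a₀ * M < Real.pi / 6) (hχ : IsCutoff a₀ M χ) (β₀ : ℝ) (hβ₀ : 0 < β₀) :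
    ∃ (C : ℝ) (Cnm : ℕ → ℕ → ℝ), 0 < C ∧ (∀ n m, 0 < Cnm n m) ∧
      ∀ (β : ℝ) (L : ℕ) (hstar : ℤ), β₀ ≤ β → 1 ≤ L → hstar < 0 →
        -- free energy: bound uniform in the cutoffs, and limit of every coefficient
        (∀ K N : ℕ, ‖freeEnergy ⟨t, a₀, M, χ, β, L, hstar⟩ K N‖ ≤
          C ^ N * Real.Gamma ((N : ℝ) / 2 + 1)) ∧
        (∀ N : ℕ, ∃ F : ℂ, Filter.Tendsto
          (fun K : ℕ => freeEnergy ⟨t, a₀, M, χ, β, L, hstar⟩ K N) Filter.atTop (nhds F)) ∧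
        -- the effective potential has kernels `W K N n m`, the coefficients of `e ^ N`
        ∃ W : ℕ → ℕ → (n m : ℕ) → Kernel n m,
          (∀ K N n m : ℕ, N < n ∨ N < m → W K N n m = 0) ∧
          (∀ K N : ℕ, effectivePotential ⟨t, a₀, M, χ, β, L, hstar⟩ K N =
            ∑ nm ∈ (Finset.range (N + 1) ×ˢ Finset.range (N + 1)).filter
                (fun nm : ℕ × ℕ => 1 ≤ nm.1 + nm.2),
              fieldPoly ⟨t, a₀, M, χ, β, L, hstar⟩ K (W K N nm.1 nm.2)) ∧
          (∀ (K N n m : ℕ) ρ μ k p, ‖W K N n m ρ μ k p‖ ≤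
            Cnm n m ^ N * Real.Gamma ((N : ℝ) / 2 + 1)) ∧
          (∀ (N n m : ℕ) ρ μ k p, ∃ W₀ : ℂ, Filter.Tendsto
            (fun K : ℕ => W K N n m ρ μ k p) Filter.atTop (nhds W₀)) := by
  obtain ⟨c, hc, hU⟩ := exists_uvBounds ht ha₀ hM haM hχ hβ₀
  -- The rate depends on the parameters only through t and c, so β, L and h* are filled with dummy
  -- zeros; one rate serves all n and m.
  refine ⟨effRate ⟨t, a₀, M, χ, 0, 0, 0⟩ c, fun _ _ => effRate ⟨t, a₀, M, χ, 0, 0, 0⟩ c,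
    effRate_pos hc, fun _ _ => effRate_pos hc, fun β L hstar hβ hL hh => ?_⟩
  exact effectivePotential_kernels (hU β L hstar hβ hL hh)
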